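/- Let $p>2$ and $n>1$ be integers. Put $[j]=0$ for $1\le j\le p$ and $[j]=1$ for $p<j\le p+2n$, and let $h=(h_{jk})$ be an orthosymplectic metric: a nondegenerate complex $(p+2n)\times(p+2n)$-matrix with $h_{jk}=0$ if $[j]\ne[k]$ and $h_{kj}=(-1)^{[j][k]}h_{jk}$; define $h^{jk}$ by $\sum_j h^{jl}h_{jk}=\delta^l_k$. Let $\mathcal P=\mathbb C[X_1,\dots,X_p]\otimes\Lambda(X_{p+1},\dots,X_{p+2n})$ be the algebra of polynomials on $\mathbb R^{p|2n}$, with $$R^2=\sum_{j,k}X_jh^{jk}X_k,\qquad \Delta=\sum_{j,k}\partial_{X_j}h_{jk}\partial_{X_k},\qquad \mathbb E=\sum_jX_j\partial_{X_j},$$ $\mathcal H_k=\{P\in\mathcal P:\Delta P=0,\ \mathbb EP=kP\}$ and $\mathcal H=\bigoplus_{k\ge0}\mathcal H_k$ (harmonic polynomials). Let $g=\begin{pmatrix}0&1\\1&0\end{pmatrix}\oplus h$ on $\mathbb C^{p+2|2n}$ (the two new indices $1,2$ are even, and $j$ becomes $j+2$). For an orthosymplectic metric $g$, the Lie superalgebra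 $\mathfrak{osp}(p+2|2n)$ consists of the matrices $A$ with $\sum_c\big(g_{ac}A^c{}_b+(-1)^{[b]([a]+[c])}A^c{}_ag_{cb}\big)=0$; $\mathfrak{osp}(p|2n)$ is defined likewise by $h$ and embedded as lower right blocks. Let $A\in\mathfrak{osp}(p+2|2n)$ act on $\mathcal P$ by $$\mathcal D_A=\sum_a\Phi_a\Big(A^a{}_1\big(1-\tfrac{p-2n}{2}-\mathbb E\big)+\sum_jA^a{}_{j+2}\,\partial_{X_j}\Big),\qquad \Phi_1=1,\ \Phi_2=-\tfrac12R^2,\ \Phi_{i+2}=X_i .$$ Thus $\mathfrak{osp}(p|2n)$ acts by $\sum A^i{}_jX_i\partial_{X_j}$, and the remaining elements act by multiples of the operators $\partial_{X^j}$, $X_j(2\mathbb E+p-2n-2)-R^2\partial_{X^j}$ and $2\mathbb E+p-2n-2$. **Theorem.** $A\mapsto\mathcal D_A$ is a representation of the Lie superalgebra $\mathfrak{osp}(p+2|2n)$, and $\mathcal H$ is a subrepresentation. Let $\mathbb N=\{0,1,2,\dots\}$. 1. If $p-2n\notin 2-2\mathbb N$, then $\mathcal H$ is an irreducible $\mathfrak{osp}(p+2|2n)$-module.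 2. If $p-2n=2-2q$ with $q\in\mathbb N$, then $\mathcal H$ is indecomposable, and it has exactly one nonzero proper submodule, namely $$\mathcal U=\bigoplus_{j=0}^{q}\mathcal H_j\ \oplus\bigoplus_{j=q+1}^{2q}R^{2j-2q}\mathcal H_{2q-j},$$ and $\mathcal U$ is irreducible. The sum is direct, and each of its summands is an irreducible $\mathfrak{osp}(p|2n)$-module. As an $\mathfrak{osp}(p+2|2n)$-module $\mathcal U$ is isomorphic to $K^{p+2|2n}_{q\epsilon_1}$, the irreducible module with highest weight $q\epsilon_1$ with respect to the simple positive roots $$\epsilon_1-\epsilon_2,\ \dots,\ \epsilon_{d-1}-\epsilon_d,\ \epsilon_d-\delta_1,\ \delta_1-\delta_2,\ \dots,\ \delta_{n-1}-\delta_n,\ \beta,\qquad d=\lfloor (p+2)/2\rfloor,$$ with $\beta=\delta_n$ for odd $p$ and $\beta=2\delta_n$ for even $p$ (the $\pm\epsilon_i$ and $\pm\delta_j$ being nonzero weights of the even and the odd part of $\mathbb C^{p+2|2n}$, respectively). Here stable subspaces that are not assumed to be $\mathbb Z_2$-graded also count as submodules. -/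

import Mathlib

open scoped TensorProduct BigOperators

noncomputable section

namespace OspHarm

section LinearSuperalgebra

/-! Linear superalgebra over an index set `ι` with parities `σ a ∈ {0, 1}`; the entry `A a b` of a
matrix is `A^a_b`, i.e. `A e_b = ∑ a, A^a_b e_a`. -/

variable {ι : Type} [Fintype ι] [DecidableEq ι]

/-- Orthosymplectic metric `g_{ab}`: even, supersymmetric and nondegenerate. -/
structure IsMetric (σ : ι → ℕ) (g : Matrix ι ι ℂ) : Prop where
  even : ∀ a b, Odd (σ a + σ b) → g a b = 0
  supersymm : ∀ a b, g b a = (-1) ^ (σ a * σ b) * g a b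
  nondeg : IsUnit g.det

/-- The metric `g^{ab}` with upper indices, determined by `∑ a, g^{ac} g_{ab} = δ^c_b`. -/
def upper (g : Matrix ι ι ℂ) : Matrix ι ι ℂ := (g⁻¹).transpose

/-- The orthosymplectic Lie superalgebra of the metric `g`, as a space of matrices. -/
def osp (σ : ι → ℕ) (g : Matrix ι ι ℂ) : Submodule ℂ (Matrix ι ι ℂ) where
  carrier := {A | ∀ a b,
    ∑ c, (g a c * A c b + (-1) ^ (σ b * (σ a + σ c)) * (A c a * g c b)) = 0}
  zero_mem' := by intro a b; simp
  add_mem' := by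
    intro A B hA hB a b
    have h1 := hA a b
    have h2 := hB a b
    have h3 := congrArg₂ (· + ·) h1 h2
    simp only [← Finset.sum_add_distrib, add_zero] at h3
    rw [← h3]
    refine Finset.sum_congr rfl fun c _ => ?_
    simp only [Matrix.add_apply]
    ring
  smul_mem' := by
    intro t A hA a b
    have h1 := congrArg (t * ·) (hA a b)
    simp only [Finset.mul_sum, mul_zero] at h1
    rw [← h1]
    refine Finset.sum_congr rfl fun c _ => ?_
    simp only [Matrix.smul_apply, smul_eq_mul]
    ring

/-- `A` is homogeneous of parity `i` (modulo 2). -/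
def IsHomogeneous (σ : ι → ℕ) (i : ℕ) (A : Matrix ι ι ℂ) : Prop :=
  ∀ a b, A a b ≠ 0 → σ a + σ b ≡ i [MOD 2]

/-- The supercommutator; on homogeneous matrices it is `AB - (-1)^{|A||B|} BA`. -/
def superBracket (σ : ι → ℕ) (A B : Matrix ι ι ℂ) : Matrix ι ι ℂ :=
  fun a b => ∑ c, (A a c * B c b -
    (-1) ^ ((σ a + σ c) * (σ c + σ b)) * (B a c * A c b))

end LinearSuperalgebra

/-! The superspace `ℝ^{p|2n}` and the ambient superspace `ℝ^{p+2|2n}`. -/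

/-- Indices of `ℂ^{p|2n}`. -/
abbrev Idx (p n : ℕ) : Type := Fin p ⊕ Fin (2 * n)

/-- Indices of `ℂ^{p+2|2n}`: two further even indices, placed first. -/
abbrev AmbIdx (p n : ℕ) : Type := Fin 2 ⊕ Idx p n

def par (p n : ℕ) : Idx p n → ℕ := Sum.elim (fun _ => 0) (fun _ => 1)

def ambPar (p n : ℕ) : AmbIdx p n → ℕ := Sum.elim (fun _ => 0) (par p n)

/-- The algebra of (complex valued) polynomials on `ℝ^{p|2n}`: polynomials in `p` commuting
variables with values in the Grassmann algebra on `2n` generators. -/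
abbrev SPoly (p n : ℕ) : Type :=
  MvPolynomial (Fin p) ℂ ⊗[ℂ] ExteriorAlgebra ℂ (Fin (2 * n) → ℂ)

variable {p n : ℕ}

/-- The coordinates `X_j`. -/
def coord : Idx p n → SPoly p n :=
  Sum.elim (fun i => MvPolynomial.X i ⊗ₜ[ℂ] 1)
    (fun j => 1 ⊗ₜ[ℂ] ExteriorAlgebra.ι ℂ (Pi.single j 1))

/-- The (left) partial derivatives `∂_{X_j}`. -/
def pd : Idx p n → Module.End ℂ (SPoly p n) :=
  Sum.elim
    (fun i => LinearMap.rTensor _ (MvPolynomial.pderiv (R := ℂ) i).toLinearMap)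
    (fun j => LinearMap.lTensor _
      (CliffordAlgebra.contractLeft (Q := (0 : QuadraticForm ℂ (Fin (2 * n) → ℂ)))
        (LinearMap.proj j)))

/-- The parity involution: `f ↦ (-1)^{|f|} f`. -/
def parityOp : Module.End ℂ (SPoly p n) :=
  LinearMap.lTensor _
    (CliffordAlgebra.involute (Q := (0 : QuadraticForm ℂ (Fin (2 * n) → ℂ)))).toLinearMap

/-- Multiplication from the left by `f`. -/
def mulOp (f : SPoly p n) : Module.End ℂ (SPoly p n) := LinearMap.mulLeft ℂ f

/-- `R² = ∑ X_j h^{jk} X_k`. -/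
def rsq (h : Matrix (Idx p n) (Idx p n) ℂ) : SPoly p n :=
  ∑ j, ∑ k, upper h j k • (coord j * coord k)

/-- The super Laplace operator `Δ = ∑ ∂_{X_j} h_{jk} ∂_{X_k}`. -/
def laplace (h : Matrix (Idx p n) (Idx p n) ℂ) : Module.End ℂ (SPoly p n) :=
  ∑ j, ∑ k, h j k • (pd j * pd k)

/-- The Euler operator `E = ∑ X_j ∂_{X_j}`. -/
def euler : Module.End ℂ (SPoly p n) := ∑ j, mulOp (coord j) * pd j

/-- Spherical harmonics of degree `k`: `Δ P = 0` and `E P = k P`. -/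
def harmDeg (h : Matrix (Idx p n) (Idx p n) ℂ) (k : ℕ) : Submodule ℂ (SPoly p n) :=
  LinearMap.ker (laplace h) ⊓ Module.End.eigenspace euler (k : ℂ)

/-- The space `H` of harmonic polynomials, the sum of the `H_k`. -/
def harm (h : Matrix (Idx p n) (Idx p n) ℂ) : Submodule ℂ (SPoly p n) :=
  ⨆ k : ℕ, harmDeg h k

/-! The action of `osp(p+2|2n)`. -/

/-- The metric on `ℂ^{p+2|2n}`: a hyperbolic plane plus `h`. -/
def ambMetric (h : Matrix (Idx p n) (Idx p n) ℂ) : Matrix (AmbIdx p n) (AmbIdx p n) ℂ :=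
  Matrix.fromBlocks !![0, 1; 1, 0] 0 0 h

/-- The ambient coordinates `x_a` restricted to `x_1 = 1` and to the null cone:
`(1, -R²/2, X_j)`. -/
def coneCoord (h : Matrix (Idx p n) (Idx p n) ℂ) : AmbIdx p n → SPoly p n :=
  Sum.elim ![1, (-(1 / 2) : ℂ) • rsq h] coord

/-- The operator `D_A` for `A ∈ osp(p+2|2n)`: the vector field `∑ A^a_c x_a ∂_{x_c}`, acting on
functions on the null cone which are homogeneous of degree `κ = 2 - M/2`, `M = p + 2 - 2n`,
written in the chart `x_1 = 1`. A function `F` of the `X_j` corresponds to `x_1^κ F(X / x_1)`, so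
`∂_{x_1}` becomes `κ - E`, `∂_{x_2}` becomes `0` and `∂_{x_{j+2}}` becomes `∂_{X_j}`. Explicitly:
matrices in `osp(p|2n)` give `∑ A^i_j X_i ∂_{X_j}`, and the remaining elements give (multiples of)
the operators `∂_{X^j}`, `X_j (2E + M - 4) - R² ∂_{X^j}` and `2E + M - 4`. -/
def confOp (h : Matrix (Idx p n) (Idx p n) ℂ) (A : Matrix (AmbIdx p n) (AmbIdx p n) ℂ) :
    Module.End ℂ (SPoly p n) :=
  ∑ a, mulOp (coneCoord h a) *
    (A a (Sum.inl 0) • ((1 - ((p : ℂ) - 2 * (n : ℂ)) / 2) • 1 - euler) +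
      ∑ j : Idx p n, A a (Sum.inr j) • pd j)

/-- The operators by which `osp(p+2|2n)` acts. -/
def confOps (h : Matrix (Idx p n) (Idx p n) ℂ) : Set (Module.End ℂ (SPoly p n)) :=
  confOp h '' (osp (ambPar p n) (ambMetric h) : Set (Matrix (AmbIdx p n) (AmbIdx p n) ℂ))

/-- The operators by which the subalgebra `osp(p|2n)`, embedded as lower right blocks, acts. -/
def rotOps (h : Matrix (Idx p n) (Idx p n) ℂ) : Set (Module.End ℂ (SPoly p n)) :=
  (fun A => confOp h (Matrix.fromBlocks 0 0 0 A)) ''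
    (osp (par p n) h : Set (Matrix (Idx p n) (Idx p n) ℂ))

/-- `A ↦ D_A` is a representation of the Lie superalgebra `osp(p+2|2n)`. -/
structure IsSuperRepresentation (h : Matrix (Idx p n) (Idx p n) ℂ) : Prop where
  parity : ∀ i : ℕ, ∀ A ∈ osp (ambPar p n) (ambMetric h), IsHomogeneous (ambPar p n) i A →
    confOp h A * parityOp = (-1 : ℂ) ^ i • (parityOp * confOp h A)
  bracket : ∀ i j : ℕ, ∀ A ∈ osp (ambPar p n) (ambMetric h),
    ∀ B ∈ osp (ambPar p n) (ambMetric h),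
    IsHomogeneous (ambPar p n) i A → IsHomogeneous (ambPar p n) j B →
    superBracket (ambPar p n) A B ∈ osp (ambPar p n) (ambMetric h) ∧
      confOp h (superBracket (ambPar p n) A B) =
        confOp h A * confOp h B - (-1 : ℂ) ^ (i * j) • (confOp h B * confOp h A)

/-! Submodules for a set `S` of operators. -/

/-- A subspace stable under the operators in `S`. -/
def IsStable (S : Set (Module.End ℂ (SPoly p n))) (W : Submodule ℂ (SPoly p n)) : Prop :=
  ∀ T ∈ S, ∀ f ∈ W, T f ∈ W

/-- A subrepresentation: a stable `ℤ/2`-graded subspace. -/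
def IsSubrep (S : Set (Module.End ℂ (SPoly p n))) (W : Submodule ℂ (SPoly p n)) : Prop :=
  IsStable S W ∧ ∀ f ∈ W, parityOp f ∈ W

/-- Irreducibility. Not even a non-graded stable proper nonzero subspace is allowed. -/
def IsIrred (S : Set (Module.End ℂ (SPoly p n))) (W : Submodule ℂ (SPoly p n)) : Prop :=
  IsSubrep S W ∧ W ≠ ⊥ ∧ ∀ W' ≤ W, IsStable S W' → W' = ⊥ ∨ W' = W

/-- Indecomposability. Not even non-graded stable complements are allowed. -/
def IsIndecomposable (S : Set (Module.End ℂ (SPoly p n))) (W : Submodule ℂ (SPoly p n)) : Prop :=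
  IsSubrep S W ∧ W ≠ ⊥ ∧ ∀ W₁ W₂ : Submodule ℂ (SPoly p n), IsStable S W₁ → IsStable S W₂ →
    W₁ ⊔ W₂ = W → W₁ ⊓ W₂ = ⊥ → W₁ = ⊥ ∨ W₂ = ⊥

/-- The piece of degree `j`: `H_j` if `j ≤ q`, and `R^{2j-2q} H_{2q-j}` if `q < j ≤ 2q`. -/
def piece (h : Matrix (Idx p n) (Idx p n) ℂ) (q j : ℕ) : Submodule ℂ (SPoly p n) :=
  if j ≤ q then harmDeg h j
  else (harmDeg h (2 * q - j)).map (mulOp (rsq h ^ (j - q)))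

/-- The sum of the pieces of degrees `0, …, 2q`. -/
def socle (h : Matrix (Idx p n) (Idx p n) ℂ) (q : ℕ) : Submodule ℂ (SPoly p n) :=
  ⨆ j : Fin (2 * q + 1), piece h q j

/-! Highest weights for `osp(m|2n)`, `m = p + 2`. With `d = ⌊m/2⌋`, weights are written in the
basis `ε_1, …, ε_d, δ_1, …, δ_n`, indexed by `0, …, d + n - 1` in this order. -/

/-- The rank `d + n` of `osp(p+2|2n)`. -/
abbrev rk (p n : ℕ) : ℕ := (p + 2) / 2 + n

/-- A homogeneous Witt frame of `ℂ^{p+2|2n}`: pairs of isotropic vectors `u_k, v_k`, even for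
`k < d` and odd for `k ≥ d`, dual to each other with respect to the metric. It fixes a Cartan
subalgebra together with the labelling of its weights. -/
structure IsWittFrame (h : Matrix (Idx p n) (Idx p n) ℂ)
    (u v : Fin (rk p n) → AmbIdx p n → ℂ) : Prop where
  parity_u : ∀ k a, ambPar p n a ≠ (if k.val < (p + 2) / 2 then 0 else 1) → u k a = 0
  parity_v : ∀ k a, ambPar p n a ≠ (if k.val < (p + 2) / 2 then 0 else 1) → v k a = 0
  isotropic_u : ∀ k l, u k ⬝ᵥ (ambMetric h).mulVec (u l) = 0
  isotropic_v : ∀ k l, v k ⬝ᵥ (ambMetric h).mulVec (v l) = 0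
  dual : ∀ k l, u k ⬝ᵥ (ambMetric h).mulVec (v l) = if k = l then 1 else 0

/-- The element of the Cartan subalgebra dual to the `k`-th basis weight:
`w ↦ g(w, v_k) u_k - g(u_k, w) v_k`, which is `1` on `u_k`, `-1` on `v_k` and `0` on the vectors
orthogonal to both. -/
def cartanElt (h : Matrix (Idx p n) (Idx p n) ℂ) (u v : Fin (rk p n) → AmbIdx p n → ℂ)
    (k : Fin (rk p n)) : Matrix (AmbIdx p n) (AmbIdx p n) ℂ :=
  Matrix.vecMulVec (u k) ((ambMetric h).mulVec (v k)) -
    Matrix.vecMulVec (v k) (Matrix.vecMul (u k) (ambMetric h))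

/-- The simple positive roots `ε_1-ε_2, …, ε_{d-1}-ε_d, ε_d-δ_1, δ_1-δ_2, …, δ_{n-1}-δ_n`,
followed by `δ_n` if `m` is odd and by `2δ_n` if `m` is even. -/
def simpleRoots (p n : ℕ) : Set (Fin (rk p n) → ℂ) :=
  {α | (∃ k l : Fin (rk p n), l.val = k.val + 1 ∧ α = Pi.single k 1 - Pi.single l 1) ∨
    ∃ k : Fin (rk p n), k.val + 1 = rk p n ∧
      α = if Even (p + 2) then Pi.single k 2 else Pi.single k 1}

/-- The root space of `α` in `osp(p+2|2n)`. -/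
def rootSpace (h : Matrix (Idx p n) (Idx p n) ℂ) (u v : Fin (rk p n) → AmbIdx p n → ℂ)
    (α : Fin (rk p n) → ℂ) : Set (Matrix (AmbIdx p n) (AmbIdx p n) ℂ) :=
  {A | A ∈ osp (ambPar p n) (ambMetric h) ∧
    ∀ k, cartanElt h u v k * A - A * cartanElt h u v k = α k • A}

/-- `f` is a highest weight vector of weight `μ`. -/
def IsHighestWeightVector (h : Matrix (Idx p n) (Idx p n) ℂ)
    (u v : Fin (rk p n) → AmbIdx p n → ℂ) (μ : Fin (rk p n) → ℂ) (f : SPoly p n) : Prop :=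
  f ≠ 0 ∧ (∀ k, confOp h (cartanElt h u v k) f = μ k • f) ∧
    ∀ α ∈ simpleRoots p n, ∀ A ∈ rootSpace h u v α, confOp h A f = 0

/-- `W` is (isomorphic to) `K_μ`: an irreducible representation of `osp(p+2|2n)` with highest
weight `μ`, for any choice of the Cartan subalgebra and of the labelling of its weights. -/
def IsK (h : Matrix (Idx p n) (Idx p n) ℂ) (μ : Fin (rk p n) → ℂ)
    (W : Submodule ℂ (SPoly p n)) : Prop :=
  IsIrred (confOps h) W ∧ (∃ u v, IsWittFrame h u v) ∧
    ∀ u v, IsWittFrame h u v → ∃ f ∈ W, IsHighestWeightVector h u v μ f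

/-- The weight `q ε_1`. -/
def qEps (p n q : ℕ) : Fin (rk p n) → ℂ := fun k => if k.val = 0 then (q : ℂ) else 0

end OspHarm

end

/-! Write M = p - 2n, let D_j be the derivative with lowered index, L_ij the rotations and K_j =
X_j(2E + M - 2) - R² D_j. A matrix acts as a linear vector field on functions on the ambient null
cone, homogeneous of degree κ and read in the chart x_1 = 1. This respects brackets for every κ
(`densOp_superBracket`); the value κ = 1 - M/2 is the one for which K_j preserves the kernel of Δ
(`laplace_K`). The matrices `ospGen` span the Lie superalgebra, so a submodule is a subspace stable
under D_j, E, K_j and L_ij (`stable_confOps_iff`).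

Every nonzero submodule contains 1: take a component of least degree; all D_j annihilate it, so by
Euler's identity it is constant (`ConfStable.one_mem`). In the other direction, ∑ h^{jl} K_j D_l is
the scalar (2k + M - 2)(k + 1) on H_{k+1} (`sum_K_D`), so a submodule containing H_k contains
H_{k+1} unless M = 2 - 2k. If no such k exists, the harmonic polynomials are irreducible.

Let M = 2 - 2q. Only the step from H_q to H_{q+1} fails: on H_q the operator K_j is -R² D_j. More
generally K_j maps R^{2s}H_{q-s} to R^{2s+2}H_{q-s-1} and D_j maps it back, so H_0, …, H_q and these
spaces together form the submodule `socle`. That it is the only one rests on two facts about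
osp(p|2n).

The first is `eq_harmDeg_of_rotStable`: a rotation stable subspace of H_k not contained in the
multiples of R² is all of H_k. Such a subspace contains the power η^k of an isotropic linear form,
by a highest weight argument modulo R² (`linPow_mem`). If it were proper, its annihilator under the
Fischer pairing ⟨f, g⟩ = (f(D)g)(0) would likewise contain ξ^k for the dual isotropic form ξ. But
⟨ξ^k, η^k⟩ = k!. The argument needs the form ξ to be a non-zero-divisor modulo R²
(`mem_range_R_of_Xv`), which follows because ξ is prime, does not divide the even part of R², and
the odd part of R² is nilpotent.

The second fact describes the harmonic multiples of R². If R^{2s+2}φ is harmonic, then applying Δ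
shows that φ is again divisible by R² except when the degree is q + s + 1 (`exists_R_pow`). Hence
H_k contains no nonzero multiple of R² for k ≤ q, and for k > q its multiples of R² lie in `socle`.
A submodule strictly larger than `socle` therefore contains some H_k with k > q entirely, and D_j
and K_j carry it to all degrees (`eq_bot_or_socle_or_harm`).

For the highest weight, κ = q, so restrictions to the cone of ambient polynomials of degree q form
an invariant space; its harmonic part is `socle` (`coneSpan_inf_harm`). The q-th power of the linear
coordinate given by the first frame vector u_1 is harmonic since u_1 is isotropic, has weight qε_1,
and is killed by the simple root vectors since these kill u_1.

The analysis uses only the interface `SuperWeyl`; the tensor product is needed just to verify its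
axioms. -/

noncomputable section

namespace OspHarm

variable {p n : ℕ}

/-! ### Signs and an axiomatic description of superpolynomials -/

/-- The sign `(-1)^{|i||j|}`. -/
def sg (i j : Idx p n) : ℂ := (-1) ^ (par p n i * par p n j)

theorem sg_inl_left (i : Fin p) (j : Idx p n) : sg (Sum.inl i) j = 1 := by simp [sg, par]
theorem sg_inl_right (i : Fin p) (j : Idx p n) : sg j (Sum.inl i) = 1 := by simp [sg, par]
theorem sg_inr_inr (i j : Fin (2 * n)) : sg (p := p) (Sum.inr i) (Sum.inr j) = -1 := by
  simp [sg, par]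

theorem sg_comm (i j : Idx p n) : sg i j = sg j i := by simp [sg, mul_comm]

theorem sg_mul_self (i j : Idx p n) : sg i j * sg i j = 1 := by
  rcases i with i | i <;> rcases j with j | j <;> simp [sg_inl_left, sg_inl_right, sg_inr_inr]

/-- An algebra with supercommuting generators `X_j` (freely generated in the sense of `lift`),
partial derivatives and a parity involution. -/
structure SuperWeyl (p n : ℕ) (V : Type) [Ring V] [Algebra ℂ V] where
  coord : Idx p n → V
  pd : Idx p n → Module.End ℂ V
  parityOp : Module.End ℂ V
  coord_mul_coord : ∀ i j, coord i * coord j = sg i j • (coord j * coord i)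
  pd_pd : ∀ i j f, pd i (pd j f) = sg i j • pd j (pd i f)
  pd_coord_mul : ∀ i j f,
    pd i (coord j * f) = sg i j • (coord j * pd i f) + (if i = j then (1 : ℂ) else 0) • f
  pd_one : ∀ j, pd j 1 = 0
  parityOp_one : parityOp 1 = 1
  parityOp_coord_mul : ∀ j f, parityOp (coord j * f) = (-1 : ℂ) ^ par p n j • (coord j * parityOp f)
  eq_top : ∀ S : Submodule ℂ V, 1 ∈ S → (∀ j, ∀ f ∈ S, coord j * f ∈ S) → S = ⊤
  augmentation : V →ₐ[ℂ] ℂ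
  augmentation_coord : ∀ j, augmentation (coord j) = 0
  lift : ∀ y : Idx p n → Module.End ℂ V, (∀ i j, y i * y j = sg i j • (y j * y i)) →
    ∃ F : V →ₐ[ℂ] Module.End ℂ V, ∀ j, F (coord j) = y j
  body : MvPolynomial (Fin p) ℂ →ₐ[ℂ] V
  body_X : ∀ i, body (MvPolynomial.X i) = coord (Sum.inl i)
  eq_zero_of_body_mul : ∀ a f, a ≠ 0 → body a * f = 0 → f = 0
  dvd_of_body_mul : ∀ ξ a f g, Prime ξ → ¬ ξ ∣ a → body a * f = body ξ * g → ∃ f', f = body ξ * f'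

end OspHarm

/-! ### Verification of the axioms for polynomials tensored with the Grassmann algebra -/

namespace OspHarm
variable {p n : ℕ}

/-- The Grassmann algebra on `2n` generators. -/
abbrev Grass (n : ℕ) : Type := ExteriorAlgebra ℂ (Fin (2 * n) → ℂ)

theorem pderiv_comm {σ : Type*} (i j : σ) (a : MvPolynomial σ ℂ) :
    MvPolynomial.pderiv i (MvPolynomial.pderiv j a) =
      MvPolynomial.pderiv j (MvPolynomial.pderiv i a) := by
  classical
  have : ⁅MvPolynomial.pderiv (R := ℂ) i, MvPolynomial.pderiv (R := ℂ) j⁆ = 0 := by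
    apply MvPolynomial.derivation_ext
    intro k
    simp [Derivation.commutator_apply, MvPolynomial.pderiv_X, Pi.single_apply, apply_ite]
  have h2 := congrArg (fun D => D a) this
  simpa [Derivation.commutator_apply, sub_eq_zero] using h2

theorem SPoly.neg_one_smul_tmul (a : MvPolynomial (Fin p) ℂ) (b : Grass n) :
    (-1 : ℂ) • (a ⊗ₜ[ℂ] b : SPoly p n) = a ⊗ₜ[ℂ] (-b) := by
  rw [← TensorProduct.tmul_smul, neg_smul, one_smul]

theorem coord_mul_coord (i j : Idx p n) :
    (coord i * coord j : SPoly p n) = sg i j • (coord j * coord i) := by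
  rcases i with i | i <;> rcases j with j | j
  · simp [coord, sg_inl_left, mul_comm]
  · simp [coord, sg_inl_left]
  · simp [coord, sg_inl_right]
  · simp only [coord, sg_inr_inr, Sum.elim_inr, Algebra.TensorProduct.tmul_mul_tmul, mul_one]
    rw [SPoly.neg_one_smul_tmul, eq_neg_of_add_eq_zero_left (ExteriorAlgebra.ι_add_mul_swap _ _)]

theorem pd_inl_tmul (i : Fin p) (a : MvPolynomial (Fin p) ℂ) (b : Grass n) :
    pd (Sum.inl i) (a ⊗ₜ[ℂ] b) = MvPolynomial.pderiv i a ⊗ₜ[ℂ] b := rfl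

theorem pd_inr_tmul (j : Fin (2 * n)) (a : MvPolynomial (Fin p) ℂ) (b : Grass n) :
    pd (Sum.inr j) (a ⊗ₜ[ℂ] b) = a ⊗ₜ[ℂ] CliffordAlgebra.contractLeft
        (Q := (0 : QuadraticForm ℂ (Fin (2 * n) → ℂ))) (LinearMap.proj j) b := rfl

theorem coord_inl_mul_tmul (i : Fin p) (a : MvPolynomial (Fin p) ℂ) (b : Grass n) :
    (coord (Sum.inl i) * (a ⊗ₜ[ℂ] b) : SPoly p n) = (MvPolynomial.X i * a) ⊗ₜ[ℂ] b := by
  simp [coord]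

theorem coord_inr_mul_tmul (j : Fin (2 * n)) (a : MvPolynomial (Fin p) ℂ) (b : Grass n) :
    (coord (Sum.inr j) * (a ⊗ₜ[ℂ] b) : SPoly p n) =
      a ⊗ₜ[ℂ] (ExteriorAlgebra.ι ℂ (Pi.single j 1) * b) := by
  simp [coord]

theorem pd_pd (i j : Idx p n) (f : SPoly p n) : pd i (pd j f) = sg i j • pd j (pd i f) := by
  have key : pd i ∘ₗ pd j = sg i j • (pd j ∘ₗ pd i : Module.End ℂ (SPoly p n)) := by
    refine TensorProduct.ext' fun a b => ?_
    rcases i with i | i <;> rcases j with j | j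
    · simp only [sg_inl_left, one_smul]
      exact congrArg (· ⊗ₜ[ℂ] b) (pderiv_comm i j a)
    · simp only [sg_inl_left, one_smul]; rfl
    · simp only [sg_inl_right, one_smul]; rfl
    · simp only [sg_inr_inr]
      refine Eq.trans ?_ (SPoly.neg_one_smul_tmul _ _).symm
      exact congrArg (a ⊗ₜ[ℂ] ·) (CliffordAlgebra.contractLeft_comm _ _ _)
  exact LinearMap.congr_fun key f

theorem pd_coord_mul (i j : Idx p n) (f : SPoly p n) :
    pd i (coord j * f) = sg i j • (coord j * pd i f) + (if i = j then (1 : ℂ) else 0) • f := by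
  have key : pd i ∘ₗ LinearMap.mulLeft ℂ (coord j) =
      sg i j • (LinearMap.mulLeft ℂ (coord j) ∘ₗ pd i : Module.End ℂ (SPoly p n)) +
        (if i = j then (1 : ℂ) else 0) • (LinearMap.id : Module.End ℂ (SPoly p n)) := by
    refine TensorProduct.ext' fun a b => ?_
    show pd i (coord j * (a ⊗ₜ[ℂ] b)) = sg i j • (coord j * pd i (a ⊗ₜ[ℂ] b)) +
      (if i = j then (1 : ℂ) else 0) • (a ⊗ₜ[ℂ] b)
    rcases i with i | i <;> rcases j with j | j
    · rw [coord_inl_mul_tmul, pd_inl_tmul, pd_inl_tmul, coord_inl_mul_tmul, sg_inl_left, one_smul,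
        TensorProduct.smul_tmul', ← TensorProduct.add_tmul]
      congr 1
      by_cases h : i = j
      · subst h; simp [Derivation.leibniz]
      · simp [h, Derivation.leibniz, MvPolynomial.pderiv_X, Ne.symm h]
    · rw [coord_inr_mul_tmul, pd_inl_tmul, pd_inl_tmul, coord_inr_mul_tmul, sg_inl_left, one_smul,
        if_neg (by simp), zero_smul, add_zero]
    · rw [coord_inl_mul_tmul, pd_inr_tmul, pd_inr_tmul, coord_inl_mul_tmul, sg_inl_right, one_smul,
        if_neg (by simp), zero_smul, add_zero]
    · rw [coord_inr_mul_tmul, pd_inr_tmul, pd_inr_tmul, coord_inr_mul_tmul, sg_inr_inr,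
        SPoly.neg_one_smul_tmul, ← TensorProduct.tmul_smul, ← TensorProduct.tmul_add]
      congr 1
      refine (CliffordAlgebra.contractLeft_ι_mul (Q := (0 : QuadraticForm ℂ (Fin (2 * n) → ℂ)))
        (d := LinearMap.proj i) (Pi.single j 1) b).trans ?_
      rw [LinearMap.proj_apply, Pi.single_apply, sub_eq_add_neg, add_comm]
      simp only [Sum.inr.injEq]
  exact LinearMap.congr_fun key f

theorem pd_one (j : Idx p n) : pd j (1 : SPoly p n) = 0 := by
  rcases j with j | j
  · exact (congrArg (· ⊗ₜ[ℂ] (1 : Grass n)) (Derivation.map_one_eq_zero (MvPolynomial.pderiv j))).trans (TensorProduct.zero_tmul _ _)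
  · exact (congrArg ((1 : MvPolynomial (Fin p) ℂ) ⊗ₜ[ℂ] ·)
      (CliffordAlgebra.contractLeft_one (Q := (0 : QuadraticForm ℂ (Fin (2 * n) → ℂ)))
        (LinearMap.proj j))).trans (TensorProduct.tmul_zero _ _)

theorem SPoly.eq_top (S : Submodule ℂ (SPoly p n)) (h1 : (1 : SPoly p n) ∈ S)
    (hX : ∀ j, ∀ f ∈ S, coord j * f ∈ S) : S = ⊤ := by
  have hodd : ∀ b : Grass n, ((1 : MvPolynomial (Fin p) ℂ) ⊗ₜ[ℂ] b : SPoly p n) ∈ S := by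
    intro b
    induction b using CliffordAlgebra.left_induction with
    | algebraMap r =>
      rw [Algebra.algebraMap_eq_smul_one, TensorProduct.tmul_smul]
      exact S.smul_mem _ h1
    | add x y hx hy => rw [TensorProduct.tmul_add]; exact S.add_mem hx hy
    | ι_mul x m hx =>
      have hm : m = ∑ j, m j • Pi.single j (1 : ℂ) := by
        ext k; simp [Finset.sum_apply, Pi.single_apply]
      rw [hm, map_sum, Finset.sum_mul, TensorProduct.tmul_sum]
      refine S.sum_mem fun j _ => ?_
      rw [map_smul, smul_mul_assoc, TensorProduct.tmul_smul]
      refine S.smul_mem _ ?_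
      have := hX (Sum.inr j) _ hx
      rwa [coord_inr_mul_tmul] at this
  have hmul : ∀ (a : MvPolynomial (Fin p) ℂ) (b : Grass n), (a ⊗ₜ[ℂ] b : SPoly p n) ∈ S := by
    intro a b
    induction a using MvPolynomial.induction_on with
    | C r =>
      have : (MvPolynomial.C r : MvPolynomial (Fin p) ℂ) = r • 1 := by
        rw [MvPolynomial.smul_eq_C_mul, mul_one]
      rw [this, ← TensorProduct.smul_tmul']
      exact S.smul_mem _ (hodd b)
    | add x y hx hy => rw [TensorProduct.add_tmul]; exact S.add_mem hx hy
    | mul_X x i hx =>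
      have := hX (Sum.inl i) _ hx
      rwa [coord_inl_mul_tmul, mul_comm (MvPolynomial.X i) x] at this
  refine eq_top_iff.2 fun f _ => ?_
  induction f using TensorProduct.induction_on with
  | zero => exact S.zero_mem
  | add f g hf hg => exact S.add_mem (hf trivial) (hg trivial)
  | tmul a b => exact hmul a b

theorem parityOp_one : parityOp (1 : SPoly p n) = 1 := by
  simp [parityOp, Algebra.TensorProduct.one_def]

theorem parityOp_coord_mul (j : Idx p n) (f : SPoly p n) :
    parityOp (coord j * f) = (-1 : ℂ) ^ par p n j • (coord j * parityOp f) := by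
  have key : parityOp ∘ₗ LinearMap.mulLeft ℂ (coord j) = (-1 : ℂ) ^ par p n j •
      (LinearMap.mulLeft ℂ (coord j) ∘ₗ parityOp : Module.End ℂ (SPoly p n)) := by
    refine TensorProduct.ext' fun a b => ?_
    show parityOp (coord j * (a ⊗ₜ[ℂ] b)) = (-1 : ℂ) ^ par p n j •
      (coord j * (a ⊗ₜ[ℂ] (CliffordAlgebra.involute b)))
    rcases j with j | j
    · rw [coord_inl_mul_tmul, coord_inl_mul_tmul]
      simp [parityOp, par]
    · rw [coord_inr_mul_tmul, coord_inr_mul_tmul,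
        show (-1 : ℂ) ^ par p n (Sum.inr j) = -1 by simp [par], SPoly.neg_one_smul_tmul]
      simp [parityOp]
  exact LinearMap.congr_fun key f

/-- The augmentation `f ↦ f(0)`. -/
def SPoly.augmentation : SPoly p n →ₐ[ℂ] ℂ :=
  Algebra.TensorProduct.lift (MvPolynomial.aeval fun _ => 0) ExteriorAlgebra.algebraMapInv
    (fun _ _ => Commute.all _ _)

theorem SPoly.augmentation_coord (j : Idx p n) : SPoly.augmentation (coord j) = 0 := by
  rcases j with j | j
  · simp [SPoly.augmentation, coord]
  · simp [SPoly.augmentation, coord, ExteriorAlgebra.algebraMapInv]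

/-- The universal properties of the two tensor factors combine because the images of even and odd
generators commute. It is used to substitute D_j for X_j in a polynomial. -/
theorem SPoly.exists_lift {B : Type} [Ring B] [Algebra ℂ B] (y : Idx p n → B)
    (hy : ∀ i j, y i * y j = sg i j • (y j * y i)) :
    ∃ F : SPoly p n →ₐ[ℂ] B, ∀ j, F (coord j) = y j := by
  have hc : ∀ a ∈ Set.range fun i => y (Sum.inl i), ∀ b ∈ Set.range fun i => y (Sum.inl i),
      a * b = b * a := by
    rintro _ ⟨i, rfl⟩ _ ⟨j, rfl⟩
    simpa [sg_inl_left] using hy (Sum.inl i) (Sum.inl j)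
  -- The target is not commutative, so polynomials are evaluated in the commutative subalgebra
  -- generated by the images of the even variables.
  let _ := Algebra.adjoinCommRingOfComm ℂ hc
  let F0 : MvPolynomial (Fin p) ℂ →ₐ[ℂ] Algebra.adjoin ℂ (Set.range fun i => y (Sum.inl i)) :=
    MvPolynomial.aeval fun i => ⟨y (Sum.inl i), Algebra.subset_adjoin ⟨i, rfl⟩⟩
  let F1 : MvPolynomial (Fin p) ℂ →ₐ[ℂ] B := (Subalgebra.val _).comp F0
  have hF1 : ∀ i, F1 (MvPolynomial.X i) = y (Sum.inl i) := fun i => by simp [F1, F0]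
  let l : (Fin (2 * n) → ℂ) →ₗ[ℂ] B := Fintype.linearCombination ℂ fun j => y (Sum.inr j)
  have hanti : ∀ i j, y (Sum.inr i) * y (Sum.inr j) = -(y (Sum.inr j) * y (Sum.inr i)) := by
    intro i j
    simpa [sg_inr_inr] using hy (Sum.inr i) (Sum.inr j)
  have hl : ∀ v, l v * l v = 0 := by
    intro v
    have h2 : l v * l v = -(l v * l v) := by
      simp only [l, Fintype.linearCombination_apply, Finset.sum_mul_sum]
      conv_rhs => rw [Finset.sum_comm]
      rw [← Finset.sum_neg_distrib]
      refine Finset.sum_congr rfl fun i _ => ?_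
      rw [← Finset.sum_neg_distrib]
      refine Finset.sum_congr rfl fun j _ => ?_
      rw [smul_mul_smul_comm, smul_mul_smul_comm, hanti i j, smul_neg, mul_comm]
    have h3 : (2 : ℂ) • (l v * l v) = 0 := by rw [two_smul]; nth_rewrite 1 [h2]; simp
    exact (smul_eq_zero.1 h3).resolve_left two_ne_zero
  let F2 : Grass n →ₐ[ℂ] B := ExteriorAlgebra.lift ℂ ⟨l, hl⟩
  have hF2 : ∀ j, F2 (ExteriorAlgebra.ι ℂ (Pi.single j 1)) = y (Sum.inr j) := fun j => by
    simp only [F2, ExteriorAlgebra.lift_ι_apply, l]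
    simp [Fintype.linearCombination_apply, Pi.single_apply]
  have hcomm : ∀ i b, Commute (y (Sum.inl i)) (F2 b) := by
    intro i b
    induction b using ExteriorAlgebra.induction with
    | algebraMap r =>
      rw [AlgHom.commutes]
      exact (Algebra.commutes _ _).symm
    | ι v =>
      simp only [F2, ExteriorAlgebra.lift_ι_apply, l, Fintype.linearCombination_apply]
      refine Commute.sum_right _ _ _ fun j _ => Commute.smul_right ?_ _
      exact (hy (Sum.inl i) (Sum.inr j)).trans (by rw [sg_inl_left, one_smul])
    | mul a b ha hb => rw [map_mul]; exact ha.mul_right hb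
    | add a b ha hb => rw [map_add]; exact ha.add_right hb
  have hcomm' : ∀ a b, Commute (F1 a) (F2 b) := by
    intro a b
    induction a using MvPolynomial.induction_on with
    | C r =>
      rw [show (MvPolynomial.C r : MvPolynomial (Fin p) ℂ) = algebraMap ℂ _ r from rfl,
        AlgHom.commutes]
      exact Algebra.commutes _ _
    | add x y hx hy => rw [map_add]; exact hx.add_left hy
    | mul_X x i hx =>
      rw [map_mul, hF1]
      exact hx.mul_left (hcomm i b)
  refine ⟨Algebra.TensorProduct.lift F1 F2 hcomm', fun j => ?_⟩
  rcases j with j | j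
  · simp [coord, hF1]
  · simp [coord, hF2]

/-- Inclusion of the even polynomials. -/
def SPoly.body : MvPolynomial (Fin p) ℂ →ₐ[ℂ] SPoly p n := Algebra.TensorProduct.includeLeft

theorem SPoly.body_mul (a : MvPolynomial (Fin p) ℂ) (f : SPoly p n) :
    SPoly.body a * f = a • f := by
  induction f using TensorProduct.induction_on with
  | zero => rw [mul_zero, smul_zero]
  | add f g hf hg => rw [mul_add, smul_add, hf, hg]
  | tmul b c =>
    rw [TensorProduct.smul_tmul']
    simp [SPoly.body]

/-- A basis of the superpolynomials over the even polynomials. -/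
def SPoly.basis (p n : ℕ) : Module.Basis (Module.Basis.ofVectorSpaceIndex ℂ (Grass n))
    (MvPolynomial (Fin p) ℂ) (SPoly p n) :=
  Algebra.TensorProduct.basis _ (Module.Basis.ofVectorSpace ℂ (Grass n))

theorem SPoly.eq_zero_of_body_mul (a : MvPolynomial (Fin p) ℂ) (f : SPoly p n) (ha : a ≠ 0)
    (h : SPoly.body a * f = 0) : f = 0 := by
  rw [SPoly.body_mul] at h
  apply (SPoly.basis p n).repr.injective
  ext1 i
  have h2 := congrArg (fun g => (SPoly.basis p n).repr g i) h
  simp only [map_smul, Finsupp.smul_apply, smul_eq_mul, map_zero, Finsupp.zero_apply] at h2 ⊢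
  exact (mul_eq_zero.1 h2).resolve_left ha

/-- The superpolynomials are a free module over the even polynomials, so divisibility by a prime can
be tested on coordinates. -/
theorem SPoly.dvd_of_body_mul (ξ a : MvPolynomial (Fin p) ℂ) (f g : SPoly p n) (hξ : Prime ξ)
    (ha : ¬ ξ ∣ a) (h : SPoly.body a * f = SPoly.body ξ * g) : ∃ f', f = SPoly.body ξ * f' := by
  simp only [SPoly.body_mul] at h ⊢
  have hdvd : ∀ i, ∃ c, (SPoly.basis p n).repr f i = ξ * c := by
    intro i
    have h2 := congrArg (fun g => (SPoly.basis p n).repr g i) h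
    simp only [map_smul, Finsupp.smul_apply, smul_eq_mul] at h2
    exact (hξ.dvd_or_dvd ⟨_, h2⟩).resolve_left ha
  choose c hc using hdvd
  refine ⟨∑ i ∈ ((SPoly.basis p n).repr f).support, c i • SPoly.basis p n i, ?_⟩
  conv_lhs => rw [← (SPoly.basis p n).linearCombination_repr f, Finsupp.linearCombination_apply]
  rw [Finsupp.sum, Finset.smul_sum]
  refine Finset.sum_congr rfl fun i _ => ?_
  rw [hc i, mul_smul]

/-- The superpolynomials as an instance of `SuperWeyl`. -/
def SPoly.superWeyl (p n : ℕ) : SuperWeyl p n (SPoly p n) where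
  coord := coord
  pd := pd
  parityOp := parityOp
  coord_mul_coord := coord_mul_coord
  pd_pd := pd_pd
  pd_coord_mul := pd_coord_mul
  pd_one := pd_one
  parityOp_one := parityOp_one
  parityOp_coord_mul := parityOp_coord_mul
  eq_top := SPoly.eq_top
  augmentation := SPoly.augmentation
  augmentation_coord := SPoly.augmentation_coord
  lift := fun y hy => SPoly.exists_lift y hy
  body := SPoly.body
  body_X := fun _ => rfl
  eq_zero_of_body_mul := SPoly.eq_zero_of_body_mul
  dvd_of_body_mul := SPoly.dvd_of_body_mul

end OspHarm

/-! ### Orthosymplectic metrics and the Lie superalgebra as matrices -/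

namespace OspHarm

section Metric

variable {ι : Type} [Fintype ι] [DecidableEq ι] {σ : ι → ℕ} {g : Matrix ι ι ℂ}

theorem neg_one_pow_mul_self' (m : ℕ) : (-1 : ℂ) ^ m * (-1) ^ m = 1 := by
  rw [← pow_add, Even.neg_one_pow ⟨m, rfl⟩]

theorem even_iff_of_modEq_two {a b : ℕ} (h : a ≡ b [MOD 2]) : Even a ↔ Even b := by
  rw [Nat.even_iff, Nat.even_iff, h]

theorem IsMetric.even_iff (hg : IsMetric σ g) {a b : ι} (h : g a b ≠ 0) :
    Even (σ a) ↔ Even (σ b) := by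
  have : ¬ Odd (σ a + σ b) := fun h' => h (hg.even a b h')
  rwa [Nat.not_odd_iff_even, Nat.even_add] at this

/-- A nonzero entry of `g` joins indices of equal parity, so a sign may be moved from one index of
`g` to the other. Most later sign computations rest on this. -/
theorem IsMetric.sign (hg : IsMetric σ g) (a b c : ι) :
    (-1) ^ (σ a * σ c) * g a b = (-1) ^ (σ b * σ c) * g a b := by
  by_cases h : g a b = 0
  · simp [h]
  · rw [neg_one_pow_congr (n := σ b * σ c)]
    simp [Nat.even_mul, hg.even_iff h]

theorem IsMetric.upper_mul_left (hg : IsMetric σ g) (l k : ι) :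
    ∑ j, upper g j l * g j k = if l = k then 1 else 0 := by
  have := congrFun (congrFun (Matrix.nonsing_inv_mul g hg.nondeg) l) k
  rw [Matrix.mul_apply, Matrix.one_apply] at this
  exact this

theorem IsMetric.upper_mul_right (hg : IsMetric σ g) (k l : ι) :
    ∑ j, g k j * upper g l j = if k = l then 1 else 0 := by
  have := congrFun (congrFun (Matrix.mul_nonsing_inv g hg.nondeg) k) l
  rw [Matrix.mul_apply, Matrix.one_apply] at this
  exact this

/-- The matrix of the parity involution. -/
def parityMatrix (σ : ι → ℕ) : Matrix ι ι ℂ := Matrix.diagonal fun a => (-1) ^ σ a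

theorem parityMatrix_mul_self (σ : ι → ℕ) : parityMatrix σ * parityMatrix σ = 1 := by
  simp [parityMatrix, neg_one_pow_mul_self', Matrix.diagonal_mul_diagonal]

theorem IsMetric.transpose_eq (hg : IsMetric σ g) : g.transpose = parityMatrix σ * g := by
  ext a b
  rw [Matrix.transpose_apply, parityMatrix, Matrix.diagonal_mul, hg.supersymm, hg.sign a b b,
    neg_one_pow_congr (n := σ b) (by simp [Nat.even_mul])]
  by_cases h : g a b = 0
  · simp [h]
  · rw [neg_one_pow_congr (hg.even_iff h)]

theorem IsMetric.parity_comm (hg : IsMetric σ g) :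
    parityMatrix σ * g = g * parityMatrix σ := by
  ext a b
  rw [parityMatrix, Matrix.diagonal_mul, Matrix.mul_diagonal, mul_comm]
  by_cases h : g a b = 0
  · simp [h]
  · rw [neg_one_pow_congr (hg.even_iff h)]

theorem IsMetric.inv_parity_comm (hg : IsMetric σ g) :
    parityMatrix σ * g⁻¹ = g⁻¹ * parityMatrix σ := by
  have h1 := Matrix.nonsing_inv_mul g hg.nondeg
  have h2 := Matrix.mul_nonsing_inv g hg.nondeg
  calc parityMatrix σ * g⁻¹ = g⁻¹ * g * (parityMatrix σ * g⁻¹) := by rw [h1, one_mul]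
    _ = g⁻¹ * (parityMatrix σ * g) * g⁻¹ := by rw [hg.parity_comm]; simp only [Matrix.mul_assoc]
    _ = g⁻¹ * parityMatrix σ := by simp only [Matrix.mul_assoc, h2, mul_one]

/-- Supersymmetry and evenness say that transposing `g` amounts to multiplying it by the parity
matrix, which commutes with `g` and is its own inverse. -/
theorem IsMetric.upper_eq_mul (hg : IsMetric σ g) : upper g = parityMatrix σ * g⁻¹ := by
  rw [upper, Matrix.transpose_nonsing_inv, hg.transpose_eq, hg.inv_parity_comm, Matrix.mul_inv_rev]
  congr 1
  exact Matrix.inv_eq_left_inv (parityMatrix_mul_self σ)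

theorem IsMetric.upper_even (hg : IsMetric σ g) {a b : ι} (h : upper g a b ≠ 0) :
    Even (σ a) ↔ Even (σ b) := by
  by_contra hne
  apply h
  have h1 := congrFun (congrFun hg.inv_parity_comm b) a
  rw [parityMatrix, Matrix.diagonal_mul, Matrix.mul_diagonal] at h1
  rw [upper, Matrix.transpose_apply]
  rcases Nat.even_or_odd (σ a) with ha | ha <;> rcases Nat.even_or_odd (σ b) with hb | hb
  · tauto
  · rw [ha.neg_one_pow, hb.neg_one_pow] at h1; linear_combination (-1 / 2 : ℂ) * h1
  · rw [ha.neg_one_pow, hb.neg_one_pow] at h1; linear_combination (1 / 2 : ℂ) * h1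
  · rw [← Nat.not_even_iff_odd] at ha hb; tauto

theorem IsMetric.upper_symm (hg : IsMetric σ g) (a b : ι) :
    upper g b a = (-1) ^ (σ a * σ b) * upper g a b := by
  by_cases h : upper g a b = 0
  · rw [h, mul_zero]
    rw [hg.upper_eq_mul, parityMatrix, Matrix.diagonal_mul]
    rw [upper, Matrix.transpose_apply] at h
    rw [h, mul_zero]
  · have hp := hg.upper_even h
    rw [neg_one_pow_congr (n := σ b) (by simp only [Nat.even_mul]; tauto)]
    conv_lhs => rw [hg.upper_eq_mul, parityMatrix, Matrix.diagonal_mul]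
    rfl

theorem IsMetric.sum_mul_upper_left (hg : IsMetric σ g) (k l : ι) :
    ∑ j, upper g k j * g j l = (-1) ^ (σ k * σ k) * if k = l then 1 else 0 := by
  rw [← hg.upper_mul_left, Finset.mul_sum]
  refine Finset.sum_congr rfl fun j _ => ?_
  rw [hg.upper_symm j k, ← mul_assoc]
  by_cases h : upper g j k = 0
  · simp [h]
  · have hp := hg.upper_even h
    rw [neg_one_pow_congr (n := σ k * σ k) (by simp only [Nat.even_mul]; tauto)]

/-- The element `w ↦ g(w, e_b) e_a - (-1)^{|a||b|} g(w, e_a) e_b` of the orthosymplectic Lie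
superalgebra. -/
def ospGen (σ : ι → ℕ) (g : Matrix ι ι ℂ) (a b : ι) : Matrix ι ι ℂ :=
  fun x c => (if x = a then g c b else 0) - (-1) ^ (σ a * σ b) * (if x = b then g c a else 0)

theorem IsMetric.ospGen_mem (hg : IsMetric σ g) (a b : ι) : ospGen σ g a b ∈ osp σ g := by
  intro x y
  simp only [ospGen, mul_sub, sub_mul, Finset.sum_add_distrib, Finset.sum_sub_distrib]
  have e1 : ∑ c, g x c * (if c = a then g y b else 0) = g x a * g y b := by simp
  have e2 : ∑ c, g x c * ((-1) ^ (σ a * σ b) * (if c = b then g y a else 0)) =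
    g x b * ((-1) ^ (σ a * σ b) * g y a) := by simp
  have e3 : ∑ c, (-1 : ℂ) ^ (σ y * (σ x + σ c)) * ((if c = a then g x b else 0) * g c y) =
    (-1) ^ (σ y * (σ x + σ a)) * (g x b * g a y) := by simp
  have e4 : ∑ c, (-1 : ℂ) ^ (σ y * (σ x + σ c)) *
      ((-1) ^ (σ a * σ b) * (if c = b then g x a else 0) * g c y) =
    (-1) ^ (σ y * (σ x + σ b)) * ((-1) ^ (σ a * σ b) * g x a * g b y) := by simp
  rw [e1, e2, e3, e4]
  have h1 : (-1) ^ (σ y * (σ x + σ a)) * (g x b * g a y) =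
      g x b * ((-1) ^ (σ a * σ b) * g y a) := by
    rw [hg.supersymm a y]
    by_cases h : g x b = 0
    · simp [h]
    by_cases h' : g a y = 0
    · simp [h']
    have := hg.even_iff h
    have := hg.even_iff h'
    rw [mul_left_comm, ← mul_assoc ((-1 : ℂ) ^ (σ a * σ b)), ← pow_add,
      neg_one_pow_congr (n := σ a * σ b + σ a * σ y)]
    simp only [Nat.even_mul, Nat.even_add]; tauto
  have h2 : (-1) ^ (σ y * (σ x + σ b)) * ((-1) ^ (σ a * σ b) * g x a * g b y) =
      g x a * g y b := by
    rw [hg.supersymm b y]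
    by_cases h : g x a = 0
    · simp [h]
    by_cases h' : g b y = 0
    · simp [h']
    have := hg.even_iff h
    have := hg.even_iff h'
    have e : (-1 : ℂ) ^ (σ y * (σ x + σ b)) * (-1) ^ (σ a * σ b) = (-1) ^ (σ b * σ y) := by
      rw [← pow_add]
      apply neg_one_pow_congr
      simp only [Nat.even_mul, Nat.even_add]; tauto
    linear_combination g x a * g b y * e
  rw [h1, h2]; ring

/-- The entries of `A` with both indices raised. -/
def raised (g A : Matrix ι ι ℂ) (a b : ι) : ℂ := ∑ d, A a d * upper g d b

theorem IsMetric.eq_sum_raised (hg : IsMetric σ g) (A : Matrix ι ι ℂ) (a c : ι) :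
    A a c = ∑ b, raised g A a b * g c b := by
  simp only [raised, Finset.sum_mul]
  rw [Finset.sum_comm]
  calc A a c = ∑ d, A a d * (if c = d then 1 else 0) := by simp
    _ = _ := Finset.sum_congr rfl fun d _ => by
      rw [← hg.upper_mul_right, Finset.mul_sum]
      exact Finset.sum_congr rfl fun b _ => by ring

theorem IsMetric.eq_zero_of_contract (hg : IsMetric σ g) (B : ι → ι → ℂ)
    (h : ∀ a b, ∑ c, ∑ d, g a c * g b d * B c d = 0) : B = 0 := by
  have h1 : g * Matrix.of B * g.transpose = 0 := by
    ext a b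
    simp only [Matrix.mul_apply, Matrix.transpose_apply, Matrix.zero_apply, Finset.sum_mul]
    rw [Finset.sum_comm, ← h a b]
    exact Finset.sum_congr rfl fun c _ => Finset.sum_congr rfl fun d _ => by simp; ring
  have h2 : Matrix.of B = 0 := by
    have e1 := Matrix.nonsing_inv_mul g hg.nondeg
    have e2 := Matrix.mul_nonsing_inv g.transpose (by rw [Matrix.det_transpose]; exact hg.nondeg)
    calc Matrix.of B = (g⁻¹ * g) * Matrix.of B * (g.transpose * g.transpose⁻¹) := by
          rw [e1, e2, one_mul, mul_one]
      _ = g⁻¹ * (g * Matrix.of B * g.transpose) * g.transpose⁻¹ := by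
          simp only [Matrix.mul_assoc]
      _ = 0 := by rw [h1]; simp
  exact h2

/-- The equation defining `osp` is this antisymmetry with both indices lowered, and lowering indices
is injective. -/
theorem IsMetric.raised_symm (hg : IsMetric σ g) {A : Matrix ι ι ℂ} (hA : A ∈ osp σ g) (c d : ι) :
    raised g A c d + (-1) ^ (σ c * σ d) * raised g A d c = 0 := by
  refine congrFun (congrFun (hg.eq_zero_of_contract
    (fun c d => raised g A c d + (-1) ^ (σ c * σ d) * raised g A d c) fun a b => ?_) c) d
  rw [← hA a b]
  simp only [Finset.sum_add_distrib, mul_add]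
  congr 1
  · refine Finset.sum_congr rfl fun c _ => ?_
    rw [hg.eq_sum_raised A c b, Finset.mul_sum]
    exact Finset.sum_congr rfl fun d _ => by ring
  · rw [Finset.sum_comm]
    refine Finset.sum_congr rfl fun d _ => ?_
    rw [hg.eq_sum_raised A d a, Finset.sum_mul, Finset.mul_sum]
    refine Finset.sum_congr rfl fun c _ => ?_
    rw [hg.supersymm b d]
    by_cases h : g b d = 0
    · simp [h]
    by_cases h' : g a c = 0
    · simp [h']
    have := hg.even_iff h
    have := hg.even_iff h'
    have e : (-1 : ℂ) ^ (σ c * σ d) = (-1) ^ (σ b * (σ a + σ d)) * (-1) ^ (σ b * σ d) := by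
      rw [← pow_add]
      apply neg_one_pow_congr
      simp only [Nat.even_mul, Nat.even_add]; tauto
    rw [e]; ring

/-- The two halves of `ospGen` each contribute A/2, the second one by the antisymmetry of the raised
entries. Stability thus needs to be tested on these generators only. -/
theorem IsMetric.eq_sum_ospGen (hg : IsMetric σ g) {A : Matrix ι ι ℂ} (hA : A ∈ osp σ g) :
    A = ∑ a, ∑ b, (raised g A a b / 2) • ospGen σ g a b := by
  ext x c
  simp only [Matrix.sum_apply, Matrix.smul_apply, ospGen, smul_eq_mul, mul_sub,
    Finset.sum_sub_distrib]
  have e1 : ∑ a, ∑ b, raised g A a b / 2 * (if x = a then g c b else 0) = A x c / 2 := by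
    rw [hg.eq_sum_raised A x c, Finset.sum_comm, Finset.sum_div]
    refine Finset.sum_congr rfl fun b _ => ?_
    simp; ring
  have e2 : ∑ a, ∑ b, raised g A a b / 2 * ((-1) ^ (σ a * σ b) * (if x = b then g c a else 0)) =
      - (A x c / 2) := by
    rw [hg.eq_sum_raised A x c, Finset.sum_div, ← Finset.sum_neg_distrib]
    refine Finset.sum_congr rfl fun a _ => ?_
    have := hg.raised_symm hA x a
    simp only [mul_ite, mul_zero, Finset.sum_ite_eq, Finset.mem_univ, if_true]
    rw [mul_comm (σ a)]
    linear_combination (1 / 2 : ℂ) * g c a * this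
  rw [e1, e2]; ring

theorem IsHomogeneous.sign_mul {i : ℕ} {A : Matrix ι ι ℂ} (hA : IsHomogeneous σ i A) :
    parityMatrix σ * A = (-1 : ℂ) ^ i • (A * parityMatrix σ) := by
  ext a b
  rw [Matrix.smul_apply, parityMatrix, Matrix.diagonal_mul, Matrix.mul_diagonal, smul_eq_mul]
  by_cases h : A a b = 0
  · simp [h]
  · have := even_iff_of_modEq_two (hA a b h)
    have e : (-1 : ℂ) ^ σ a = (-1) ^ i * (-1) ^ σ b := by
      rw [← pow_add]
      apply neg_one_pow_congr
      rw [Nat.even_add] at this ⊢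
      tauto
    rw [e]; ring

theorem superBracket_eq {i j : ℕ} {A B : Matrix ι ι ℂ} (hA : IsHomogeneous σ i A)
    (hB : IsHomogeneous σ j B) :
    superBracket σ A B = A * B - (-1 : ℂ) ^ (i * j) • (B * A) := by
  ext a b
  simp only [superBracket, Matrix.sub_apply, Matrix.smul_apply, Matrix.mul_apply, smul_eq_mul,
    Finset.mul_sum, ← Finset.sum_sub_distrib]
  refine Finset.sum_congr rfl fun c _ => ?_
  congr 1
  by_cases h : A c b = 0
  · simp [h]
  by_cases h' : B a c = 0
  · simp [h']
  have h1 := even_iff_of_modEq_two (hA _ _ h)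
  have h2 := even_iff_of_modEq_two (hB _ _ h')
  rw [neg_one_pow_congr]
  simp only [Nat.even_mul]; tauto

/-- For homogeneous matrices the entrywise signs are absorbed by a power of the parity matrix, so
closure under the bracket becomes matrix algebra. -/
theorem mem_osp_iff_of_homogeneous {i : ℕ} {A : Matrix ι ι ℂ}
    (hA : IsHomogeneous σ i A) :
    A ∈ osp σ g ↔ g * A = - (A.transpose * g * parityMatrix σ ^ i) := by
  have key : ∀ a b, ∑ c, (g a c * A c b + (-1) ^ (σ b * (σ a + σ c)) * (A c a * g c b)) =
      (g * A) a b + (A.transpose * g * parityMatrix σ ^ i) a b := by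
    intro a b
    rw [Finset.sum_add_distrib, parityMatrix, Matrix.diagonal_pow, Matrix.mul_diagonal,
      Matrix.mul_apply, Matrix.mul_apply, Finset.sum_mul]
    congr 1
    refine Finset.sum_congr rfl fun c _ => ?_
    rw [Matrix.transpose_apply, mul_comm]
    by_cases h : A c a = 0
    · simp [h]
    have := even_iff_of_modEq_two (hA _ _ h)
    congr 1
    rw [Pi.pow_apply, ← pow_mul]
    apply neg_one_pow_congr
    simp only [Nat.even_mul, Nat.even_add] at *; tauto
  constructor
  · intro h
    ext a b
    rw [Matrix.neg_apply, eq_neg_iff_add_eq_zero, ← key]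
    exact h a b
  · intro h a b
    rw [key, h, Matrix.neg_apply, neg_add_cancel]

theorem IsHomogeneous.mul {i j : ℕ} {A B : Matrix ι ι ℂ} (hA : IsHomogeneous σ i A)
    (hB : IsHomogeneous σ j B) : IsHomogeneous σ (i + j) (A * B) := by
  intro a b h
  rw [Matrix.mul_apply] at h
  obtain ⟨c, -, hc⟩ := Finset.exists_ne_zero_of_sum_ne_zero h
  have h1 := hA a c (left_ne_zero_of_mul hc)
  have h2 := hB c b (right_ne_zero_of_mul hc)
  unfold Nat.ModEq at *
  omega

theorem IsHomogeneous.pow_sign_mul {i : ℕ} {A : Matrix ι ι ℂ} (hA : IsHomogeneous σ i A) (j : ℕ) :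
    parityMatrix σ ^ j * A = (-1 : ℂ) ^ (i * j) • (A * parityMatrix σ ^ j) := by
  induction j with
  | zero => simp
  | succ j ih =>
    rw [pow_succ', Matrix.mul_assoc, ih, Matrix.mul_smul, ← Matrix.mul_assoc, hA.sign_mul,
      Matrix.smul_mul, smul_smul, Matrix.mul_assoc, ← pow_add]
    ring_nf

theorem superBracket_mem {i j : ℕ} {A B : Matrix ι ι ℂ}
    (hA : A ∈ osp σ g) (hB : B ∈ osp σ g) (hi : IsHomogeneous σ i A) (hj : IsHomogeneous σ j B) :
    superBracket σ A B ∈ osp σ g := by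
  have hAB := hi.mul hj
  have hBA := hj.mul hi
  have hhom : IsHomogeneous σ (i + j) (superBracket σ A B) := by
    rw [superBracket_eq hi hj]
    intro a b h
    by_cases h1 : (A * B) a b = 0
    · have h2 : (B * A) a b ≠ 0 := by
        intro h2; apply h; simp [h1, h2]
      have := hBA a b h2
      rwa [add_comm j i] at this
    · exact hAB a b h1
  rw [mem_osp_iff_of_homogeneous hhom, superBracket_eq hi hj]
  have key : ∀ {i j : ℕ} {A B : Matrix ι ι ℂ}, A ∈ osp σ g → B ∈ osp σ g → IsHomogeneous σ i A →
      IsHomogeneous σ j B → g * (A * B) = (-1 : ℂ) ^ (i * j) •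
        ((B * A).transpose * g * parityMatrix σ ^ (i + j)) := by
    intro i j A B hA hB hi hj
    rw [mem_osp_iff_of_homogeneous hi] at hA
    rw [mem_osp_iff_of_homogeneous hj] at hB
    calc g * (A * B) = - (A.transpose * g * (parityMatrix σ ^ i * B)) := by
          rw [← Matrix.mul_assoc, hA]; simp [Matrix.mul_assoc]
      _ = - ((-1 : ℂ) ^ (i * j) • (A.transpose * (g * B) * parityMatrix σ ^ i)) := by
          rw [hj.pow_sign_mul, mul_comm i j, Matrix.mul_smul]; simp [Matrix.mul_assoc]
      _ = _ := by
          rw [hB, add_comm i j, pow_add]; simp [Matrix.mul_assoc, Matrix.transpose_mul]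
  rw [Matrix.mul_sub, Matrix.mul_smul, key hA hB hi hj, key hB hA hj hi, smul_smul, mul_comm j i,
    neg_one_pow_mul_self', one_smul, Matrix.transpose_sub, Matrix.transpose_smul, Matrix.sub_mul,
    Matrix.sub_mul, Matrix.smul_mul, Matrix.smul_mul, add_comm j i]
  abel

end Metric
end OspHarm

/-! ### Commutation relations between coordinates, derivatives, R², Δ, the Euler operator, rotations
and K_j -/

namespace OspHarm
variable {p n : ℕ}

namespace SuperWeyl
variable {V : Type} [Ring V] [Algebra ℂ V] (W : SuperWeyl p n V)

/-- The element `R²`. -/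
def rsq (h : Matrix (Idx p n) (Idx p n) ℂ) : V :=
  ∑ j, ∑ k, upper h j k • (W.coord j * W.coord k)

/-- The super Laplace operator. -/
def laplace (h : Matrix (Idx p n) (Idx p n) ℂ) : Module.End ℂ V :=
  ∑ j, ∑ k, h j k • (W.pd j * W.pd k)

/-- The Euler operator. -/
def euler : Module.End ℂ V := ∑ j, LinearMap.mulLeft ℂ (W.coord j) * W.pd j

/-- Multiplication by a coordinate. -/
def X (j : Idx p n) : Module.End ℂ V := LinearMap.mulLeft ℂ (W.coord j)

/-- Multiplication by `R²`. -/
def R (h : Matrix (Idx p n) (Idx p n) ℂ) : Module.End ℂ V := LinearMap.mulLeft ℂ (W.rsq h)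

/-- The derivative with lowered index, `D_j = ∑ h_{kj} ∂_{X_k}`. -/
def D (h : Matrix (Idx p n) (Idx p n) ℂ) (j : Idx p n) : Module.End ℂ V := ∑ k, h k j • W.pd k

/-- The rotations `X_i D_j - (-1)^{|i||j|} X_j D_i`. -/
def L (h : Matrix (Idx p n) (Idx p n) ℂ) (i j : Idx p n) : Module.End ℂ V :=
  W.X i * W.D h j - sg i j • (W.X j * W.D h i)

/-- The superdimension `p - 2n`. -/
def sdim (p n : ℕ) : ℂ := (p : ℂ) - 2 * (n : ℂ)

/-- The operator `X_j (2E + p - 2n - 2) - R² D_j`. -/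
def K (h : Matrix (Idx p n) (Idx p n) ℂ) (j : Idx p n) : Module.End ℂ V :=
  W.X j * ((2 : ℂ) • W.euler + (sdim p n - 2) • 1) - W.R h * W.D h j

theorem X_apply (j : Idx p n) (f : V) : W.X j f = W.coord j * f := rfl
theorem R_apply (h : Matrix (Idx p n) (Idx p n) ℂ) (f : V) : W.R h f = W.rsq h * f := rfl
theorem R_eq (h : Matrix (Idx p n) (Idx p n) ℂ) (f : V) :
    W.R h f = ∑ j, ∑ k, upper h j k • W.X j (W.X k f) := by
  simp only [R_apply, rsq, Finset.sum_mul, smul_mul_assoc, X_apply, mul_assoc]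
theorem D_apply (h : Matrix (Idx p n) (Idx p n) ℂ) (j : Idx p n) (f : V) :
    W.D h j f = ∑ k, h k j • W.pd k f := by
  simp [D]
theorem L_apply (h : Matrix (Idx p n) (Idx p n) ℂ) (i j : Idx p n) (f : V) :
    W.L h i j f = W.X i (W.D h j f) - sg i j • W.X j (W.D h i f) := by
  simp [L]
theorem K_apply (h : Matrix (Idx p n) (Idx p n) ℂ) (j : Idx p n) (f : V) :
    W.K h j f = (2 : ℂ) • W.X j (W.euler f) + (sdim p n - 2) • W.X j f - W.R h (W.D h j f) := by
  simp [K]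
theorem euler_eq (f : V) : W.euler f = ∑ j, W.X j (W.pd j f) := by
  simp [euler, X]
theorem laplace_eq_pd (h : Matrix (Idx p n) (Idx p n) ℂ) (f : V) :
    W.laplace h f = ∑ j, ∑ k, h j k • W.pd j (W.pd k f) := by
  simp [laplace]

/-- The axiom `eq_top` in the form of an induction principle: identities between operators are
checked on 1 and propagated by multiplication with coordinates. -/
theorem induction_on {C : V → Prop} (h0 : C 1) (hX : ∀ j f, C f → C (W.X j f))
    (hadd : ∀ f g, C f → C g → C (f + g)) (hsmul : ∀ (c : ℂ) f, C f → C (c • f)) (f : V) : C f := by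
  let S : Submodule ℂ V :=
    { carrier := {f | C f}
      zero_mem' := by
        have := hsmul 0 1 h0
        rwa [zero_smul] at this
      add_mem' := fun {a b} ha hb => hadd a b ha hb
      smul_mem' := fun c x hx => hsmul c x hx }
  have : S = ⊤ := W.eq_top S h0 fun j f hf => hX j f hf
  exact (eq_top_iff.1 this) (Submodule.mem_top (x := f))

theorem X_X (i j : Idx p n) (f : V) : W.X i (W.X j f) = sg i j • W.X j (W.X i f) := by
  simp only [X_apply, ← mul_assoc, W.coord_mul_coord i j, smul_mul_assoc]

theorem pd_X (i j : Idx p n) (f : V) :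
    W.pd i (W.X j f) = sg i j • W.X j (W.pd i f) + (if i = j then (1 : ℂ) else 0) • f :=
  W.pd_coord_mul i j f

theorem parityOp_X (j : Idx p n) (f : V) :
    W.parityOp (W.X j f) = (-1 : ℂ) ^ par p n j • W.X j (W.parityOp f) :=
  W.parityOp_coord_mul j f

theorem parityOp_pd (j : Idx p n) (f : V) :
    W.parityOp (W.pd j f) = (-1 : ℂ) ^ par p n j • W.pd j (W.parityOp f) := by
  induction f using W.induction_on with
  | h0 => simp [W.pd_one, W.parityOp_one]
  | hadd f g hf hg => simp only [map_add, hf, hg, smul_add]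
  | hsmul c f hf => simp only [map_smul, hf, smul_comm c]
  | hX i f hf =>
    simp only [pd_X, parityOp_X, map_add, map_smul, hf, smul_add, smul_smul]
    by_cases hij : j = i
    · subst hij
      simp only [if_true, one_smul, mul_one, neg_one_pow_mul_self']
      rw [← mul_assoc, neg_one_pow_mul_self', one_mul]
    · simp only [if_neg hij, mul_zero, zero_smul, add_zero]
      congr 1
      ring

theorem parityOp_parityOp (f : V) : W.parityOp (W.parityOp f) = f := by
  induction f using W.induction_on with
  | h0 => simp [W.parityOp_one]
  | hadd f g hf hg => simp only [map_add, hf, hg]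
  | hsmul c f hf => simp only [map_smul, hf]
  | hX i f hf => simp only [parityOp_X, map_smul, hf, smul_smul, neg_one_pow_mul_self', one_smul]

end SuperWeyl

variable {h : Matrix (Idx p n) (Idx p n) ℂ}

theorem IsMetric.sg_mul (hh : IsMetric (par p n) h) (i j k : Idx p n) :
    sg i k * h i j = sg j k * h i j := hh.sign i j k

theorem IsMetric.sg_mul_upper (hh : IsMetric (par p n) h) (i j k : Idx p n) :
    sg i k * upper h i j = sg j k * upper h i j := by
  by_cases hu : upper h i j = 0
  · simp [hu]
  · unfold sg
    rw [neg_one_pow_congr (n := par p n j * par p n k)]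
    simp [Nat.even_mul, hh.upper_even hu]

theorem IsMetric.parity_mul (hh : IsMetric (par p n) h) (i j : Idx p n) :
    (-1) ^ par p n i * h i j = (-1) ^ par p n j * h i j := by
  by_cases hu : h i j = 0
  · simp [hu]
  · rw [neg_one_pow_congr (hh.even_iff hu)]

theorem IsMetric.symm' (hh : IsMetric (par p n) h) (i j : Idx p n) :
    h j i = sg i j * h i j := hh.supersymm i j

theorem IsMetric.upper_symm' (hh : IsMetric (par p n) h) (i j : Idx p n) :
    upper h j i = sg i j * upper h i j := hh.upper_symm i j

namespace SuperWeyl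
variable {V : Type} [Ring V] [Algebra ℂ V] (W : SuperWeyl p n V) (hh : IsMetric (par p n) h)
include hh

theorem parityOp_D (j : Idx p n) (f : V) :
    W.parityOp (W.D h j f) = (-1 : ℂ) ^ par p n j • W.D h j (W.parityOp f) := by
  simp only [D_apply, map_sum, map_smul, parityOp_pd, Finset.smul_sum, smul_smul]
  refine Finset.sum_congr rfl fun k _ => ?_
  rw [mul_comm, hh.parity_mul]

theorem D_X (i j : Idx p n) (f : V) :
    W.D h i (W.X j f) = sg i j • W.X j (W.D h i f) + h j i • f := by
  simp only [D_apply, pd_X, smul_add, smul_smul, Finset.sum_add_distrib, map_sum, map_smul,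
    Finset.smul_sum]
  congr 1
  · refine Finset.sum_congr rfl fun k _ => ?_
    rw [mul_comm, hh.sg_mul]
  · simp

theorem D_pd (i j : Idx p n) (f : V) :
    W.D h i (W.pd j f) = sg i j • W.pd j (W.D h i f) := by
  simp only [D_apply, map_sum, map_smul, Finset.smul_sum, smul_smul]
  refine Finset.sum_congr rfl fun k _ => ?_
  rw [W.pd_pd, smul_smul, mul_comm, hh.sg_mul]

theorem D_D (i j : Idx p n) (f : V) :
    W.D h i (W.D h j f) = sg i j • W.D h j (W.D h i f) := by
  rw [W.D_apply h j, W.D_apply h j, map_sum, Finset.smul_sum]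
  refine Finset.sum_congr rfl fun k _ => ?_
  rw [map_smul, W.D_pd hh, smul_smul, smul_smul, sg_comm, mul_comm, hh.sg_mul, sg_comm]

theorem pd_eq (k : Idx p n) (f : V) : W.pd k f = ∑ j, upper h k j • W.D h j f := by
  simp only [D_apply, Finset.smul_sum, smul_smul]
  rw [Finset.sum_comm]
  calc W.pd k f = ∑ l, (if l = k then (1 : ℂ) else 0) • W.pd l f := by simp
    _ = _ := Finset.sum_congr rfl fun l _ => by
      rw [← hh.upper_mul_right, Finset.sum_smul]
      exact Finset.sum_congr rfl fun j _ => by rw [mul_comm]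

theorem euler_eq_D (f : V) : W.euler f = ∑ j, ∑ k, upper h j k • W.X j (W.D h k f) := by
  rw [euler_eq]
  refine Finset.sum_congr rfl fun j _ => ?_
  rw [W.pd_eq hh, map_sum]
  simp only [map_smul]

theorem laplace_eq_D (f : V) : W.laplace h f = ∑ j, ∑ k, upper h j k • W.D h j (W.D h k f) := by
  have : ∀ j, ∑ k, upper h j k • W.D h j (W.D h k f) = W.D h j (W.pd j f) := fun j => by
    rw [W.pd_eq hh j f, map_sum]
    simp only [map_smul]
  rw [Finset.sum_congr rfl fun j _ => this j]
  simp only [D_apply, laplace_eq_pd]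
  exact Finset.sum_comm

theorem D_R (j : Idx p n) (f : V) :
    W.D h j (W.R h f) = W.R h (W.D h j f) + (2 : ℂ) • W.X j f := by
  simp only [R_eq, map_sum, map_smul, W.D_X hh, smul_add, smul_smul, Finset.sum_add_distrib,
    map_add]
  have e1 : ∑ k, ∑ l, (upper h k l * (sg j k * sg j l)) • W.X k (W.X l (W.D h j f)) =
      ∑ k, ∑ l, upper h k l • W.X k (W.X l (W.D h j f)) := by
    refine Finset.sum_congr rfl fun k _ => Finset.sum_congr rfl fun l _ => ?_
    congr 1
    rw [sg_comm j k, sg_comm j l]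
    linear_combination sg l j * hh.sg_mul_upper k l j + upper h k l * sg_mul_self l j
  have e2 : ∑ k, ∑ l, (upper h k l * (sg j k * h l j)) • W.X k f = W.X j f := by
    calc _ = ∑ k, (if j = k then (1 : ℂ) else 0) • W.X k f := by
          refine Finset.sum_congr rfl fun k _ => ?_
          rw [← hh.upper_mul_right, Finset.sum_smul]
          refine Finset.sum_congr rfl fun l _ => ?_
          congr 1
          rw [sg_comm j k, hh.symm' l j]
          linear_combination h l j * hh.sg_mul_upper k l j
      _ = W.X j f := by simp
  have e3 : ∑ k, ∑ l, (upper h k l * h k j) • W.X l f = W.X j f := by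
    rw [Finset.sum_comm]
    simp only [← Finset.sum_smul, hh.upper_mul_left]
    simp
  rw [e1, e2, e3]
  module

theorem R_X (j : Idx p n) (f : V) : W.R h (W.X j f) = W.X j (W.R h f) := by
  simp only [R_eq, map_sum, map_smul]
  refine Finset.sum_congr rfl fun k _ => Finset.sum_congr rfl fun l _ => ?_
  rw [W.X_X l j, map_smul, W.X_X k j, smul_smul, smul_smul]
  congr 1
  linear_combination sg l j * hh.sg_mul_upper k l j + upper h k l * sg_mul_self l j

theorem pd_laplace (j : Idx p n) (f : V) : W.pd j (W.laplace h f) = W.laplace h (W.pd j f) := by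
  simp only [laplace_eq_pd, map_sum, map_smul]
  refine Finset.sum_congr rfl fun k _ => Finset.sum_congr rfl fun l _ => ?_
  rw [W.pd_pd j k, W.pd_pd j l, map_smul, smul_smul, smul_smul]
  congr 1
  rw [mul_assoc, mul_comm, sg_comm j k, sg_comm j l, mul_right_comm, hh.sg_mul, mul_right_comm,
    sg_mul_self, one_mul]

theorem D_laplace (j : Idx p n) (f : V) : W.D h j (W.laplace h f) = W.laplace h (W.D h j f) := by
  simp only [D_apply, map_sum, map_smul, W.pd_laplace hh]

theorem laplace_X (j : Idx p n) (f : V) :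
    W.laplace h (W.X j f) = W.X j (W.laplace h f) + (2 : ℂ) • W.D h j f := by
  simp only [laplace_eq_pd, pd_X, map_add, map_smul, smul_add, smul_smul, Finset.sum_add_distrib,
    map_sum]
  have e1 : ∑ k, ∑ l, (h k l * (sg l j * sg k j)) • W.X j (W.pd k (W.pd l f)) =
      ∑ k, ∑ l, h k l • W.X j (W.pd k (W.pd l f)) := by
    refine Finset.sum_congr rfl fun k _ => Finset.sum_congr rfl fun l _ => ?_
    congr 1
    linear_combination sg l j * hh.sg_mul k l j + h k l * sg_mul_self l j
  have e2 : ∑ k, ∑ l, (h k l * (sg l j * if k = j then (1 : ℂ) else 0)) • W.pd l f = W.D h j f := by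
    rw [Finset.sum_comm, D_apply]
    refine Finset.sum_congr rfl fun l _ => ?_
    rw [← Finset.sum_smul]
    congr 1
    simp only [mul_ite, mul_one, mul_zero, Finset.sum_ite_eq', Finset.mem_univ, if_true]
    rw [hh.symm' j l, mul_comm, sg_comm]
  have e3 : ∑ k, ∑ l, (h k l * if l = j then (1 : ℂ) else 0) • W.pd k f = W.D h j f := by
    rw [D_apply]
    refine Finset.sum_congr rfl fun k _ => ?_
    rw [← Finset.sum_smul]
    simp
  rw [e1, e2, e3]
  module

omit hh in
theorem euler_X (j : Idx p n) (f : V) : W.euler (W.X j f) = W.X j (W.euler f) + W.X j f := by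
  simp only [euler_eq, pd_X, map_add, map_smul, Finset.sum_add_distrib, map_sum]
  congr 1
  · refine Finset.sum_congr rfl fun k _ => ?_
    rw [W.X_X k j, smul_smul, sg_mul_self, one_smul]
  · simp

omit hh in
theorem euler_pd (j : Idx p n) (f : V) : W.euler (W.pd j f) = W.pd j (W.euler f) - W.pd j f := by
  rw [eq_sub_iff_add_eq]
  simp only [euler_eq, pd_X, Finset.sum_add_distrib, map_sum]
  congr 1
  · refine Finset.sum_congr rfl fun k _ => ?_
    rw [W.pd_pd j k, map_smul, smul_smul, sg_mul_self, one_smul]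
  · simp

omit hh in
theorem euler_D (j : Idx p n) (f : V) :
    W.euler (W.D h j f) = W.D h j (W.euler f) - W.D h j f := by
  simp only [D_apply, map_sum, map_smul, euler_pd, smul_sub, Finset.sum_sub_distrib]

omit hh in
theorem euler_R (f : V) : W.euler (W.R h f) = W.R h (W.euler f) + (2 : ℂ) • W.R h f := by
  simp only [R_eq, map_sum, map_smul, euler_X, Finset.smul_sum, ← Finset.sum_add_distrib]
  refine Finset.sum_congr rfl fun k _ => Finset.sum_congr rfl fun l _ => ?_
  rw [map_add]
  module

omit hh in
theorem euler_laplace (f : V) :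
    W.euler (W.laplace h f) = W.laplace h (W.euler f) - (2 : ℂ) • W.laplace h f := by
  simp only [laplace_eq_pd, map_sum, map_smul, euler_pd, Finset.smul_sum, ← Finset.sum_sub_distrib]
  refine Finset.sum_congr rfl fun k _ => Finset.sum_congr rfl fun l _ => ?_
  rw [map_sub]
  module

/-- This is the commutator relation of the sl_2 generated by R² and Δ. Moving both derivatives past
both coordinates gives the Euler operator four times and a supertrace. -/
theorem laplace_R (f : V) : W.laplace h (W.R h f) =
    W.R h (W.laplace h f) + (4 : ℂ) • W.euler f + (2 * sdim p n) • f := by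
  rw [R_eq, R_eq]
  simp only [map_sum, map_smul, W.laplace_X hh, map_add, smul_add, smul_smul,
    Finset.sum_add_distrib, W.D_X hh]
  have e1 : ∑ j, ∑ k, (upper h j k * 2) • W.X j (W.D h k f) = (2 : ℂ) • W.euler f := by
    rw [W.euler_eq_D hh]
    simp only [Finset.smul_sum, smul_smul, mul_comm]
  have e2 : ∑ j, ∑ k, (upper h j k * (2 * sg j k)) • W.X k (W.D h j f) = (2 : ℂ) • W.euler f := by
    rw [W.euler_eq_D hh, Finset.sum_comm]
    simp only [Finset.smul_sum, smul_smul]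
    refine Finset.sum_congr rfl fun k _ => Finset.sum_congr rfl fun j _ => ?_
    rw [hh.upper_symm' j k]
    congr 1; ring
  have e3 : ∑ j, ∑ k, (upper h j k * (2 * h k j)) • f = (2 * sdim p n) • f := by
    simp only [← Finset.sum_smul]
    congr 1
    -- An odd index contributes with the opposite sign; this turns the dimension into p - 2n.
    have : ∀ j, ∑ k, upper h j k * (2 * h k j) = 2 * (-1) ^ (par p n j * par p n j) := fun j => by
      have := hh.sum_mul_upper_left j j
      rw [if_pos rfl, mul_one] at this
      rw [← this, Finset.mul_sum]
      exact Finset.sum_congr rfl fun k _ => by ring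
    simp only [this, ← Finset.mul_sum, Fintype.sum_sum_type, par, Sum.elim_inl, Sum.elim_inr]
    simp [sdim]
    ring
  rw [e1, e2, e3]
  module

theorem parityOp_R (f : V) : W.parityOp (W.R h f) = W.R h (W.parityOp f) := by
  simp only [R_eq, map_sum, map_smul, parityOp_X, smul_smul]
  refine Finset.sum_congr rfl fun k _ => Finset.sum_congr rfl fun l _ => ?_
  by_cases hu : upper h k l = 0
  · simp [hu]
  · rw [neg_one_pow_congr (hh.upper_even hu), neg_one_pow_mul_self', mul_one]

theorem parityOp_laplace (f : V) : W.parityOp (W.laplace h f) = W.laplace h (W.parityOp f) := by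
  simp only [laplace_eq_pd, map_sum, map_smul, parityOp_pd, smul_smul]
  refine Finset.sum_congr rfl fun k _ => Finset.sum_congr rfl fun l _ => ?_
  by_cases hu : h k l = 0
  · simp [hu]
  · rw [neg_one_pow_congr (hh.even_iff hu), neg_one_pow_mul_self', mul_one]

omit hh in
theorem parityOp_euler (f : V) : W.parityOp (W.euler f) = W.euler (W.parityOp f) := by
  simp only [euler_eq, map_sum, map_smul, parityOp_pd, parityOp_X, smul_smul,
    neg_one_pow_mul_self', one_smul]

theorem L_R (i j : Idx p n) (f : V) : W.L h i j (W.R h f) = W.R h (W.L h i j f) := by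
  simp only [L_apply, W.D_R hh, map_add, map_smul, map_sub, W.R_X hh, smul_add]
  rw [W.X_X i j f]
  module

theorem laplace_L (i j : Idx p n) (f : V) :
    W.laplace h (W.L h i j f) = W.L h i j (W.laplace h f) := by
  simp only [L_apply, W.laplace_X hh, map_smul, map_sub, W.D_laplace hh, smul_add]
  rw [W.D_D hh i j f]
  module

omit hh in
theorem euler_L (i j : Idx p n) (f : V) :
    W.euler (W.L h i j f) = W.L h i j (W.euler f) := by
  simp only [L_apply, map_sub, map_smul, euler_X, euler_D]
  module

/-- The shift M - 2 in K_j is exactly what cancels the terms in D_j, so that the commutator with Δ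
is a multiple of X_j Δ and K_j preserves harmonicity. -/
theorem laplace_K (j : Idx p n) (f : V) :
    W.laplace h (W.K h j f) = W.K h j (W.laplace h f) + (4 : ℂ) • W.X j (W.laplace h f) := by
  simp only [K_apply, map_sub, map_add, map_smul, W.laplace_X hh, W.laplace_R hh, euler_D,
    euler_laplace, W.D_laplace hh]
  module

omit hh in
theorem euler_K (j : Idx p n) (f : V) :
    W.euler (W.K h j f) = W.K h j (W.euler f) + W.K h j f := by
  simp only [K_apply, map_sub, map_add, map_smul, euler_X, euler_R, euler_D]
  module

end SuperWeyl
end OspHarm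

/-! ### Densities on the null cone and the representation property -/

namespace OspHarm
variable {p n : ℕ}

/-- The sign `(-1)^{|a||b|}` for ambient indices. -/
def asg (a b : AmbIdx p n) : ℂ := (-1) ^ (ambPar p n a * ambPar p n b)

theorem asg_inl_left (i : Fin 2) (a : AmbIdx p n) : asg (Sum.inl i) a = 1 := by simp [asg, ambPar]
theorem asg_inl_right (i : Fin 2) (a : AmbIdx p n) : asg a (Sum.inl i) = 1 := by simp [asg, ambPar]
theorem asg_inr_inr (i j : Idx p n) : asg (Sum.inr i) (Sum.inr j) = sg i j := rfl

variable {h : Matrix (Idx p n) (Idx p n) ℂ}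

theorem IsMetric.ambMetric_isMetric (hh : IsMetric (par p n) h) :
    IsMetric (ambPar p n) (ambMetric h) where
  even := by
    rintro (a | a) (b | b) hab
    · simp [ambPar] at hab
    · rfl
    · rfl
    · exact hh.even a b hab
  supersymm := by
    rintro (a | a) (b | b)
    · fin_cases a <;> fin_cases b <;> simp [ambMetric, ambPar]
    · simp [ambMetric]
    · simp [ambMetric]
    · exact hh.supersymm a b
  nondeg := by
    rw [ambMetric, Matrix.det_fromBlocks_zero₂₁]
    refine IsUnit.mul ?_ hh.nondeg
    simp [Matrix.det_fin_two]

theorem IsMetric.upper_ambMetric (hh : IsMetric (par p n) h) :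
    upper (ambMetric h) = Matrix.fromBlocks !![0, 1; 1, 0] 0 0 (upper h) := by
  have h1 := Matrix.nonsing_inv_mul h hh.nondeg
  have e : (!![0, 1; 1, 0] * !![0, 1; 1, 0] : Matrix (Fin 2) (Fin 2) ℂ) = 1 := by
    ext i j; fin_cases i <;> fin_cases j <;> simp
  have e' : (!![0, 1; 1, 0] : Matrix (Fin 2) (Fin 2) ℂ).transpose = !![0, 1; 1, 0] := by
    ext i j; fin_cases i <;> fin_cases j <;> simp
  have h2 : (ambMetric h)⁻¹ = Matrix.fromBlocks !![0, 1; 1, 0] 0 0 h⁻¹ := by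
    apply Matrix.inv_eq_left_inv
    rw [ambMetric, Matrix.fromBlocks_multiply, h1, e]
    simp
  rw [upper, h2, Matrix.fromBlocks_transpose, upper, e']
  simp

theorem eq_zero_of_eq_neg {V : Type} [AddCommGroup V] [Module ℂ V] {x : V} (hx : x = -x) : x = 0 := by
  have h3 : (2 : ℂ) • x = 0 := by rw [two_smul]; nth_rewrite 1 [hx]; rw [neg_add_cancel]
  exact (smul_eq_zero.1 h3).resolve_left two_ne_zero

namespace SuperWeyl
variable {V : Type} [Ring V] [Algebra ℂ V] (W : SuperWeyl p n V)

/-- The coordinates of the null cone in the chart `x_1 = 1`. -/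
def coneCoord (h : Matrix (Idx p n) (Idx p n) ℂ) : AmbIdx p n → V :=
  Sum.elim ![1, (-(1 / 2) : ℂ) • W.rsq h] W.coord

/-- Multiplication by a coordinate of the null cone. -/
def Phi (h : Matrix (Idx p n) (Idx p n) ℂ) (a : AmbIdx p n) : Module.End ℂ V :=
  LinearMap.mulLeft ℂ (W.coneCoord h a)

/-- The derivatives along the ambient coordinates, on densities of degree `κ`. -/
def nab (κ : ℂ) : AmbIdx p n → Module.End ℂ V :=
  Sum.elim ![κ • 1 - W.euler, 0] W.pd

/-- The coordinates of the null cone with raised index. -/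
def PhiUp (h : Matrix (Idx p n) (Idx p n) ℂ) (c : AmbIdx p n) : Module.End ℂ V :=
  ∑ d, upper (ambMetric h) c d • W.Phi h d

/-- The action of a matrix on densities of degree `κ`. -/
def densOp (h : Matrix (Idx p n) (Idx p n) ℂ) (κ : ℂ) (A : Matrix (AmbIdx p n) (AmbIdx p n) ℂ) :
    Module.End ℂ V :=
  ∑ a, ∑ c, A a c • (W.Phi h a * W.nab κ c)

/-- The operator by which a matrix acts on superpolynomials. -/
def confOp (h : Matrix (Idx p n) (Idx p n) ℂ) (A : Matrix (AmbIdx p n) (AmbIdx p n) ℂ) :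
    Module.End ℂ V :=
  ∑ a, LinearMap.mulLeft ℂ (W.coneCoord h a) *
    (A a (Sum.inl 0) • ((1 - ((p : ℂ) - 2 * (n : ℂ)) / 2) • 1 - W.euler) +
      ∑ j : Idx p n, A a (Sum.inr j) • W.pd j)

theorem confOp_eq (h : Matrix (Idx p n) (Idx p n) ℂ) (A : Matrix (AmbIdx p n) (AmbIdx p n) ℂ) :
    W.confOp h A = W.densOp h (1 - sdim p n / 2) A := by
  refine Finset.sum_congr rfl fun a _ => ?_
  rw [Fintype.sum_sum_type (fun c => A a c • (W.Phi h a * W.nab (1 - sdim p n / 2) c)), mul_add,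
    Finset.mul_sum, Fin.sum_univ_two]
  simp [nab, Phi, sdim]

theorem densOp_apply (h : Matrix (Idx p n) (Idx p n) ℂ) (κ : ℂ)
    (A : Matrix (AmbIdx p n) (AmbIdx p n) ℂ) (f : V) :
    W.densOp h κ A f = ∑ a, ∑ c, A a c • W.Phi h a (W.nab κ c f) := by
  simp [densOp]

theorem densOp_add (κ : ℂ) (A B : Matrix (AmbIdx p n) (AmbIdx p n) ℂ) :
    W.densOp h κ (A + B) = W.densOp h κ A + W.densOp h κ B := by
  simp [densOp, add_smul, Finset.sum_add_distrib]

theorem densOp_smul (κ t : ℂ) (A : Matrix (AmbIdx p n) (AmbIdx p n) ℂ) :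
    W.densOp h κ (t • A) = t • W.densOp h κ A := by
  simp [densOp, Finset.smul_sum, smul_smul]

theorem Phi_zero (f : V) : W.Phi h (Sum.inl 0) f = f := by simp [Phi, coneCoord]
theorem Phi_one (f : V) : W.Phi h (Sum.inl 1) f = (-(1 / 2) : ℂ) • W.R h f := by
  simp [Phi, coneCoord, R]
theorem Phi_inr (j : Idx p n) (f : V) : W.Phi h (Sum.inr j) f = W.X j f := rfl
theorem nab_zero (κ : ℂ) (f : V) : W.nab κ (Sum.inl 0) f = κ • f - W.euler f := by simp [nab]
theorem nab_one (κ : ℂ) (f : V) : W.nab κ (Sum.inl 1) f = 0 := by simp [nab]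
theorem nab_inr (κ : ℂ) (j : Idx p n) (f : V) : W.nab κ (Sum.inr j) f = W.pd j f := rfl

section
variable (hh : IsMetric (par p n) h)
include hh

theorem PhiUp_zero (f : V) : W.PhiUp h (Sum.inl 0) f = W.Phi h (Sum.inl 1) f := by
  simp [PhiUp, hh.upper_ambMetric]
theorem PhiUp_one (f : V) : W.PhiUp h (Sum.inl 1) f = f := by
  simp [PhiUp, hh.upper_ambMetric, Phi_zero]
theorem PhiUp_inr (j : Idx p n) (f : V) :
    W.PhiUp h (Sum.inr j) f = ∑ k, upper h j k • W.X k f := by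
  simp [PhiUp, hh.upper_ambMetric, Phi_inr]

theorem Phi_Phi (a b : AmbIdx p n) (f : V) :
    W.Phi h a (W.Phi h b f) = asg a b • W.Phi h b (W.Phi h a f) := by
  rcases a with a | a <;> rcases b with b | b
  · fin_cases a <;> fin_cases b <;> simp [asg_inl_left, Phi_zero]
  · fin_cases a <;> simp [asg_inl_left, Phi_zero, Phi_one, Phi_inr, W.R_X hh]
  · fin_cases b <;> simp [asg_inl_right, Phi_zero, Phi_one, Phi_inr, W.R_X hh]
  · exact W.X_X a b f

theorem pd_R (k : Idx p n) (f : V) :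
    W.pd k (W.R h f) = W.R h (W.pd k f) + (2 : ℂ) • ∑ j, upper h k j • W.X j f := by
  rw [W.pd_eq hh, W.pd_eq hh, map_sum, Finset.smul_sum, ← Finset.sum_add_distrib]
  refine Finset.sum_congr rfl fun j _ => ?_
  rw [W.D_R hh, map_smul]
  module

/-- A Leibniz rule in which a factor Φ_b lowers the degree of the density by one. The derivative in
x_2 has been set to zero while Φ_2 = -R²/2 is not constant; this accounts for the last term. -/
theorem nab_Phi (κ : ℂ) (c b : AmbIdx p n) (f : V) :
    W.nab κ c (W.Phi h b f) = asg c b • W.Phi h b (W.nab (κ - 1) c f) +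
      (if c = b then (1 : ℂ) else 0) • f -
      (if b = Sum.inl 1 then (1 : ℂ) else 0) • W.PhiUp h c f := by
  rcases c with c | c <;> rcases b with b | b
  · fin_cases c <;> fin_cases b
    · simp [nab_zero, Phi_zero, asg_inl_left]; module
    · simp [nab_zero, Phi_one, asg_inl_left, euler_R, W.PhiUp_zero hh]; module
    · simp [nab_one]
    · simp [nab_one, W.PhiUp_one hh]
  · fin_cases c
    · simp [nab_zero, Phi_inr, asg_inl_left, euler_X]; module
    · simp [nab_one]
  · fin_cases b
    · simp [nab_inr, Phi_zero, asg_inl_right]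
    · simp [nab_inr, Phi_one, asg_inl_right, W.pd_R hh, W.PhiUp_inr hh, smul_smul]
      module
  · simp [nab_inr, Phi_inr, asg_inr_inr, pd_X]

omit hh in
theorem nab_nab (κ : ℂ) (c d : AmbIdx p n) (f : V) :
    W.nab (κ - 1) c (W.nab κ d f) = asg c d • W.nab (κ - 1) d (W.nab κ c f) := by
  rcases c with c | c <;> rcases d with d | d
  · fin_cases c <;> fin_cases d <;> simp [asg_inl_left, nab_one]
  · fin_cases c
    · simp [asg_inl_left, nab_zero, nab_inr, euler_pd]; module
    · simp [nab_one]
  · fin_cases d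
    · simp [asg_inl_right, nab_zero, nab_inr, euler_pd]; module
    · simp [nab_one]
  · exact W.pd_pd c d f

/-- The raised entries of `A` are super-antisymmetric while Φ_a Φ_d is supersymmetric. This removes
the correction term of `nab_Phi`: the vector field of `A` is tangent to the cone. -/
theorem sum_Phi_PhiUp {A : Matrix (AmbIdx p n) (AmbIdx p n) ℂ}
    (hA : A ∈ osp (ambPar p n) (ambMetric h)) (f : V) :
    ∑ a, ∑ c, A a c • W.Phi h a (W.PhiUp h c f) = 0 := by
  have e : ∑ a, ∑ c, A a c • W.Phi h a (W.PhiUp h c f) =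
      ∑ a, ∑ d, raised (ambMetric h) A a d • W.Phi h a (W.Phi h d f) := by
    refine Finset.sum_congr rfl fun a _ => ?_
    simp only [PhiUp, raised, LinearMap.sum_apply, LinearMap.smul_apply, map_sum, map_smul,
      Finset.smul_sum, Finset.sum_smul, smul_smul]
    exact Finset.sum_comm
  have e2 : ∑ a, ∑ d, raised (ambMetric h) A a d • W.Phi h a (W.Phi h d f) =
      - ∑ a, ∑ d, raised (ambMetric h) A a d • W.Phi h a (W.Phi h d f) := by
    conv_lhs => rw [Finset.sum_comm]
    rw [← Finset.sum_neg_distrib]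
    refine Finset.sum_congr rfl fun a _ => ?_
    rw [← Finset.sum_neg_distrib]
    refine Finset.sum_congr rfl fun d _ => ?_
    rw [W.Phi_Phi hh, smul_smul, ← neg_smul]
    congr 1
    have := hh.ambMetric_isMetric.raised_symm hA a d
    have hs : asg d a = (-1) ^ (ambPar p n a * ambPar p n d) := by rw [asg, mul_comm]
    rw [hs]
    linear_combination this
  rw [e]
  exact eq_zero_of_eq_neg e2

/-- On densities of degree `κ`, `A` differentiates a product with `Φ_b`. -/
theorem densOp_Phi {A : Matrix (AmbIdx p n) (AmbIdx p n) ℂ}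
    (hA : A ∈ osp (ambPar p n) (ambMetric h)) (κ : ℂ) (b : AmbIdx p n) (f : V) :
    W.densOp h κ A (W.Phi h b f) =
      (∑ a, ∑ c, (A a c * asg c b) • W.Phi h a (W.Phi h b (W.nab (κ - 1) c f))) +
        ∑ a, A a b • W.Phi h a f := by
  simp only [densOp_apply, W.nab_Phi hh, map_add, map_sub, map_smul, smul_add, smul_sub, smul_smul,
    Finset.sum_add_distrib, Finset.sum_sub_distrib]
  have e1 : ∑ a, ∑ c, (A a c * if c = b then (1 : ℂ) else 0) • W.Phi h a f =
      ∑ a, A a b • W.Phi h a f := by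
    refine Finset.sum_congr rfl fun a _ => ?_
    rw [← Finset.sum_smul]
    simp
  have e2 : ∑ a, ∑ c, (A a c * if b = Sum.inl 1 then (1 : ℂ) else 0) •
      W.Phi h a (W.PhiUp h c f) = 0 := by
    by_cases hb : b = Sum.inl 1
    · simp only [if_pos hb, mul_one, W.sum_Phi_PhiUp hh hA]
    · simp [if_neg hb]
  rw [e1, e2, sub_zero]

theorem densOp_mul {A : Matrix (AmbIdx p n) (AmbIdx p n) ℂ}
    (hA : A ∈ osp (ambPar p n) (ambMetric h)) (κ : ℂ) (B : Matrix (AmbIdx p n) (AmbIdx p n) ℂ)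
    (f : V) :
    W.densOp h κ A (W.densOp h κ B f) =
      (∑ a, ∑ c, ∑ b, ∑ d, (A a c * B b d * asg c b) •
        W.Phi h a (W.Phi h b (W.nab (κ - 1) c (W.nab κ d f)))) + W.densOp h κ (A * B) f := by
  rw [W.densOp_apply h κ B, map_sum]
  simp only [map_sum, map_smul, W.densOp_Phi hh hA, smul_add, Finset.sum_add_distrib]
  congr 1
  · simp only [Finset.smul_sum, smul_smul]
    rw [Finset.sum_congr rfl fun b _ => Finset.sum_comm]
    rw [Finset.sum_comm]
    refine Finset.sum_congr rfl fun a _ => ?_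
    rw [Finset.sum_congr rfl fun b _ => Finset.sum_comm]
    rw [Finset.sum_comm]
    refine Finset.sum_congr rfl fun c _ => Finset.sum_congr rfl fun b _ =>
      Finset.sum_congr rfl fun d _ => ?_
    congr 1; ring
  · simp only [densOp_apply, Matrix.mul_apply, Finset.sum_smul, Finset.smul_sum, smul_smul]
    rw [Finset.sum_congr rfl fun b _ => Finset.sum_comm]
    rw [Finset.sum_comm]
    refine Finset.sum_congr rfl fun a _ => ?_
    rw [Finset.sum_comm]
    refine Finset.sum_congr rfl fun c _ => Finset.sum_congr rfl fun b _ => ?_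
    rw [mul_comm]

/-- By `densOp_mul` a product of two operators is a second-order term plus the operator of the
matrix product, so it remains to see that the second-order terms cancel. -/
theorem densOp_superBracket {i j : ℕ} {A B : Matrix (AmbIdx p n) (AmbIdx p n) ℂ}
    (hA : A ∈ osp (ambPar p n) (ambMetric h)) (hB : B ∈ osp (ambPar p n) (ambMetric h))
    (hi : IsHomogeneous (ambPar p n) i A) (hj : IsHomogeneous (ambPar p n) j B) (κ : ℂ) :
    W.densOp h κ (superBracket (ambPar p n) A B) = W.densOp h κ A * W.densOp h κ B -
      (-1 : ℂ) ^ (i * j) • (W.densOp h κ B * W.densOp h κ A) := by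
  ext1 f
  rw [superBracket_eq hi hj, sub_eq_add_neg, ← neg_smul, densOp_add, densOp_smul]
  simp only [LinearMap.add_apply, LinearMap.sub_apply, LinearMap.smul_apply, Module.End.mul_apply,
    W.densOp_mul hh hA, W.densOp_mul hh hB, smul_add]
  -- The second-order terms are supersymmetric in the two matrices, because the Φ supercommute and
  -- so do consecutive derivatives with degrees κ and κ - 1.
  have key : ∑ a, ∑ c, ∑ b, ∑ d, (A a c * B b d * asg c b) •
        W.Phi h a (W.Phi h b (W.nab (κ - 1) c (W.nab κ d f))) =
      (-1 : ℂ) ^ (i * j) • ∑ a, ∑ c, ∑ b, ∑ d, (B a c * A b d * asg c b) •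
        W.Phi h a (W.Phi h b (W.nab (κ - 1) c (W.nab κ d f))) := by
    simp only [Finset.smul_sum, smul_smul]
    have swap : ∀ F : AmbIdx p n → AmbIdx p n → AmbIdx p n → AmbIdx p n → V,
        ∑ a, ∑ c, ∑ b, ∑ d, F a c b d = ∑ a, ∑ c, ∑ b, ∑ d, F b d a c := by
      intro F
      have e : ∀ G : AmbIdx p n → AmbIdx p n → V, ∑ a, ∑ c, G a c = ∑ x : AmbIdx p n × AmbIdx p n,
        G x.1 x.2 := fun G => (Fintype.sum_prod_type' G).symm
      simp only [e]
      exact Finset.sum_comm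
    rw [swap]
    refine Finset.sum_congr rfl fun b _ => Finset.sum_congr rfl fun d _ =>
      Finset.sum_congr rfl fun a _ => Finset.sum_congr rfl fun c _ => ?_
    rw [W.Phi_Phi hh a b, W.nab_nab κ c d, map_smul, map_smul, smul_smul, smul_smul]
    congr 1
    by_cases h1 : A a c = 0
    · simp [h1]
    by_cases h2 : B b d = 0
    · simp [h2]
    have h1 := even_iff_of_modEq_two (hi _ _ h1)
    have h2 := even_iff_of_modEq_two (hj _ _ h2)
    have e : asg c b * asg c d * asg a b = (-1) ^ (i * j) * asg d a := by
      have e1 : (-1 : ℂ) ^ (i * j) =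
          (-1) ^ ((ambPar p n a + ambPar p n c) * (ambPar p n b + ambPar p n d)) :=
        neg_one_pow_congr (by rw [Nat.even_mul, Nat.even_mul, h1, h2])
      have e2 : (ambPar p n a + ambPar p n c) * (ambPar p n b + ambPar p n d) +
          ambPar p n d * ambPar p n a = ambPar p n c * ambPar p n b + ambPar p n c * ambPar p n d +
          ambPar p n a * ambPar p n b + 2 * (ambPar p n a * ambPar p n d) := by ring
      rw [e1]
      simp only [asg, ← pow_add]
      rw [e2, pow_add _ _ (2 * _), pow_mul _ 2, neg_one_sq, one_pow, mul_one]
    linear_combination (A a c * B b d) * e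
  rw [key]
  module

end

/-- The operators by which `osp(p+2|2n)` acts. -/
def confOps (h : Matrix (Idx p n) (Idx p n) ℂ) : Set (Module.End ℂ V) :=
  W.confOp h '' (osp (ambPar p n) (ambMetric h) : Set (Matrix (AmbIdx p n) (AmbIdx p n) ℂ))

/-- The operators by which `osp(p|2n)` acts. -/
def rotOps (h : Matrix (Idx p n) (Idx p n) ℂ) : Set (Module.End ℂ V) :=
  (fun A => W.confOp h (Matrix.fromBlocks 0 0 0 A)) ''
    (osp (par p n) h : Set (Matrix (Idx p n) (Idx p n) ℂ))

theorem parityOp_Phi (hh : IsMetric (par p n) h) (a : AmbIdx p n) (f : V) :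
    W.parityOp (W.Phi h a f) = (-1 : ℂ) ^ ambPar p n a • W.Phi h a (W.parityOp f) := by
  rcases a with a | a
  · fin_cases a <;> simp [ambPar, Phi_zero, Phi_one, W.parityOp_R hh]
  · exact W.parityOp_X a f

theorem parityOp_nab (κ : ℂ) (a : AmbIdx p n) (f : V) :
    W.parityOp (W.nab κ a f) = (-1 : ℂ) ^ ambPar p n a • W.nab κ a (W.parityOp f) := by
  rcases a with a | a
  · fin_cases a <;> simp [ambPar, nab_zero, nab_one, W.parityOp_euler]
  · exact W.parityOp_pd a f

theorem densOp_parityOp (hh : IsMetric (par p n) h) {i : ℕ}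
    {A : Matrix (AmbIdx p n) (AmbIdx p n) ℂ} (hi : IsHomogeneous (ambPar p n) i A) (κ : ℂ) :
    W.densOp h κ A * W.parityOp = (-1 : ℂ) ^ i • (W.parityOp * W.densOp h κ A) := by
  ext1 f
  simp only [Module.End.mul_apply, LinearMap.smul_apply, densOp_apply, map_sum, map_smul,
    W.parityOp_Phi hh, parityOp_nab, Finset.smul_sum, smul_smul]
  refine Finset.sum_congr rfl fun a _ => Finset.sum_congr rfl fun c _ => ?_
  congr 1
  by_cases h1 : A a c = 0
  · simp [h1]
  have h1 := even_iff_of_modEq_two (hi _ _ h1)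
  have e : (-1 : ℂ) ^ i * ((-1) ^ ambPar p n a * (-1) ^ ambPar p n c) = 1 := by
    rw [← pow_add, ← pow_add, Even.neg_one_pow]
    rw [Nat.even_add] at *
    rw [Nat.even_add]
    tauto
  linear_combination - A a c * e

end SuperWeyl
end OspHarm

/-! ### Stability in terms of generators, and the grading by degree -/

namespace OspHarm
variable {p n : ℕ} {h : Matrix (Idx p n) (Idx p n) ℂ}

namespace SuperWeyl
variable {V : Type} [Ring V] [Algebra ℂ V] (W : SuperWeyl p n V)

/-- A subspace stable under a set of operators. -/
def Stable (S : Set (Module.End ℂ V)) (U : Submodule ℂ V) : Prop :=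
  ∀ T ∈ S, ∀ f ∈ U, T f ∈ U

/-- Stability under the operators `D_j`, `E`, `K_j` and `L_{ij}`. -/
structure ConfStable (h : Matrix (Idx p n) (Idx p n) ℂ) (U : Submodule ℂ V) : Prop where
  D : ∀ j, ∀ f ∈ U, W.D h j f ∈ U
  euler : ∀ f ∈ U, W.euler f ∈ U
  K : ∀ j, ∀ f ∈ U, W.K h j f ∈ U
  L : ∀ i j, ∀ f ∈ U, W.L h i j f ∈ U

/-- Stability under the operators `L_{ij}`. -/
def RotStable (h : Matrix (Idx p n) (Idx p n) ℂ) (U : Submodule ℂ V) : Prop :=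
  ∀ i j, ∀ f ∈ U, W.L h i j f ∈ U

/-- The ambient derivatives with lowered index. -/
def nabLow (h : Matrix (Idx p n) (Idx p n) ℂ) (κ : ℂ) (b : AmbIdx p n) : Module.End ℂ V :=
  ∑ c, ambMetric h c b • W.nab κ c

theorem nabLow_zero (κ : ℂ) (f : V) : W.nabLow h κ (Sum.inl 0) f = 0 := by
  simp [nabLow, ambMetric, nab_one]
theorem nabLow_one (κ : ℂ) (f : V) : W.nabLow h κ (Sum.inl 1) f = κ • f - W.euler f := by
  simp [nabLow, ambMetric, nab_zero]
theorem nabLow_inr (κ : ℂ) (j : Idx p n) (f : V) : W.nabLow h κ (Sum.inr j) f = W.D h j f := by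
  simp [nabLow, ambMetric, nab_inr, D_apply]

theorem densOp_ospGen (κ : ℂ) (a b : AmbIdx p n) (f : V) :
    W.densOp h κ (ospGen (ambPar p n) (ambMetric h) a b) f =
      W.Phi h a (W.nabLow h κ b f) - asg a b • W.Phi h b (W.nabLow h κ a f) := by
  simp only [densOp_apply, ospGen, sub_smul, Finset.sum_sub_distrib]
  congr 1
  · rw [Finset.sum_eq_single a]
    · simp only [if_true, nabLow, LinearMap.sum_apply, LinearMap.smul_apply, map_sum, map_smul]
    · intro x _ hx
      simp only [if_neg hx, zero_smul, Finset.sum_const_zero]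
    · simp
  · rw [Finset.sum_eq_single b]
    · simp only [if_true, nabLow, LinearMap.sum_apply, LinearMap.smul_apply, map_sum, map_smul,
        Finset.smul_sum, smul_smul]
      rfl
    · intro x _ hx
      simp only [if_neg hx, mul_zero, zero_smul, Finset.sum_const_zero]
    · simp

theorem densOp_sum {α : Type} (s : Finset α) (κ : ℂ) (A : α → Matrix (AmbIdx p n) (AmbIdx p n) ℂ) :
    W.densOp h κ (∑ a ∈ s, A a) = ∑ a ∈ s, W.densOp h κ (A a) := by
  classical
  induction s using Finset.induction_on with
  | empty =>
    have := W.densOp_smul (h := h) κ 0 (0 : Matrix (AmbIdx p n) (AmbIdx p n) ℂ)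
    rw [zero_smul, zero_smul] at this
    simpa using this
  | insert a s ha ih => rw [Finset.sum_insert ha, Finset.sum_insert ha, densOp_add, ih]

/-- Here κ = 1 - M/2 enters: twice -X_j(κ - E) is X_j(2E + M - 2), and the factor 2 clears the one
half in Φ_2. -/
theorem K_eq (j : Idx p n) (f : V) : W.K h j f =
    (2 : ℂ) • W.densOp h (1 - sdim p n / 2)
      (ospGen (ambPar p n) (ambMetric h) (Sum.inl 1) (Sum.inr j)) f := by
  rw [densOp_ospGen, nabLow_inr, nabLow_one, Phi_one, Phi_inr, asg_inl_left, K_apply]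
  simp only [map_sub, map_smul]
  module

theorem D_eq (j : Idx p n) (f : V) : W.D h j f = W.densOp h (1 - sdim p n / 2)
      (ospGen (ambPar p n) (ambMetric h) (Sum.inl 0) (Sum.inr j)) f := by
  rw [densOp_ospGen, nabLow_inr, nabLow_zero, Phi_zero]
  simp

theorem L_eq (κ : ℂ) (i j : Idx p n) (f : V) : W.L h i j f = W.densOp h κ
      (ospGen (ambPar p n) (ambMetric h) (Sum.inr i) (Sum.inr j)) f := by
  rw [densOp_ospGen, nabLow_inr, nabLow_inr, Phi_inr, Phi_inr, asg_inr_inr, L_apply]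

theorem stable_confOps_iff (hh : IsMetric (par p n) h) (U : Submodule ℂ V) :
    Stable (W.confOps h) U ↔ W.ConfStable h U := by
  have hg := hh.ambMetric_isMetric
  constructor
  · intro hU
    have key : ∀ a b, ∀ f ∈ U, W.densOp h (1 - sdim p n / 2)
        (ospGen (ambPar p n) (ambMetric h) a b) f ∈ U := by
      intro a b f hf
      rw [← W.confOp_eq]
      exact hU _ ⟨_, hg.ospGen_mem a b, rfl⟩ f hf
    refine ⟨fun j f hf => ?_, fun f hf => ?_, fun j f hf => ?_, fun i j f hf => ?_⟩
    · rw [D_eq]; exact key _ _ f hf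
    -- This generator acts as κ - E, so the Euler operator is recovered by subtracting from κ f.
    · have h1 := key (Sum.inl 0) (Sum.inl 1) f hf
      rw [densOp_ospGen, nabLow_one, nabLow_zero, Phi_zero, map_zero, smul_zero, sub_zero] at h1
      have h2 := U.sub_mem (U.smul_mem (1 - sdim p n / 2) hf) h1
      rwa [sub_sub_cancel] at h2
    · rw [K_eq]; exact U.smul_mem _ (key _ _ f hf)
    · rw [W.L_eq (1 - sdim p n / 2)]; exact key _ _ f hf
  · rintro hU _ ⟨A, hA, rfl⟩ f hf
    rw [W.confOp_eq, hg.eq_sum_ospGen hA]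
    simp only [densOp_sum, densOp_smul, LinearMap.sum_apply, LinearMap.smul_apply]
    refine U.sum_mem fun a _ => U.sum_mem fun b _ => U.smul_mem _ ?_
    have hE : ∀ κ : ℂ, κ • f - W.euler f ∈ U := fun κ => U.sub_mem (U.smul_mem _ hf) (hU.euler f hf)
    have hK : ∀ j, W.densOp h (1 - sdim p n / 2)
        (ospGen (ambPar p n) (ambMetric h) (Sum.inl 1) (Sum.inr j)) f ∈ U := by
      intro j
      have := U.smul_mem (1 / 2 : ℂ) (hU.K j f hf)
      rw [K_eq, smul_smul] at this
      simpa using this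
    rcases a with a | a <;> rcases b with b | b
    · rw [densOp_ospGen]
      fin_cases a <;> fin_cases b <;>
        simp [nabLow_zero, nabLow_one, asg_inl_left, Phi_zero]
      · exact hE _
      · have := U.neg_mem (hE (1 - sdim p n / 2))
        rwa [neg_sub] at this
    · fin_cases a
      · exact (W.D_eq b f) ▸ hU.D b f hf
      · exact hK b
    · have e : ∀ x, W.densOp h (1 - sdim p n / 2)
          (ospGen (ambPar p n) (ambMetric h) (Sum.inr a) (Sum.inl x)) f = - W.densOp h
            (1 - sdim p n / 2) (ospGen (ambPar p n) (ambMetric h) (Sum.inl x) (Sum.inr a)) f := by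
        intro x
        rw [densOp_ospGen, densOp_ospGen, asg_inl_left, asg_inl_right]
        module
      rw [e]
      refine U.neg_mem ?_
      fin_cases b
      · exact (W.D_eq a f) ▸ hU.D a f hf
      · exact hK a
    · rw [← W.L_eq]; exact hU.L a b f hf

theorem confOp_fromBlocks_ospGen (i j : Idx p n) (f : V) :
    W.confOp h (Matrix.fromBlocks 0 0 0 (ospGen (par p n) h i j)) f = W.L h i j f := by
  rw [W.L_eq (1 - sdim p n / 2), confOp_eq]
  congr 2
  ext (x | x) (c | c)
  · simp [ospGen]
  · simp [ospGen]
  · simp [ospGen, ambMetric]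
  · simp [ospGen, ambMetric]; rfl

theorem stable_rotOps_iff (hh : IsMetric (par p n) h) (U : Submodule ℂ V) :
    Stable (W.rotOps h) U ↔ W.RotStable h U := by
  constructor
  · intro hU i j f hf
    rw [← confOp_fromBlocks_ospGen]
    exact hU _ ⟨_, hh.ospGen_mem i j, rfl⟩ f hf
  · rintro hU _ ⟨A, hA, rfl⟩ f hf
    have e : (Matrix.fromBlocks 0 0 0 A : Matrix (AmbIdx p n) (AmbIdx p n) ℂ) =
        ∑ a, ∑ b, (raised h A a b / 2) • Matrix.fromBlocks 0 0 0 (ospGen (par p n) h a b) := by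
      conv_lhs => rw [hh.eq_sum_ospGen hA]
      ext (x | x) (c | c) <;> simp only [Matrix.sum_apply, Matrix.smul_apply,
        Matrix.fromBlocks_apply₁₁, Matrix.fromBlocks_apply₁₂, Matrix.fromBlocks_apply₂₁,
        Matrix.fromBlocks_apply₂₂, Matrix.zero_apply, smul_zero, Finset.sum_const_zero]
    simp only [e, W.confOp_eq, densOp_sum, densOp_smul, LinearMap.sum_apply, LinearMap.smul_apply]
    refine U.sum_mem fun a _ => U.sum_mem fun b _ => U.smul_mem _ ?_
    rw [← W.confOp_eq, confOp_fromBlocks_ospGen]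
    exact hU a b f hf

/-! Graded pieces. -/

/-- Superpolynomials of degree `c`. -/
def deg (c : ℂ) : Submodule ℂ V := Module.End.eigenspace W.euler c

theorem mem_deg {c : ℂ} {f : V} : f ∈ W.deg c ↔ W.euler f = c • f :=
  Module.End.mem_eigenspace_iff

/-- The span of the coordinates. -/
def lin : Submodule ℂ V := Submodule.span ℂ (Set.range W.coord)

theorem euler_one : W.euler 1 = 0 := by simp [euler_eq, W.pd_one]

theorem X_mem_deg {c : ℂ} {f : V} (hf : f ∈ W.deg c) (j : Idx p n) : W.X j f ∈ W.deg (c + 1) := by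
  rw [mem_deg] at *
  rw [euler_X, hf, map_smul]
  module

theorem D_mem_deg {c : ℂ} {f : V} (hf : f ∈ W.deg c) (j : Idx p n) : W.D h j f ∈ W.deg (c - 1) := by
  rw [mem_deg] at *
  rw [euler_D, hf, map_smul]
  module

theorem R_mem_deg {c : ℂ} {f : V} (hf : f ∈ W.deg c) : W.R h f ∈ W.deg (c + 2) := by
  rw [mem_deg] at *
  rw [euler_R, hf, map_smul]
  module

theorem L_mem_deg {c : ℂ} {f : V} (hf : f ∈ W.deg c) (i j : Idx p n) : W.L h i j f ∈ W.deg c := by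
  rw [mem_deg] at *
  rw [euler_L, hf, map_smul]

theorem K_mem_deg {c : ℂ} {f : V} (hf : f ∈ W.deg c) (j : Idx p n) : W.K h j f ∈ W.deg (c + 1) := by
  rw [mem_deg] at *
  rw [euler_K, hf, map_smul]
  module

theorem lin_pow_le_deg (k : ℕ) : W.lin ^ k ≤ W.deg k := by
  induction k with
  | zero =>
    rw [pow_zero, Submodule.one_le, mem_deg, euler_one]
    simp
  | succ k ih =>
    rw [pow_succ', Submodule.mul_le]
    intro x hx f hf
    refine Submodule.span_induction (p := fun x _ => x * f ∈ W.deg ((k + 1 : ℕ) : ℂ)) ?_ ?_ ?_ ?_ hx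
    · rintro _ ⟨j, rfl⟩
      have := W.X_mem_deg (ih hf) j
      rw [Nat.cast_succ]
      exact this
    · rw [zero_mul]; exact Submodule.zero_mem _
    · intro x y _ _ h1 h2; rw [add_mul]; exact Submodule.add_mem _ h1 h2
    · intro c x _ h1; rw [smul_mul_assoc]; exact Submodule.smul_mem _ _ h1

theorem iSup_lin_pow : ⨆ k : ℕ, W.lin ^ k = ⊤ := by
  refine W.eq_top _ ?_ fun j f hf => ?_
  · refine Submodule.mem_iSup_of_mem 0 ?_
    rw [pow_zero]; exact Submodule.one_le.1 le_rfl
  · refine Submodule.iSup_induction (fun k : ℕ => W.lin ^ k)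
      (motive := fun f => W.coord j * f ∈ ⨆ k : ℕ, W.lin ^ k) hf ?_ ?_ ?_
    · intro k f hf
      refine Submodule.mem_iSup_of_mem (k + 1) ?_
      rw [pow_succ']
      exact Submodule.mul_mem_mul (Submodule.subset_span ⟨j, rfl⟩) hf
    · rw [mul_zero]; exact Submodule.zero_mem _
    · intro f g hf hg; rw [mul_add]; exact Submodule.add_mem _ hf hg

end SuperWeyl

/-- In a direct sum of eigenspaces, homogeneous elements of a sum of subspaces of the eigenspaces
lie in the corresponding subspace. -/
theorem mem_of_mem_iSup_of_mem_eigenspace {V : Type} [AddCommGroup V] [Module ℂ V]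
    {T : Module.End ℂ V} {ι : Type} {c : ι → ℂ} (hc : Function.Injective c)
    {A : ι → Submodule ℂ V} (hA : ∀ i, A i ≤ Module.End.eigenspace T (c i)) {f : V}
    (hf : f ∈ ⨆ i, A i) {i : ι} (hi : f ∈ Module.End.eigenspace T (c i)) : f ∈ A i := by
  classical
  obtain ⟨m, hm, rfl⟩ := (Submodule.mem_iSup_iff_exists_finsupp _ _).1 hf
  have hind := (Module.End.eigenspaces_iSupIndep T).comp hc
  have key : (m.sum fun i x => x) - m i = 0 := by
    have h1 : (m.sum fun i x => x) - m i ∈ ⨆ j, ⨆ (_ : j ≠ i), Module.End.eigenspace T (c j) := by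
      rw [Finsupp.sum]
      by_cases him : i ∈ m.support
      · rw [← Finset.add_sum_erase _ _ him, add_sub_cancel_left]
        refine Submodule.sum_mem _ fun j hj => ?_
        exact Submodule.mem_iSup_of_mem j (Submodule.mem_iSup_of_mem (Finset.ne_of_mem_erase hj)
          (hA j (hm j)))
      · rw [Finsupp.notMem_support_iff.1 him, sub_zero]
        refine Submodule.sum_mem _ fun j hj => ?_
        refine Submodule.mem_iSup_of_mem j (Submodule.mem_iSup_of_mem ?_ (hA j (hm j)))
        rintro rfl; exact him hj
    have h2 := Submodule.sub_mem _ hi (hA i (hm i))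
    exact Submodule.disjoint_def.1 (hind i) _ h2 h1
  rw [sub_eq_zero.1 key]
  exact hm i

/-- A stable subspace of a direct sum of eigenspaces contains the homogeneous components of its
elements. -/
theorem le_iSup_inf_eigenspace {V : Type} [AddCommGroup V] [Module ℂ V]
    {T : Module.End ℂ V} {ι : Type} {c : ι → ℂ} (hc : Function.Injective c)
    {U : Submodule ℂ V} (hU : ∀ f ∈ U, T f ∈ U)
    (hle : U ≤ ⨆ i, Module.End.eigenspace T (c i)) :
    U ≤ ⨆ i, U ⊓ Module.End.eigenspace T (c i) := by
  classical
  have key : ∀ s : Finset ι, ∀ m : ι → V, (∀ i, m i ∈ Module.End.eigenspace T (c i)) →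
      ∑ i ∈ s, m i ∈ U → ∀ i ∈ s, m i ∈ U := by
    intro s
    induction s using Finset.induction_on with
    | empty => simp
    | insert a s ha ih =>
      intro m hm hs
      have h1 : ∑ i ∈ s, (c i - c a) • m i ∈ U := by
        have h2 := U.sub_mem (hU _ hs) (U.smul_mem (c a) hs)
        rw [map_sum, Finset.smul_sum, ← Finset.sum_sub_distrib, Finset.sum_insert ha] at h2
        have h3 : ∀ i, T (m i) - c a • m i = (c i - c a) • m i := fun i => by
          rw [Module.End.mem_eigenspace_iff.1 (hm i), sub_smul]
        simp only [h3, sub_self, zero_smul, zero_add] at h2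
        exact h2
      have h2 := ih (fun i => (c i - c a) • m i) (fun i => Submodule.smul_mem _ _ (hm i)) h1
      have h3 : ∀ i ∈ s, m i ∈ U := by
        intro i hi
        have hne : c i - c a ≠ 0 := by
          rw [sub_ne_zero]
          intro he
          exact ha (hc he ▸ hi)
        have := U.smul_mem (c i - c a)⁻¹ (h2 i hi)
        rwa [smul_smul, inv_mul_cancel₀ hne, one_smul] at this
      intro i hi
      rcases Finset.mem_insert.1 hi with rfl | hi
      · rw [Finset.sum_insert ha] at hs
        have := U.sub_mem hs (U.sum_mem h3)
        rwa [add_sub_cancel_right] at this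
      · exact h3 i hi
  intro f hf
  obtain ⟨m, hm, rfl⟩ := (Submodule.mem_iSup_iff_exists_finsupp _ _).1 (hle hf)
  rw [Finsupp.sum] at hf ⊢
  refine Submodule.sum_mem _ fun i hi => ?_
  exact Submodule.mem_iSup_of_mem i ⟨key _ m hm hf i hi, hm i⟩

namespace SuperWeyl
variable {V : Type} [Ring V] [Algebra ℂ V] (W : SuperWeyl p n V)

theorem iSup_deg : ⨆ k : ℕ, W.deg k = ⊤ :=
  eq_top_iff.2 (W.iSup_lin_pow ▸ iSup_mono W.lin_pow_le_deg)

theorem deg_eq_lin_pow (k : ℕ) : W.deg k = W.lin ^ k := by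
  refine le_antisymm (fun f hf => ?_) (W.lin_pow_le_deg k)
  refine mem_of_mem_iSup_of_mem_eigenspace (T := W.euler) (c := fun k : ℕ => (k : ℂ))
    (A := fun k : ℕ => W.lin ^ k) Nat.cast_injective W.lin_pow_le_deg ?_ hf
  rw [W.iSup_lin_pow]
  exact Submodule.mem_top

/-- The eigenspaces for natural numbers already span everything. This gives the vanishing of
elements of negative degree. -/
theorem deg_eq_bot {c : ℂ} (hc : ∀ k : ℕ, c ≠ k) : W.deg c = ⊥ := by
  rw [eq_bot_iff]
  intro f hf
  -- The eigenvalue c is adjoined to the natural numbers as the label `none`, with the zero subspace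
  -- attached to it.
  have hinj : Function.Injective (fun o : Option ℕ => o.elim c fun k => (k : ℂ)) := by
    rintro (_ | a) (_ | b) hab
    · rfl
    · exact absurd hab (hc b)
    · exact absurd hab.symm (hc a)
    · simp at hab; rw [hab]
  refine mem_of_mem_iSup_of_mem_eigenspace (T := W.euler) (c := fun o : Option ℕ => o.elim c fun k => (k : ℂ))
    (A := fun o : Option ℕ => o.elim ⊥ fun k => W.deg k) hinj ?_ ?_ (i := none) hf
  · rintro (_ | k)
    · exact bot_le
    · exact le_rfl
  · rw [iSup_option]
    simp [W.iSup_deg]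

theorem deg_zero : W.deg 0 = Submodule.span ℂ {1} := by
  have := W.deg_eq_lin_pow 0
  rw [Nat.cast_zero, pow_zero, Submodule.one_eq_span] at this
  exact this

theorem finite_deg (k : ℕ) : Module.Finite ℂ (W.deg k) := by
  rw [deg_eq_lin_pow]
  apply Module.Finite.iff_fg.2
  exact (Submodule.fg_span (Set.finite_range _)).pow k

end SuperWeyl
end OspHarm

/-! ### Harmonic polynomials and irreducibility outside the critical dimensions -/

namespace OspHarm
variable {p n : ℕ} {h : Matrix (Idx p n) (Idx p n) ℂ}

namespace SuperWeyl
variable {V : Type} [Ring V] [Algebra ℂ V] (W : SuperWeyl p n V)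

/-- Spherical harmonics of degree `k`. -/
def harmDeg (h : Matrix (Idx p n) (Idx p n) ℂ) (k : ℕ) : Submodule ℂ V :=
  LinearMap.ker (W.laplace h) ⊓ Module.End.eigenspace W.euler (k : ℂ)

/-- The harmonic superpolynomials. -/
def harm (h : Matrix (Idx p n) (Idx p n) ℂ) : Submodule ℂ V :=
  ⨆ k : ℕ, W.harmDeg h k

/-- A stable graded subspace. -/
def IsSubrep (S : Set (Module.End ℂ V)) (U : Submodule ℂ V) : Prop :=
  Stable S U ∧ ∀ f ∈ U, W.parityOp f ∈ U

/-- Irreducibility. -/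
def IsIrred (S : Set (Module.End ℂ V)) (U : Submodule ℂ V) : Prop :=
  W.IsSubrep S U ∧ U ≠ ⊥ ∧ ∀ U' ≤ U, Stable S U' → U' = ⊥ ∨ U' = U

theorem mem_harmDeg {k : ℕ} {f : V} :
    f ∈ W.harmDeg h k ↔ W.laplace h f = 0 ∧ f ∈ W.deg k := by
  rw [harmDeg, Submodule.mem_inf, LinearMap.mem_ker]; rfl

theorem harmDeg_le_deg (k : ℕ) : W.harmDeg h k ≤ W.deg k := fun _ hf => (W.mem_harmDeg.1 hf).2

theorem harmDeg_le_harm (k : ℕ) : W.harmDeg h k ≤ W.harm h := le_iSup (W.harmDeg h) k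

/-- Δ is homogeneous of degree -2, so its kernel is stable under the Euler operator and splits into
degrees. -/
theorem harm_eq_ker : W.harm h = LinearMap.ker (W.laplace h) := by
  refine le_antisymm (iSup_le fun k => inf_le_left) ?_
  have := le_iSup_inf_eigenspace (T := W.euler) (c := fun k : ℕ => (k : ℂ)) Nat.cast_injective
    (U := LinearMap.ker (W.laplace h)) (fun f hf => by
      rw [LinearMap.mem_ker] at *
      have := W.euler_laplace (h := h) f
      rw [hf, map_zero, smul_zero, sub_zero] at this
      exact this.symm)
    (by rw [show (⨆ k : ℕ, Module.End.eigenspace W.euler (k : ℂ)) = ⊤ from W.iSup_deg]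
        exact le_top)
  exact this

theorem mem_harm {f : V} : f ∈ W.harm h ↔ W.laplace h f = 0 := by
  rw [harm_eq_ker, LinearMap.mem_ker]

theorem confStable_harm (hh : IsMetric (par p n) h) : W.ConfStable h (W.harm h) where
  D j f hf := by rw [mem_harm] at *; rw [← W.D_laplace hh, hf, map_zero]
  euler f hf := by
    rw [mem_harm] at *
    have := W.euler_laplace (h := h) f
    rw [hf, map_zero, smul_zero, sub_zero] at this
    exact this.symm
  K j f hf := by rw [mem_harm] at *; rw [W.laplace_K hh, hf]; simp
  L i j f hf := by rw [mem_harm] at *; rw [W.laplace_L hh, hf, map_zero]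

theorem parityOp_mem_harm (hh : IsMetric (par p n) h) {f : V} (hf : f ∈ W.harm h) :
    W.parityOp f ∈ W.harm h := by
  rw [mem_harm] at *; rw [← W.parityOp_laplace hh, hf, map_zero]

theorem parityOp_mem_harmDeg (hh : IsMetric (par p n) h) {k : ℕ} {f : V} (hf : f ∈ W.harmDeg h k) :
    W.parityOp f ∈ W.harmDeg h k := by
  rw [mem_harmDeg, mem_deg] at *
  rw [← W.parityOp_laplace hh, hf.1, map_zero, ← parityOp_euler, hf.2, map_smul]
  exact ⟨rfl, rfl⟩

theorem rotStable_harmDeg (hh : IsMetric (par p n) h) (k : ℕ) : W.RotStable h (W.harmDeg h k) := by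
  intro i j f hf
  rw [mem_harmDeg] at *
  exact ⟨by rw [W.laplace_L hh, hf.1, map_zero], W.L_mem_deg hf.2 i j⟩

theorem D_mem_harmDeg (hh : IsMetric (par p n) h) {k : ℕ} {f : V} (hf : f ∈ W.harmDeg h (k + 1))
    (j : Idx p n) : W.D h j f ∈ W.harmDeg h k := by
  rw [mem_harmDeg] at *
  refine ⟨by rw [← W.D_laplace hh, hf.1, map_zero], ?_⟩
  have := W.D_mem_deg (h := h) hf.2 j
  rwa [Nat.cast_succ, add_sub_cancel_right] at this

theorem K_mem_harmDeg (hh : IsMetric (par p n) h) {k : ℕ} {f : V} (hf : f ∈ W.harmDeg h k)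
    (j : Idx p n) : W.K h j f ∈ W.harmDeg h (k + 1) := by
  rw [mem_harmDeg] at *
  refine ⟨by rw [W.laplace_K hh, hf.1]; simp, ?_⟩
  rw [Nat.cast_succ]
  exact W.K_mem_deg hf.2 j

theorem D_eq_zero_of_mem_deg_zero {f : V} (hf : f ∈ W.deg 0) (j : Idx p n) : W.D h j f = 0 := by
  rw [deg_zero, Submodule.mem_span_singleton] at hf
  obtain ⟨c, rfl⟩ := hf
  simp [D_apply, W.pd_one]

theorem one_mem_harmDeg : (1 : V) ∈ W.harmDeg h 0 := by
  rw [mem_harmDeg, mem_deg, euler_one]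
  simp [laplace_eq_pd, W.pd_one]

theorem harmDeg_zero_le {U : Submodule ℂ V} (hU : (1 : V) ∈ U) : W.harmDeg h 0 ≤ U := by
  intro f hf
  have := W.harmDeg_le_deg 0 hf
  rw [Nat.cast_zero, deg_zero] at this
  exact (Submodule.span_singleton_le_iff_mem _ _).2 hU this

/-- Euler's identity: c f = ∑ h^{jk} X_j D_k f. -/
theorem eq_zero_of_D {c : ℂ} (hc : c ≠ 0) (hh : IsMetric (par p n) h) {f : V} (hf : f ∈ W.deg c)
    (hD : ∀ j, W.D h j f = 0) : f = 0 := by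
  have := W.euler_eq_D hh f
  simp only [hD, map_zero, smul_zero, Finset.sum_const_zero] at this
  rw [W.mem_deg.1 hf] at this
  exact (smul_eq_zero.1 this).resolve_left hc

theorem ConfStable.inf_deg {U : Submodule ℂ V} (hU : W.ConfStable h U) :
    U ≤ ⨆ k : ℕ, U ⊓ W.deg k :=
  le_iSup_inf_eigenspace (T := W.euler) (c := fun k : ℕ => (k : ℂ)) Nat.cast_injective hU.euler
    (by rw [show (⨆ k : ℕ, Module.End.eigenspace W.euler (k : ℂ)) = ⊤ from W.iSup_deg]
        exact le_top)

/-- In the least degree where the subspace is nonzero every D_j vanishes on it, so this degree is 0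
and the elements are constants. -/
theorem ConfStable.one_mem (hh : IsMetric (par p n) h) {U : Submodule ℂ V}
    (hU : W.ConfStable h U) (hne : U ≠ ⊥) : (1 : V) ∈ U := by
  classical
  have hex : ∃ k : ℕ, U ⊓ W.deg k ≠ ⊥ := by
    by_contra hcon
    push Not at hcon
    apply hne
    rw [eq_bot_iff]
    refine (ConfStable.inf_deg W hU).trans (iSup_le fun k => (hcon k).le)
  obtain ⟨f, hf, hf0⟩ := Submodule.exists_mem_ne_zero_of_ne_bot (Nat.find_spec hex)
  rcases hk : Nat.find hex with _ | k
  · rw [hk, Nat.cast_zero, deg_zero, Submodule.mem_inf, Submodule.mem_span_singleton] at hf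
    obtain ⟨hfU, c, rfl⟩ := hf
    have hc : c ≠ 0 := by rintro rfl; exact hf0 (zero_smul _ _)
    have := U.smul_mem c⁻¹ hfU
    rwa [smul_smul, inv_mul_cancel₀ hc, one_smul] at this
  · rw [hk] at hf
    exfalso
    apply hf0
    refine W.eq_zero_of_D (Nat.cast_ne_zero.2 k.succ_ne_zero) hh hf.2 fun j => ?_
    have hmin := Nat.find_min hex (m := k) (by omega)
    push Not at hmin
    rw [← Submodule.mem_bot ℂ, ← hmin]
    refine ⟨hU.D j f hf.1, ?_⟩
    have := W.D_mem_deg (h := h) hf.2 j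
    rwa [Nat.cast_succ, add_sub_cancel_right] at this

/-- The sum is (2k + M - 2)E - R²Δ applied to g: each D_l g has degree k, so the factor 2E + M - 2
in K_j is a scalar. The zeros of the first factor of the eigenvalue are the critical dimensions. -/
theorem sum_K_D (hh : IsMetric (par p n) h) {k : ℕ} {g : V} (hg : g ∈ W.harmDeg h (k + 1)) :
    ∑ j, ∑ l, upper h j l • W.K h j (W.D h l g) =
      ((2 * k + sdim p n - 2) * (k + 1)) • g := by
  obtain ⟨h1, h2⟩ := W.mem_harmDeg.1 hg
  have e : ∀ j l, upper h j l • W.K h j (W.D h l g) =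
      (2 * k + sdim p n - 2 : ℂ) • (upper h j l • W.X j (W.D h l g)) -
        W.R h (upper h j l • W.D h j (W.D h l g)) := by
    intro j l
    rw [K_apply, euler_D, W.mem_deg.1 h2, Nat.cast_succ]
    simp only [map_sub, map_smul]
    module
  simp only [e, Finset.sum_sub_distrib, ← Finset.smul_sum, ← map_sum]
  rw [← W.euler_eq_D hh, ← W.laplace_eq_D hh, h1, map_zero, sub_zero, W.mem_deg.1 h2, smul_smul,
    Nat.cast_succ]

theorem harmDeg_succ_le (hh : IsMetric (par p n) h) {U : Submodule ℂ V} (hU : W.ConfStable h U)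
    {k : ℕ} (hk : (2 * k + sdim p n - 2 : ℂ) ≠ 0) (hle : W.harmDeg h k ≤ U) :
    W.harmDeg h (k + 1) ≤ U := by
  intro g hg
  have h1 : ∑ j, ∑ l, upper h j l • W.K h j (W.D h l g) ∈ U :=
    U.sum_mem fun j _ => U.sum_mem fun l _ => U.smul_mem _
      (hU.K j _ (hle (W.D_mem_harmDeg hh hg l)))
  rw [W.sum_K_D hh hg] at h1
  have hne : ((2 * k + sdim p n - 2) * (k + 1) : ℂ) ≠ 0 :=
    mul_ne_zero hk (Nat.cast_add_one_ne_zero k)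
  have := U.smul_mem ((2 * k + sdim p n - 2) * (k + 1) : ℂ)⁻¹ h1
  rwa [smul_smul, inv_mul_cancel₀ hne, one_smul] at this

theorem isSubrep_harm (hh : IsMetric (par p n) h) : W.IsSubrep (W.confOps h) (W.harm h) :=
  ⟨(W.stable_confOps_iff hh _).2 (W.confStable_harm hh), fun _ hf => W.parityOp_mem_harm hh hf⟩

theorem one_ne_zero' (W : SuperWeyl p n V) : (1 : V) ≠ 0 := by
  intro h0
  have := congrArg W.augmentation h0
  rw [map_one, map_zero] at this
  exact one_ne_zero this

theorem isIrred_harm (hh : IsMetric (par p n) h)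
    (hpn : ∀ q : ℕ, (p : ℤ) - 2 * (n : ℤ) ≠ 2 - 2 * (q : ℤ)) :
    W.IsIrred (W.confOps h) (W.harm h) := by
  refine ⟨W.isSubrep_harm hh, fun hbot => ?_, fun U hU hst => ?_⟩
  · have := W.harmDeg_le_harm 0 (W.one_mem_harmDeg (h := h))
    rw [hbot, Submodule.mem_bot] at this
    exact W.one_ne_zero' this
  · rw [or_iff_not_imp_left]
    intro hne
    rw [W.stable_confOps_iff hh] at hst
    have h1 := ConfStable.one_mem W hh hst hne
    refine le_antisymm hU (iSup_le fun k => ?_)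
    induction k with
    | zero => exact W.harmDeg_zero_le h1
    | succ k ih =>
      refine W.harmDeg_succ_le hh hst (fun hk => ?_) ih
      apply hpn k
      have : (((p : ℤ) - 2 * (n : ℤ) : ℤ) : ℂ) = ((2 - 2 * (k : ℤ) : ℤ) : ℂ) := by
        push_cast
        rw [sdim] at hk
        linear_combination hk
      exact_mod_cast this

end SuperWeyl
end OspHarm

/-! ### Orthonormal bases and hyperbolic pairs of even vectors -/

namespace OspHarm
variable {p n : ℕ} {h : Matrix (Idx p n) (Idx p n) ℂ}

/-- An orthogonal basis of a nondegenerate symmetric form is rescaled by complex square roots. -/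
theorem exists_orthonormal {κ : Type} [Fintype κ] [DecidableEq κ] {G G' : Matrix κ κ ℂ}
    (hs : G.IsSymm) (hG : G' * G = 1) :
    ∃ v : κ → κ → ℂ, ∀ i j, v i ⬝ᵥ G.mulVec (v j) = if i = j then 1 else 0 := by
  classical
  let B := Matrix.toBilin' G
  have hB : LinearMap.IsSymm B := by
    refine ⟨fun x y => ?_⟩
    simp only [B, Matrix.toBilin'_apply', RingHom.id_apply]
    rw [Matrix.dotProduct_mulVec, ← Matrix.mulVec_transpose, hs.eq, dotProduct_comm]
  have hsep : B.SeparatingLeft := by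
    intro x hx
    have h1 : G.mulVec x = 0 := by
      funext i
      have := hx (Pi.single i 1)
      rw [← hB.eq] at this
      simp only [B, Matrix.toBilin'_apply', RingHom.id_apply, single_one_dotProduct] at this
      exact this
    have h2 := congrArg G'.mulVec h1
    rwa [Matrix.mulVec_mulVec, hG, Matrix.one_mulVec, Matrix.mulVec_zero] at h2
  obtain ⟨b, hb⟩ := LinearMap.BilinForm.exists_orthogonal_basis hB
  have hne := fun i => hb.not_isOrtho_basis_self_of_separatingLeft hsep i
  choose s hs2 using fun i => IsAlgClosed.exists_pow_nat_eq (B (b i) (b i)) (n := 2) (by norm_num)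
  have hs0 : ∀ i, s i ≠ 0 := fun i h0 => hne i (by rw [← hs2, h0]; norm_num)
  let e : κ ≃ Fin (Module.finrank ℂ (κ → ℂ)) :=
    Fintype.equivOfCardEq (by simp)
  refine ⟨fun i => (s (e i))⁻¹ • b (e i), fun i j => ?_⟩
  rw [Matrix.mulVec_smul, smul_dotProduct, dotProduct_smul]
  have e1 : b (e i) ⬝ᵥ G.mulVec (b (e j)) = B (b (e i)) (b (e j)) :=
    (Matrix.toBilin'_apply' G _ _).symm
  rw [e1]
  by_cases hij : i = j
  · subst hij
    rw [if_pos rfl, ← hs2, smul_eq_mul, smul_eq_mul]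
    field_simp [hs0 (e i)]
  · rw [if_neg hij, show B (b (e i)) (b (e j)) = 0 from hb (fun hh => hij (e.injective hh))]
    simp

/-- The functional on `ℂ^{p|2n}` dual to the even vector `a`. -/
def low (h : Matrix (Idx p n) (Idx p n) ℂ) (a : Fin p → ℂ) (j : Idx p n) : ℂ :=
  ∑ i, a i * h (Sum.inl i) j

/-- The metric on even vectors. -/
def ip (h : Matrix (Idx p n) (Idx p n) ℂ) (a b : Fin p → ℂ) : ℂ :=
  ∑ j, b j * low h a (Sum.inl j)

theorem IsMetric.symm_inl (hh : IsMetric (par p n) h) (i : Fin p) (j : Idx p n) :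
    h j (Sum.inl i) = h (Sum.inl i) j := by
  rw [hh.symm', sg_inl_left, one_mul]

theorem IsMetric.inl_inr (hh : IsMetric (par p n) h) (i : Fin p) (j : Fin (2 * n)) :
    h (Sum.inl i) (Sum.inr j) = 0 := hh.even _ _ (by simp [par])

theorem IsMetric.inr_inl (hh : IsMetric (par p n) h) (i : Fin p) (j : Fin (2 * n)) :
    h (Sum.inr j) (Sum.inl i) = 0 := hh.even _ _ (by simp [par])

theorem IsMetric.upper_inl_inr (hh : IsMetric (par p n) h) (i : Fin p) (j : Fin (2 * n)) :
    upper h (Sum.inl i) (Sum.inr j) = 0 := by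
  by_contra hne
  simpa [par] using hh.upper_even hne

theorem IsMetric.upper_inr_inl (hh : IsMetric (par p n) h) (i : Fin p) (j : Fin (2 * n)) :
    upper h (Sum.inr j) (Sum.inl i) = 0 := by
  by_contra hne
  simpa [par] using hh.upper_even hne

theorem low_inr (hh : IsMetric (par p n) h) (a : Fin p → ℂ) (j : Fin (2 * n)) :
    low h a (Sum.inr j) = 0 := by simp [low, hh.inl_inr]

theorem ip_comm (hh : IsMetric (par p n) h) (a b : Fin p → ℂ) : ip h a b = ip h b a := by
  simp only [ip, low, Finset.mul_sum]
  rw [Finset.sum_comm]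
  refine Finset.sum_congr rfl fun i _ => Finset.sum_congr rfl fun j _ => ?_
  rw [hh.symm_inl j (Sum.inl i)]
  ring

/-- A hyperbolic pair of even vectors together with a unit vector orthogonal to both. -/
structure IsTriple (h : Matrix (Idx p n) (Idx p n) ℂ) (ξ η ζ : Fin p → ℂ) : Prop where
  ξξ : ip h ξ ξ = 0
  ηη : ip h η η = 0
  ξη : ip h ξ η = 1
  ξζ : ip h ξ ζ = 0
  ηζ : ip h η ζ = 0
  ζζ : ip h ζ ζ = 1

theorem IsTriple.swap (hh : IsMetric (par p n) h) {ξ η ζ : Fin p → ℂ} (ht : IsTriple h ξ η ζ) :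
    IsTriple h η ξ ζ :=
  ⟨ht.ηη, ht.ξξ, (ip_comm hh _ _).trans ht.ξη, ht.ηζ, ht.ξζ, ht.ζζ⟩

theorem ip_eq_dotProduct (hh : IsMetric (par p n) h) (a b : Fin p → ℂ) :
    ip h a b = a ⬝ᵥ (Matrix.of fun i j => h (Sum.inl i) (Sum.inl j)).mulVec b := by
  rw [ip_comm hh]
  simp only [ip, low, dotProduct, Matrix.mulVec, Matrix.of_apply]
  refine Finset.sum_congr rfl fun i _ => ?_
  congr 1
  refine Finset.sum_congr rfl fun j _ => ?_
  rw [hh.symm_inl i (Sum.inl j), mul_comm]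

theorem exists_isTriple (hh : IsMetric (par p n) h) (hp : 2 < p) :
    ∃ ξ η ζ, IsTriple h ξ η ζ := by
  have hG : (Matrix.of fun i j => upper h (Sum.inl j) (Sum.inl i)) *
      (Matrix.of fun i j => h (Sum.inl i) (Sum.inl j)) = (1 : Matrix (Fin p) (Fin p) ℂ) := by
    ext i j
    have := hh.upper_mul_left (Sum.inl i) (Sum.inl j)
    simp only [Fintype.sum_sum_type, hh.inr_inl, mul_zero, Finset.sum_const_zero, add_zero,
      Sum.inl.injEq] at this
    rw [Matrix.mul_apply, Matrix.one_apply]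
    exact this
  obtain ⟨v, hv⟩ := exists_orthonormal (Matrix.IsSymm.ext fun i j => by
    simp only [Matrix.of_apply]; exact hh.symm_inl _ _) hG
  have hv' : ∀ i j, ip h (v i) (v j) = if i = j then 1 else 0 := fun i j => by
    rw [ip_eq_dotProduct hh, hv]
  let i0 : Fin p := ⟨0, by omega⟩
  let i1 : Fin p := ⟨1, by omega⟩
  let i2 : Fin p := ⟨2, hp⟩
  have hadd : ∀ (s t s' t' : ℂ) (i j k l : Fin p), ip h (s • v i + t • v j) (s' • v k + t' • v l) =
      s * s' * ip h (v i) (v k) + s * t' * ip h (v i) (v l) + t * s' * ip h (v j) (v k) +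
        t * t' * ip h (v j) (v l) := by
    intro s t s' t' i j k l
    simp only [ip_eq_dotProduct hh, Matrix.mulVec_add, Matrix.mulVec_smul, add_dotProduct,
      dotProduct_add, smul_dotProduct, dotProduct_smul, smul_eq_mul]
    ring
  -- Two orthonormal vectors e, e' give the isotropic vectors e + ie' and (e - ie')/2, which pair to
  -- 1. The third orthonormal vector ζ exists because p > 2.
  refine ⟨(1 : ℂ) • v i0 + Complex.I • v i1, (1 / 2 : ℂ) • v i0 + (-(Complex.I / 2)) • v i1,
    (1 : ℂ) • v i2 + (0 : ℂ) • v i2, ?_, ?_, ?_, ?_, ?_, ?_⟩ <;>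
  · rw [hadd]
    simp only [hv', i0, i1, i2, Fin.mk.injEq]
    norm_num <;> ring_nf <;> simp only [Complex.I_sq] <;> norm_num

end OspHarm

/-! ### R² and isotropic linear forms as non-zero-divisors -/

namespace OspHarm
variable {p n : ℕ} {h : Matrix (Idx p n) (Idx p n) ℂ}

namespace SuperWeyl
variable {V : Type} [Ring V] [Algebra ℂ V] (W : SuperWeyl p n V)

/-- The linear form attached to an even vector. -/
def linForm (a : Fin p → ℂ) : MvPolynomial (Fin p) ℂ := ∑ i, a i • MvPolynomial.X i

/-- The even part of `R²`. -/
def quadForm (h : Matrix (Idx p n) (Idx p n) ℂ) : MvPolynomial (Fin p) ℂ :=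
  ∑ i, ∑ j, upper h (Sum.inl i) (Sum.inl j) • (MvPolynomial.X i * MvPolynomial.X j)

/-- The odd part of `R²`. -/
def oddSq (h : Matrix (Idx p n) (Idx p n) ℂ) : V :=
  ∑ i : Fin (2 * n), ∑ j : Fin (2 * n), upper h (Sum.inr i) (Sum.inr j) •
    (W.coord (Sum.inr i) * W.coord (Sum.inr j))

/-- Multiplication by the linear form attached to an even vector. -/
def Xv (a : Fin p → ℂ) : Module.End ℂ V := ∑ i, a i • W.X (Sum.inl i)

theorem Xv_apply (a : Fin p → ℂ) (f : V) : W.Xv a f = ∑ i, a i • W.X (Sum.inl i) f := by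
  simp [Xv]

theorem body_linForm_mul (a : Fin p → ℂ) (f : V) : W.body (linForm a) * f = W.Xv a f := by
  simp only [linForm, map_sum, map_smul, W.body_X, Finset.sum_mul, smul_mul_assoc, Xv_apply,
    X_apply]

theorem rsq_eq (hh : IsMetric (par p n) h) : W.rsq h = W.body (quadForm h) + W.oddSq h := by
  simp only [rsq, quadForm, oddSq, Fintype.sum_sum_type, hh.upper_inl_inr, hh.upper_inr_inl,
    zero_smul, Finset.sum_const_zero, zero_add, add_zero, map_sum, map_smul, map_mul, W.body_X]

theorem coord_inl_commute (i : Fin p) (f : V) : Commute (W.coord (Sum.inl i)) f := by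
  induction f using W.induction_on with
  | h0 => exact Commute.one_right _
  | hX j f hf =>
    refine Commute.mul_right ?_ hf
    rw [commute_iff_eq, W.coord_mul_coord, sg_inl_left, one_smul]
  | hadd f g hf hg => exact hf.add_right hg
  | hsmul c f hf => exact hf.smul_right c

theorem body_commute (a : MvPolynomial (Fin p) ℂ) (f : V) : Commute (W.body a) f := by
  induction a using MvPolynomial.induction_on with
  | C c =>
    rw [← MvPolynomial.algebraMap_eq, AlgHom.commutes]
    exact Algebra.commutes c f
  | add a b ha hb => rw [map_add]; exact ha.add_left hb
  | mul_X a i ha => rw [map_mul, W.body_X]; exact ha.mul_left (W.coord_inl_commute i f)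

theorem oddSq_isNilpotent (h : Matrix (Idx p n) (Idx p n) ℂ) : IsNilpotent (W.oddSq h) := by
  have hanti : ∀ i j : Fin (2 * n), W.coord (Sum.inr i) * W.coord (Sum.inr j) =
      -(W.coord (Sum.inr j) * W.coord (Sum.inr i)) := fun i j => by
    rw [W.coord_mul_coord, sg_inr_inr, neg_one_smul]
  have hsq : ∀ i : Fin (2 * n), W.coord (Sum.inr i) * W.coord (Sum.inr i) = 0 := fun i => by
    have h1 := hanti i i
    have h2 : (2 : ℂ) • (W.coord (Sum.inr i) * W.coord (Sum.inr i)) = 0 := by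
      rw [two_smul]
      nth_rewrite 1 [h1]
      exact neg_add_cancel _
    exact (smul_eq_zero.1 h2).resolve_left two_ne_zero
  have hcomm : ∀ i j k : Fin (2 * n), Commute (W.coord (Sum.inr i) * W.coord (Sum.inr j))
      (W.coord (Sum.inr k)) := fun i j k => by
    rw [commute_iff_eq, mul_assoc, hanti j k, mul_neg, ← mul_assoc, hanti i k, neg_mul, neg_neg,
      mul_assoc]
  have hcomm2 : ∀ i j k l : Fin (2 * n), Commute (W.coord (Sum.inr i) * W.coord (Sum.inr j))
      (W.coord (Sum.inr k) * W.coord (Sum.inr l)) := fun i j k l =>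
    (hcomm i j k).mul_right (hcomm i j l)
  have hnil : ∀ i j : Fin (2 * n), IsNilpotent (W.coord (Sum.inr i) * W.coord (Sum.inr j)) :=
    fun i j => ⟨2, by
      rw [pow_two, ← mul_assoc, (hcomm i j i).eq, ← mul_assoc, hsq, zero_mul, zero_mul]⟩
  unfold oddSq
  refine Commute.isNilpotent_sum (fun i _ => ?_) fun i k _ _ => ?_
  · refine Commute.isNilpotent_sum (fun j _ => ?_) fun j l _ _ => ?_
    · exact (hnil i j).smul _
    · exact ((hcomm2 i j i l).smul_left _).smul_right _
  · exact Commute.sum_left _ _ _ fun j _ => Commute.sum_right _ _ _ fun l _ =>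
      ((hcomm2 i j k l).smul_left _).smul_right _

theorem linForm_prime {a : Fin p → ℂ} (ha : a ≠ 0) : Prime (linForm a) := by
  classical
  let c : Fin p →₀ ℂ := Finsupp.equivFunOnFinite.symm a
  have hc : linForm a = MvPolynomial.sumSMulX c := by
    rw [MvPolynomial.sumSMulX, Finsupp.linearCombination_apply, Finsupp.sum_fintype _ _ (by simp)]
    rfl
  obtain ⟨i, hi⟩ := Function.ne_iff.1 ha
  rw [hc]
  refine (MvPolynomial.irreducible_sumSMulX c ⟨i, ?_⟩ fun r hr => ?_).prime
  · exact Finsupp.mem_support_iff.2 hi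
  · refine isUnit_iff_ne_zero.2 fun h0 => hi ?_
    have := hr i
    rw [h0, zero_dvd_iff] at this
    exact this

variable {ξ η ζ : Fin p → ℂ}

theorem _root_.OspHarm.IsTriple.ne_zero (ht : IsTriple h ξ η ζ) : ξ ≠ 0 := by
  rintro rfl
  have := ht.ξη
  simp [ip, low] at this

/-- At the point dual to ζ the form ξ vanishes, whereas the quadratic form takes the value 1. -/
theorem _root_.OspHarm.IsTriple.not_dvd (hh : IsMetric (par p n) h) (ht : IsTriple h ξ η ζ) :
    ¬ linForm ξ ∣ quadForm h := by
  intro hd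
  have h1 := map_dvd (MvPolynomial.eval fun i => low h ζ (Sum.inl i)) hd
  have e1 : MvPolynomial.eval (fun i => low h ζ (Sum.inl i)) (linForm ξ) = 0 := by
    rw [← ht.ξζ, ip_comm hh]
    simp [linForm, ip, MvPolynomial.smul_eval]
  have e2 : MvPolynomial.eval (fun i => low h ζ (Sum.inl i)) (quadForm h) = 1 := by
    rw [← ht.ζζ]
    simp only [quadForm, ip, map_sum, MvPolynomial.smul_eval, map_mul, MvPolynomial.eval_X]
    rw [Finset.sum_comm]
    refine Finset.sum_congr rfl fun j _ => ?_
    simp only [← mul_assoc, ← Finset.sum_mul]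
    congr 1
    simp only [low, Finset.mul_sum]
    rw [Finset.sum_comm]
    calc _ = ∑ k, ζ k * ∑ i, upper h (Sum.inl i) (Sum.inl j) * h (Sum.inl i) (Sum.inl k) := by
          refine Finset.sum_congr rfl fun k _ => ?_
          rw [Finset.mul_sum]
          refine Finset.sum_congr rfl fun i _ => ?_
          rw [hh.symm_inl k (Sum.inl i)]
          ring
      _ = ζ j := by
          have : ∀ k, ∑ i, upper h (Sum.inl i) (Sum.inl j) * h (Sum.inl i) (Sum.inl k) =
              if j = k then 1 else 0 := fun k => by
            have := hh.upper_mul_left (Sum.inl j) (Sum.inl k)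
            simpa only [Fintype.sum_sum_type, hh.inr_inl, mul_zero, Finset.sum_const_zero,
              add_zero, Sum.inl.injEq] using this
          simp [this]
  rw [e1, e2, zero_dvd_iff] at h1
  exact one_ne_zero h1

/-- Modulo the left ideal `I`, the central element a acts on f as -z. If z is nilpotent, a power of
a therefore sends f into `I`, and the odd part has been eliminated. -/
theorem body_pow_mul {a : MvPolynomial (Fin p) ℂ} {f z : V} {I : Submodule ℂ V}
    (hI : ∀ (x : V), ∀ f ∈ I, x * f ∈ I) (hfg : W.body a * f + z * f ∈ I)
    (k : ℕ) : W.body (a ^ k) * f - (-z) ^ k * f ∈ I := by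
  induction k with
  | zero => simp
  | succ k ih =>
    have h1 := I.add_mem (hI (W.body a) _ ih) (hI ((-z) ^ k) _ hfg)
    convert h1 using 1
    have hc : (-z) ^ k * W.body a = W.body a * (-z) ^ k := (W.body_commute _ _).eq.symm
    rw [pow_succ' a, map_mul, pow_succ (-z), mul_add, mul_sub, ← mul_assoc,
      ← mul_assoc, ← mul_assoc ((-z) ^ k), hc, mul_neg, neg_mul, ← mul_assoc]
    abel

/-- An element whose even part is nonzero and whose odd part is nilpotent is not a zero divisor. -/
theorem eq_zero_of_body_add_mul {a : MvPolynomial (Fin p) ℂ} (ha : a ≠ 0) {z f : V}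
    (hz : IsNilpotent z) (hf : W.body a * f + z * f = 0) : f = 0 := by
  obtain ⟨N, hN⟩ := hz.neg
  have := W.body_pow_mul (I := ⊥)
    (fun x f hf => by rw [Submodule.mem_bot] at *; rw [hf, mul_zero])
    ((Submodule.mem_bot ℂ).2 hf) N
  rw [hN, zero_mul, sub_zero, Submodule.mem_bot] at this
  exact W.eq_zero_of_body_mul _ f (pow_ne_zero _ ha) this

theorem _root_.OspHarm.IsTriple.quadForm_ne_zero (hh : IsMetric (par p n) h)
    (ht : IsTriple h ξ η ζ) : quadForm h ≠ 0 :=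
  fun h0 => IsTriple.not_dvd hh ht (h0 ▸ dvd_zero _)

theorem R_injective (hh : IsMetric (par p n) h) (ht : IsTriple h ξ η ζ) :
    Function.Injective (W.R h) := by
  rw [← LinearMap.ker_eq_bot, LinearMap.ker_eq_bot']
  intro f hf
  rw [R_apply, W.rsq_eq hh, add_mul] at hf
  exact W.eq_zero_of_body_add_mul (ht.quadForm_ne_zero hh) (W.oddSq_isNilpotent h) hf

theorem Xv_R (hh : IsMetric (par p n) h) (a : Fin p → ℂ) (f : V) :
    W.Xv a (W.R h f) = W.R h (W.Xv a f) := by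
  simp only [Xv_apply, map_sum, map_smul, W.R_X hh]

theorem Xv_injective {a : Fin p → ℂ} (ha : a ≠ 0) : Function.Injective (W.Xv a) := by
  rw [← LinearMap.ker_eq_bot, LinearMap.ker_eq_bot']
  intro f hf
  rw [← body_linForm_mul] at hf
  exact W.eq_zero_of_body_mul _ f (linForm_prime ha).ne_zero hf

/-- Let ξf = R²g. Modulo ξ, a power of the even quadratic form annihilates g, and ξ is a prime not
dividing that form, so ξ divides g and can be cancelled. -/
theorem mem_range_R_of_Xv (hh : IsMetric (par p n) h) (ht : IsTriple h ξ η ζ) {f : V}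
    (hf : W.Xv ξ f ∈ LinearMap.range (W.R h)) : f ∈ LinearMap.range (W.R h) := by
  obtain ⟨g, hg⟩ := hf
  obtain ⟨N, hN⟩ := (W.oddSq_isNilpotent h).neg
  have := W.body_pow_mul (f := g) (I := LinearMap.range (W.Xv ξ))
    (by
      rintro x _ ⟨f, rfl⟩
      refine ⟨x * f, ?_⟩
      rw [← body_linForm_mul, ← body_linForm_mul, ← mul_assoc, ← mul_assoc,
        (W.body_commute _ _).eq])
    (by rw [← add_mul, ← W.rsq_eq hh, ← R_apply, hg]; exact ⟨f, rfl⟩) N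
  rw [hN, zero_mul, sub_zero] at this
  obtain ⟨g', hg'⟩ := this
  rw [← body_linForm_mul] at hg'
  have hp := linForm_prime (ht.ne_zero)
  obtain ⟨g'', hg''⟩ := W.dvd_of_body_mul (linForm ξ) (quadForm h ^ N) g g' hp
    (fun hd => IsTriple.not_dvd hh ht (hp.dvd_of_dvd_pow hd)) hg'.symm
  rw [body_linForm_mul] at hg''
  rw [hg'', ← W.Xv_R hh] at hg
  exact ⟨g'', W.Xv_injective ht.ne_zero hg⟩

end SuperWeyl
end OspHarm

/-! ### Weights of the rotation in a hyperbolic plane and isotropic powers -/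

namespace OspHarm
variable {p n : ℕ} {h : Matrix (Idx p n) (Idx p n) ℂ}

namespace SuperWeyl
variable {V : Type} [Ring V] [Algebra ℂ V] (W : SuperWeyl p n V)

/-- The derivative in the direction of an even vector. -/
def Dv (h : Matrix (Idx p n) (Idx p n) ℂ) (a : Fin p → ℂ) : Module.End ℂ V :=
  ∑ i, a i • W.D h (Sum.inl i)

/-- The rotation attached to an even vector and a basis vector. -/
def Lv (h : Matrix (Idx p n) (Idx p n) ℂ) (a : Fin p → ℂ) (j : Idx p n) : Module.End ℂ V :=
  ∑ i, a i • W.L h (Sum.inl i) j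

/-- The rotation attached to two even vectors. -/
def boost (h : Matrix (Idx p n) (Idx p n) ℂ) (a b : Fin p → ℂ) : Module.End ℂ V :=
  ∑ j, b j • W.Lv h a (Sum.inl j)

/-- The powers of the linear form attached to an even vector. -/
def linPow (a : Fin p → ℂ) (k : ℕ) : V := (W.Xv a ^ k) 1

theorem linPow_zero (a : Fin p → ℂ) : W.linPow a 0 = 1 := rfl
theorem linPow_succ (a : Fin p → ℂ) (k : ℕ) : W.linPow a (k + 1) = W.Xv a (W.linPow a k) := by
  rw [linPow, pow_succ']; rfl

theorem Dv_apply (a : Fin p → ℂ) (f : V) : W.Dv h a f = ∑ i, a i • W.D h (Sum.inl i) f := by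
  simp [Dv]

theorem Lv_apply (a : Fin p → ℂ) (j : Idx p n) (f : V) :
    W.Lv h a j f = W.Xv a (W.D h j f) - W.X j (W.Dv h a f) := by
  simp only [Lv, Xv_apply, Dv_apply, LinearMap.sum_apply, LinearMap.smul_apply, L_apply,
    sg_inl_left, one_smul, smul_sub, Finset.sum_sub_distrib, map_sum, map_smul]

theorem boost_apply (a b : Fin p → ℂ) (f : V) :
    W.boost h a b f = W.Xv a (W.Dv h b f) - W.Xv b (W.Dv h a f) := by
  simp only [boost, LinearMap.sum_apply, LinearMap.smul_apply, Lv_apply, smul_sub,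
    Finset.sum_sub_distrib, W.Xv_apply b, W.Dv_apply b, map_sum, map_smul]

theorem X_Xv (j : Idx p n) (a : Fin p → ℂ) (f : V) : W.X j (W.Xv a f) = W.Xv a (W.X j f) := by
  simp only [Xv_apply, map_sum, map_smul]
  refine Finset.sum_congr rfl fun i _ => ?_
  rw [W.X_X j, sg_inl_right, one_smul]

theorem Xv_Xv (a b : Fin p → ℂ) (f : V) : W.Xv a (W.Xv b f) = W.Xv b (W.Xv a f) := by
  rw [W.Xv_apply a, W.Xv_apply a, map_sum]
  simp only [X_Xv, map_smul]

theorem parityOp_Xv (a : Fin p → ℂ) (f : V) : W.parityOp (W.Xv a f) = W.Xv a (W.parityOp f) := by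
  simp [Xv_apply, parityOp_X, par]

theorem euler_Xv (a : Fin p → ℂ) (f : V) : W.euler (W.Xv a f) = W.Xv a (W.euler f) + W.Xv a f := by
  simp only [Xv_apply, map_sum, map_smul, euler_X, smul_add, Finset.sum_add_distrib]

theorem linPow_mem_deg (a : Fin p → ℂ) (k : ℕ) : W.linPow a k ∈ W.deg k := by
  induction k with
  | zero => rw [linPow_zero, mem_deg, euler_one]; simp
  | succ k ih =>
    rw [mem_deg] at *
    rw [linPow_succ, euler_Xv, ih, map_smul]
    push_cast
    module

theorem linPow_ne_zero {a : Fin p → ℂ} (ha : a ≠ 0) (k : ℕ) : W.linPow a k ≠ 0 := by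
  induction k with
  | zero => exact W.one_ne_zero'
  | succ k ih =>
    rw [linPow_succ]
    exact fun h0 => ih (W.Xv_injective ha (h0.trans (map_zero _).symm))

section
variable (hh : IsMetric (par p n) h)
include hh

theorem D_Xv (j : Idx p n) (a : Fin p → ℂ) (f : V) :
    W.D h j (W.Xv a f) = W.Xv a (W.D h j f) + low h a j • f := by
  simp only [Xv_apply, map_sum, map_smul, W.D_X hh, sg_inl_right, one_smul, smul_add,
    Finset.sum_add_distrib, low, Finset.sum_smul, smul_smul]

theorem Dv_X (a : Fin p → ℂ) (j : Idx p n) (f : V) :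
    W.Dv h a (W.X j f) = W.X j (W.Dv h a f) + low h a j • f := by
  simp only [Dv_apply, map_sum, map_smul, W.D_X hh, sg_inl_left, one_smul, smul_add,
    Finset.sum_add_distrib, low, Finset.sum_smul, smul_smul, hh.symm_inl _ j]

theorem Dv_Xv (b a : Fin p → ℂ) (f : V) :
    W.Dv h b (W.Xv a f) = W.Xv a (W.Dv h b f) + ip h a b • f := by
  simp only [Dv_apply, W.D_Xv hh, smul_add, Finset.sum_add_distrib, ip, Finset.sum_smul, smul_smul,
    map_sum, map_smul]

theorem D_Dv (j : Idx p n) (a : Fin p → ℂ) (f : V) :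
    W.D h j (W.Dv h a f) = W.Dv h a (W.D h j f) := by
  simp only [Dv_apply, map_sum, map_smul]
  refine Finset.sum_congr rfl fun i _ => ?_
  rw [W.D_D hh j, sg_inl_right, one_smul]

theorem Dv_Dv (a b : Fin p → ℂ) (f : V) : W.Dv h a (W.Dv h b f) = W.Dv h b (W.Dv h a f) := by
  rw [W.Dv_apply a, W.Dv_apply a, map_sum]
  simp only [W.D_Dv hh, map_smul]

theorem parityOp_Dv (a : Fin p → ℂ) (f : V) :
    W.parityOp (W.Dv h a f) = W.Dv h a (W.parityOp f) := by
  simp [Dv_apply, W.parityOp_D hh, par]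

theorem boost_X (a b : Fin p → ℂ) (j : Idx p n) (f : V) : W.boost h a b (W.X j f) =
    W.X j (W.boost h a b f) + low h b j • W.Xv a f - low h a j • W.Xv b f := by
  simp only [boost_apply, W.Dv_X hh, map_add, map_sub, map_smul, X_Xv]
  module

theorem boost_Xv (a b c : Fin p → ℂ) (f : V) : W.boost h a b (W.Xv c f) =
    W.Xv c (W.boost h a b f) + ip h c b • W.Xv a f - ip h c a • W.Xv b f := by
  simp only [boost_apply, W.Dv_Xv hh, map_add, map_sub, map_smul]
  rw [W.Xv_Xv c a, W.Xv_Xv c b]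
  module

theorem D_boost (a b : Fin p → ℂ) (j : Idx p n) (f : V) : W.D h j (W.boost h a b f) =
    W.boost h a b (W.D h j f) + low h a j • W.Dv h b f - low h b j • W.Dv h a f := by
  simp only [boost_apply, W.D_Xv hh, map_sub, W.D_Dv hh]
  module

theorem Dv_boost (a b c : Fin p → ℂ) (f : V) : W.Dv h c (W.boost h a b f) =
    W.boost h a b (W.Dv h c f) + ip h a c • W.Dv h b f - ip h b c • W.Dv h a f := by
  simp only [boost_apply, W.Dv_Xv hh, map_sub, W.Dv_Dv hh c]
  module

theorem parityOp_boost (a b : Fin p → ℂ) (f : V) :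
    W.parityOp (W.boost h a b f) = W.boost h a b (W.parityOp f) := by
  simp only [boost_apply, map_sub, parityOp_Xv, W.parityOp_Dv hh]

theorem sum_X_Lv (a : Fin p → ℂ) (f : V) : ∑ k, ∑ j, upper h k j • W.X k (W.Lv h a j f) =
    W.Xv a (W.euler f) - W.R h (W.Dv h a f) := by
  simp only [Lv_apply, map_sub, X_Xv, smul_sub, Finset.sum_sub_distrib, W.euler_eq_D hh, R_eq,
    map_sum, map_smul]

theorem sum_low_X (a : Fin p → ℂ) (f : V) :
    ∑ k, ∑ j, upper h k j • W.X k (low h a j • f) = W.Xv a f := by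
  simp only [map_smul, smul_smul, ← Finset.sum_smul]
  have : ∀ k, ∑ j, upper h k j * low h a j =
      ∑ i, a i * if Sum.inl i = k then (1 : ℂ) else 0 := fun k => by
    simp only [low, Finset.mul_sum]
    rw [Finset.sum_comm]
    refine Finset.sum_congr rfl fun i _ => ?_
    rw [← hh.upper_mul_right, Finset.mul_sum]
    exact Finset.sum_congr rfl fun j _ => by ring
  simp only [this, Fintype.sum_sum_type, Xv_apply]
  simp

variable {ξ η ζ : Fin p → ℂ} (ht : IsTriple h ξ η ζ)
include ht

/-- Rotations of ξ with vectors orthogonal to ξ raise the weight under the rotation L_{ξη} by one.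
The subtracted multiple of L_{ξη} removes the component of the j-th basis vector along η. -/
theorem boost_Lv_sub {c : ℂ} {f : V} (hf : W.boost h ξ η f = c • f) (j : Idx p n) :
    W.boost h ξ η (W.Lv h ξ j f - low h ξ j • W.boost h ξ η f) =
      (c + 1) • (W.Lv h ξ j f - low h ξ j • W.boost h ξ η f) := by
  have e1 := W.D_boost hh ξ η j f
  have e2 := W.Dv_boost hh ξ η ξ f
  rw [hf, map_smul, eq_sub_iff_add_eq, ← eq_sub_iff_add_eq] at e1 e2
  rw [map_sub, map_smul, Lv_apply, map_sub, W.boost_Xv hh, W.boost_X hh, hf, map_smul, hf]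
  rw [eq_sub_iff_add_eq, ← sub_eq_iff_eq_add] at e1 e2
  rw [← e1, ← e2, ip_comm hh η ξ, ht.ξξ, ht.ξη]
  have e3 : low h ξ j • (c • f) = low h ξ j • (W.Xv ξ (W.Dv h η f) - W.Xv η (W.Dv h ξ f)) := by
    rw [← hf, boost_apply]
  simp only [map_sub, map_add, map_smul]
  have e4 := e3
  simp only [smul_sub] at e4
  have e5 : low h ξ j • W.Xv ξ (W.Dv h η f) =
      low h ξ j • (c • f) + low h ξ j • W.Xv η (W.Dv h ξ f) := by
    rw [e4]; abel
  simp only [e5]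
  module

theorem boost_linPow (k : ℕ) : W.boost h ξ η (W.linPow ξ k) = (k : ℂ) • W.linPow ξ k := by
  induction k with
  | zero => simp [linPow_zero, boost_apply, Dv_apply, D_apply, W.pd_one]
  | succ k ih =>
    rw [linPow_succ, W.boost_Xv hh, ih, map_smul, ht.ξξ, ht.ξη]
    push_cast
    module

/-- Multiplication by ξ, by η and by a form orthogonal to both changes the weight by 1, -1 and 0.
Hence weight k in degree k is reached only by multiplying with ξ at every step. -/
theorem lin_pow_le_boost (k : ℕ) : W.lin ^ k ≤ Submodule.span ℂ {W.linPow ξ k} ⊔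
    ⨆ i : ℕ, Module.End.eigenspace (W.boost h ξ η) ((k : ℂ) - 1 - i) := by
  induction k with
  | zero => rw [pow_zero, Submodule.one_eq_span, linPow_zero]; exact le_sup_left
  | succ k ih =>
    set S := Submodule.span ℂ {W.linPow ξ (k + 1)} ⊔
      ⨆ i : ℕ, Module.End.eigenspace (W.boost h ξ η) (((k + 1 : ℕ) : ℂ) - 1 - i) with hS
    have hmem : ∀ (i : ℕ) (f : V), W.boost h ξ η f = (((k + 1 : ℕ) : ℂ) - 1 - i) • f → f ∈ S :=
      fun i f hf => Submodule.mem_sup_right (Submodule.mem_iSup_of_mem i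
        (Module.End.mem_eigenspace_iff.2 hf))
    -- The coordinate X_j minus its components along ξ and η is orthogonal to both and preserves
    -- weights.
    have hrest : ∀ (c : ℂ) (f : V) (j : Idx p n), W.boost h ξ η f = c • f → W.boost h ξ η
        (W.X j f - low h η j • W.Xv ξ f - low h ξ j • W.Xv η f) =
        c • (W.X j f - low h η j • W.Xv ξ f - low h ξ j • W.Xv η f) := fun c f j hf => by
      simp only [map_sub, map_smul, W.boost_X hh, W.boost_Xv hh, hf, ip_comm hh η ξ, ht.ξξ, ht.ηη,
        ht.ξη]
      module
    have hη : ∀ (c : ℂ) (f : V), W.boost h ξ η f = c • f → W.boost h ξ η (W.Xv η f) =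
        (c - 1) • W.Xv η f := fun c f hf => by
      rw [W.boost_Xv hh, hf, map_smul, ip_comm hh η ξ, ht.ηη, ht.ξη]
      module
    have hξ : ∀ (c : ℂ) (f : V), W.boost h ξ η f = c • f → W.boost h ξ η (W.Xv ξ f) =
        (c + 1) • W.Xv ξ f := fun c f hf => by
      rw [W.boost_Xv hh, hf, map_smul, ht.ξξ, ht.ξη]
      module
    have key : ∀ j, W.lin ^ k ≤ S.comap (W.X j) := fun j => by
      refine ih.trans (sup_le ?_ (iSup_le fun i => ?_))
      · rw [Submodule.span_singleton_le_iff_mem, Submodule.mem_comap]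
        have h0 := W.boost_linPow hh ht k
        have h1 := hmem 0 _ ((hrest _ _ j h0).trans (by congr 1; push_cast; ring))
        have h2 := hmem 1 _ ((hη _ _ h0).trans (by congr 1; push_cast; ring))
        have h3 : W.Xv ξ (W.linPow ξ k) ∈ S := by
          rw [← linPow_succ]
          exact Submodule.mem_sup_left (Submodule.mem_span_singleton_self _)
        have := S.add_mem (S.add_mem h1 (S.smul_mem (low h η j) h3)) (S.smul_mem (low h ξ j) h2)
        convert this using 1
        abel
      · intro f hf
        rw [Module.End.mem_eigenspace_iff] at hf
        rw [Submodule.mem_comap]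
        have h1 := hmem (i + 1) _ ((hrest _ _ j hf).trans (by congr 1; push_cast; ring))
        have h2 := hmem (i + 2) _ ((hη _ _ hf).trans (by congr 1; push_cast; ring))
        have h3 := hmem i _ ((hξ _ _ hf).trans (by congr 1; push_cast; ring))
        have := S.add_mem (S.add_mem h1 (S.smul_mem (low h η j) h3)) (S.smul_mem (low h ξ j) h2)
        convert this using 1
        abel
    rw [pow_succ', Submodule.mul_le]
    intro m hm f hf
    refine Submodule.span_induction (p := fun m _ => m * f ∈ S) ?_ ?_ ?_ ?_ hm
    · rintro _ ⟨j, rfl⟩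
      exact key j hf
    · simp
    · intro x y _ _ hx hy
      rw [add_mul]; exact S.add_mem hx hy
    · intro c x _ hx
      rw [smul_mul_assoc]; exact S.smul_mem c hx

theorem deg_le_boost (k : ℕ) :
    W.deg k ≤ ⨆ i : ℕ, Module.End.eigenspace (W.boost h ξ η) ((k : ℂ) - i) := by
  rw [deg_eq_lin_pow]
  refine (W.lin_pow_le_boost hh ht k).trans (sup_le ?_ (iSup_le fun i => ?_))
  · rw [Submodule.span_singleton_le_iff_mem]
    refine Submodule.mem_iSup_of_mem 0 (Module.End.mem_eigenspace_iff.2 ?_)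
    rw [W.boost_linPow hh ht, Nat.cast_zero, sub_zero]
  · refine le_iSup_of_le (i + 1) (le_of_eq ?_)
    congr 1
    push_cast
    ring

theorem boost_eq_top {k : ℕ} {f : V} (hf : f ∈ W.deg k) (hb : W.boost h ξ η f = (k : ℂ) • f) :
    f ∈ Submodule.span ℂ {W.linPow ξ k} := by
  have hinj : Function.Injective (fun o : Option ℕ => o.elim (k : ℂ) fun i => (k : ℂ) - 1 - i) := by
    have h1 : ∀ i : ℕ, (k : ℂ) ≠ k - 1 - i := fun i hi =>
      Nat.cast_add_one_ne_zero (R := ℂ) i (by linear_combination hi)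
    rintro (_ | a) (_ | b) hab
    · rfl
    · exact absurd hab (h1 b)
    · exact absurd hab.symm (h1 a)
    · have : (a : ℂ) = b := by
        simp only [Option.elim] at hab
        linear_combination -hab
      rw [Nat.cast_injective this]
  refine mem_of_mem_iSup_of_mem_eigenspace (T := W.boost h ξ η) hinj
    (A := fun o : Option ℕ => o.elim (Submodule.span ℂ {W.linPow ξ k})
      fun i => Module.End.eigenspace (W.boost h ξ η) ((k : ℂ) - 1 - i)) ?_ ?_ (i := none)
      (Module.End.mem_eigenspace_iff.2 hb)
  · rintro (_ | i)
    · rw [Option.elim_none, Submodule.span_singleton_le_iff_mem]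
      exact Module.End.mem_eigenspace_iff.2 (W.boost_linPow hh ht k)
    · exact le_rfl
  · rw [iSup_option]
    rw [deg_eq_lin_pow] at hf
    exact W.lin_pow_le_boost hh ht k hf

/-- Take the highest weight k - i occurring in `N` outside the multiples of R², with vector f.
Raising operators send f to multiples of R², and contracting them with the coordinates gives iξf
modulo R². So i = 0, and f is a multiple of ξ^k. The twist `s` covers two situations: `N` rotation
stable, and `N` an annihilator, which is stable only up to a parity operator for odd indices. -/
theorem linPow_mem {k : ℕ} {N : Submodule ℂ V} (hdeg : N ≤ W.deg k) {s : Module.End ℂ V}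
    (hs : s = 1 ∨ s = W.parityOp)
    (hN : ∀ i j, ∀ f ∈ N, W.L h (Sum.inl i) j ((s ^ par p n j) f) ∈ N)
    (hR : ¬ N ≤ LinearMap.range (W.R h)) : W.linPow ξ k ∈ N := by
  classical
  set I := LinearMap.range (W.R h)
  have hI : ∀ f ∈ I, W.parityOp f ∈ I := by
    rintro _ ⟨g, rfl⟩
    exact ⟨W.parityOp g, (W.parityOp_R hh g).symm⟩
  have hT : ∀ j, ∀ f ∈ N, W.Lv h ξ j ((s ^ par p n j) f) ∈ N := fun j f hf => by
    rw [Lv, LinearMap.sum_apply]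
    exact N.sum_mem fun i _ => N.smul_mem _ (hN i j f hf)
  have hb : ∀ f ∈ N, W.boost h ξ η f ∈ N := fun f hf => by
    rw [boost, LinearMap.sum_apply]
    exact N.sum_mem fun i _ => N.smul_mem _ (hT (Sum.inl i) f hf)
  let A : Idx p n → V → V := fun j f => W.Lv h ξ j f - low h ξ j • W.boost h ξ η f
  have hAN : ∀ j, ∀ f ∈ N, A j ((s ^ par p n j) f) ∈ N := by
    rintro (j | j) f hf
    · exact N.sub_mem (hT (Sum.inl j) f hf) (N.smul_mem _ (hb f hf))
    · simp only [A, low_inr hh, zero_smul, sub_zero]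
      exact hT (Sum.inr j) f hf
  have hAI : ∀ j f, A j ((s ^ par p n j) f) ∈ I → A j f ∈ I := by
    rintro (j | j) f hf
    · exact hf
    · rcases hs with rfl | rfl
      · rwa [one_pow] at hf
      · simp only [A, low_inr hh, zero_smul, sub_zero, par, Sum.elim_inr, pow_one] at hf ⊢
        -- An odd rotation anticommutes with the parity operator, and the multiples of R² are stable
        -- under parity, so the twist can be removed modulo R².
        have : W.Lv h ξ (Sum.inr j) f = -W.parityOp (W.Lv h ξ (Sum.inr j) (W.parityOp f)) := by
          simp only [Lv_apply, map_sub, parityOp_Xv, W.parityOp_D hh, parityOp_X, W.parityOp_Dv hh,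
            parityOp_parityOp, par, Sum.elim_inr, pow_one, map_smul]
          module
        rw [this]
        exact I.neg_mem (hI _ hf)
  have hsb : ∀ (j : Idx p n) (c : ℂ) (f : V), W.boost h ξ η f = c • f →
      W.boost h ξ η ((s ^ par p n j) f) = c • (s ^ par p n j) f := by
    rintro (j | j) c f hf
    · exact hf
    · rcases hs with rfl | rfl
      · rwa [one_pow]
      · simp only [par, Sum.elim_inr, pow_one]
        rw [← W.parityOp_boost hh, hf, map_smul]
  have hle := le_iSup_inf_eigenspace (T := W.boost h ξ η) (c := fun i : ℕ => (k : ℂ) - i)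
    (fun a b hab => Nat.cast_injective (R := ℂ) (by simpa using hab)) hb
    (hdeg.trans (W.deg_le_boost hh ht k))
  have hex : ∃ i : ℕ, ¬ N ⊓ Module.End.eigenspace (W.boost h ξ η) ((k : ℂ) - i) ≤ I := by
    by_contra hcon
    push Not at hcon
    exact hR (hle.trans (iSup_le hcon))
  obtain ⟨f, ⟨hfN, hfe⟩, hfI⟩ := SetLike.not_le_iff_exists.1 (Nat.find_spec hex)
  replace hfe := Module.End.mem_eigenspace_iff.1 hfe
  rcases hi : Nat.find hex with _ | i
  · rw [hi, Nat.cast_zero, sub_zero] at hfe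
    obtain ⟨c, hc⟩ := Submodule.mem_span_singleton.1 (W.boost_eq_top hh ht (hdeg hfN) hfe)
    have hc0 : c ≠ 0 := by
      rintro rfl
      rw [zero_smul] at hc
      exact hfI (hc ▸ I.zero_mem)
    have := N.smul_mem c⁻¹ hfN
    rwa [← hc, smul_smul, inv_mul_cancel₀ hc0, one_smul] at this
  · exfalso
    rw [hi] at hfe
    have hmin := Nat.find_min hex (m := i) (by omega)
    rw [not_not] at hmin
    have hA : ∀ j, A j f ∈ I := fun j => hAI j f (hmin ⟨hAN j f hfN,
      Module.End.mem_eigenspace_iff.2 (by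
        have := W.boost_Lv_sub hh ht (hsb j _ f hfe) j
        refine this.trans ?_
        congr 1
        push_cast
        ring)⟩)
    have hsum : ∑ k', ∑ j, upper h k' j • W.X k' (A j f) ∈ I := by
      refine I.sum_mem fun k' _ => I.sum_mem fun j _ => I.smul_mem _ ?_
      obtain ⟨g, hg⟩ := hA j
      exact ⟨W.X k' g, by rw [W.R_X hh, hg]⟩
    simp only [A, map_sub, smul_sub, Finset.sum_sub_distrib] at hsum
    -- The contraction has become kξf - R²D_ξ f - (k - (i + 1))ξf, so i + 1 times ξf is a multiple
    -- of R².
    rw [W.sum_X_Lv hh, W.sum_low_X hh, W.mem_deg.1 (hdeg hfN), hfe, map_smul, map_smul] at hsum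
    have h1 := I.add_mem hsum (show W.R h (W.Dv h ξ f) ∈ I from ⟨_, rfl⟩)
    have h2 : ((i : ℂ) + 1) • W.Xv ξ f ∈ I := by
      convert h1 using 1
      push_cast
      module
    have h3 := I.smul_mem ((i : ℂ) + 1)⁻¹ h2
    rw [smul_smul, inv_mul_cancel₀ (Nat.cast_add_one_ne_zero i), one_smul] at h3
    exact hfI (W.mem_range_R_of_Xv hh ht h3)

end
end SuperWeyl
end OspHarm

/-! ### The Fischer pairing and rotation stable spaces of harmonic polynomials -/

namespace OspHarm
variable {p n : ℕ} {h : Matrix (Idx p n) (Idx p n) ℂ}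

namespace SuperWeyl
variable {V : Type} [Ring V] [Algebra ℂ V] (W : SuperWeyl p n V)

theorem augmentation_X (j : Idx p n) (f : V) : W.augmentation (W.X j f) = 0 := by
  rw [X_apply, map_mul, W.augmentation_coord, zero_mul]

theorem augmentation_L (i j : Idx p n) (f : V) : W.augmentation (W.L h i j f) = 0 := by
  rw [L_apply, map_sub, map_smul, augmentation_X, augmentation_X, smul_zero, sub_zero]

theorem parityOp_pow_X (a : ℕ) (k : Idx p n) (f : V) : (W.parityOp ^ a) (W.X k f) =
    (-1 : ℂ) ^ (a * par p n k) • W.X k ((W.parityOp ^ a) f) := by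
  induction a with
  | zero => simp
  | succ a ih =>
    rw [pow_succ', Module.End.mul_apply, ih, map_smul, parityOp_X, Module.End.mul_apply, smul_smul,
      add_mul, pow_add, one_mul]

theorem parityOp_pow_parityOp_pow (a : ℕ) (f : V) :
    (W.parityOp ^ a) ((W.parityOp ^ a) f) = f := by
  induction a with
  | zero => simp
  | succ a ih =>
    rw [← Module.End.mul_apply, ← pow_add, show a + 1 + (a + 1) = a + a + 2 by ring, pow_add,
      Module.End.mul_apply, pow_two, Module.End.mul_apply, parityOp_parityOp, pow_add,
      Module.End.mul_apply, ih]

theorem parityOp_mem_deg {c : ℂ} {f : V} (hf : f ∈ W.deg c) : W.parityOp f ∈ W.deg c := by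
  rw [mem_deg] at *
  rw [← parityOp_euler, hf, map_smul]

theorem parityOp_pow_mem_deg {c : ℂ} {f : V} (hf : f ∈ W.deg c) (a : ℕ) :
    (W.parityOp ^ a) f ∈ W.deg c := by
  induction a with
  | zero => exact hf
  | succ a ih => rw [pow_succ', Module.End.mul_apply]; exact W.parityOp_mem_deg ih

section
variable (hh : IsMetric (par p n) h)
include hh

theorem L_X (i : Fin p) (j k : Idx p n) (f : V) : W.L h (Sum.inl i) j (W.X k f) =
    sg j k • W.X k (W.L h (Sum.inl i) j f) + h k j • W.X (Sum.inl i) f -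
      h k (Sum.inl i) • W.X j f := by
  simp only [L_apply, W.D_X hh, sg_inl_left, one_smul, map_add, map_sub, map_smul]
  rw [W.X_X j k, W.X_X (Sum.inl i) k, sg_inl_left, one_smul, smul_sub]
  abel

theorem D_L (i : Fin p) (j k : Idx p n) (f : V) : W.D h k (W.L h (Sum.inl i) j f) =
    sg j k • W.L h (Sum.inl i) j (W.D h k f) + h (Sum.inl i) k • W.D h j f -
      h j k • W.D h (Sum.inl i) f := by
  simp only [L_apply, W.D_X hh, sg_inl_left, sg_inl_right, one_smul, map_sub]
  rw [W.D_D hh k j, W.D_D hh k (Sum.inl i), sg_inl_right, map_smul, sg_comm k j, one_smul]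
  module

theorem Dv_linPow_succ {ξ η ζ : Fin p → ℂ} (ht : IsTriple h ξ η ζ) (k : ℕ) :
    W.Dv h ξ (W.linPow η (k + 1)) = ((k : ℂ) + 1) • W.linPow η k := by
  induction k with
  | zero =>
    rw [linPow_succ, linPow_zero, W.Dv_Xv hh, ip_comm hh, ht.ξη]
    simp [Dv_apply, D_apply, W.pd_one]
  | succ k ih =>
    rw [linPow_succ, W.Dv_Xv hh, ip_comm hh, ht.ξη, ih, map_smul, ← linPow_succ]
    push_cast
    module

variable {F : V →ₐ[ℂ] Module.End ℂ V} (hF : ∀ j, F (W.coord j) = W.D h j)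
include hF

omit hh in
theorem symbol_X (j : Idx p n) (f g : V) : F (W.X j f) g = W.D h j (F f g) := by
  rw [X_apply, map_mul, hF]; rfl

/-- Substituting D for X intertwines rotations, since X_k and D_k rotate in the same way (`L_X`,
`D_L`). As rotations produce no constant term, they are skew for the Fischer pairing up to parity.
-/
theorem symbol_L (i : Fin p) (j : Idx p n) (f g : V) : F (W.L h (Sum.inl i) j f) g =
    W.L h (Sum.inl i) j (F f g) - F ((W.parityOp ^ par p n j) f) (W.L h (Sum.inl i) j g) := by
  induction f using W.induction_on with
  | h0 =>
    have : (W.parityOp ^ par p n j) 1 = 1 := by rcases j with j | j <;> simp [par, W.parityOp_one]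
    have hL : W.L h (Sum.inl i) j 1 = 0 := by simp [L_apply, D_apply, W.pd_one]
    rw [this, hL, map_one F, map_zero]
    simp
  | hadd f f' hf hf' => simp only [map_add, LinearMap.add_apply, hf, hf']; abel
  | hsmul c f hf => simp only [map_smul, LinearMap.smul_apply, hf, smul_sub]
  | hX k f hf =>
    have h1 : sg j k * h (Sum.inl i) k = h k (Sum.inl i) := by
      rcases k with k | k
      · rw [sg_inl_right, one_mul, hh.symm_inl]
      · rw [hh.inl_inr, hh.inr_inl, mul_zero]
    have h2 : sg j k * h j k = h k j := (hh.symm' j k).symm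
    rw [W.L_X hh, map_sub, map_add, map_smul, map_smul, map_smul, parityOp_pow_X, map_smul]
    simp only [LinearMap.sub_apply, LinearMap.add_apply, LinearMap.smul_apply, W.symbol_X hF, hf,
      map_sub, W.D_L hh]
    rw [← h1, ← h2, show (-1 : ℂ) ^ (par p n j * par p n k) = sg j k from rfl]
    simp only [smul_sub, smul_add, smul_smul, sg_mul_self, one_smul]
    module

omit hh in
theorem symbol_mul_coord (j : Idx p n) (f g : V) : F (f * W.coord j) g = F f (W.D h j g) := by
  rw [map_mul, hF]; rfl

/-- R² is adjoint to Δ, so harmonic polynomials pair to zero with multiples of R². -/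
theorem symbol_R (f g : V) : F (W.R h f) g = F f (W.laplace h g) := by
  have h1 : F (W.R h f) g = W.laplace h (F f g) := by
    rw [R_eq, W.laplace_eq_D hh]
    simp only [map_sum, map_smul, LinearMap.sum_apply, LinearMap.smul_apply, W.symbol_X hF]
  rw [h1]
  induction f using W.induction_on with
  | h0 => simp
  | hadd f f' hf hf' =>
    simp only [map_add, LinearMap.add_apply]
    rw [hf, hf'] <;> simp only [R_eq, W.laplace_eq_D hh, map_sum, map_smul, LinearMap.sum_apply,
      LinearMap.smul_apply, W.symbol_X hF]
  | hsmul c f hf =>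
    simp only [map_smul, LinearMap.smul_apply]
    rw [hf]
    simp only [R_eq, W.laplace_eq_D hh, map_sum, map_smul, LinearMap.sum_apply,
      LinearMap.smul_apply, W.symbol_X hF]
  | hX k f hf =>
    rw [W.symbol_X hF, W.symbol_X hF, ← W.D_laplace hh, hf]
    simp only [R_eq, W.laplace_eq_D hh, map_sum, map_smul, LinearMap.sum_apply,
      LinearMap.smul_apply, W.symbol_X hF]

/-- Nondegeneracy of the Fischer pairing by induction on the degree: multiplying f by X_j on the
right differentiates g, and Euler's identity detects g from its derivatives. -/
theorem eq_zero_of_symbol {k : ℕ} {g : V} (hg : g ∈ W.deg k)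
    (h0 : ∀ f ∈ W.deg k, W.augmentation (F f g) = 0) : g = 0 := by
  induction k generalizing g with
  | zero =>
    rw [Nat.cast_zero, deg_zero, Submodule.mem_span_singleton] at hg
    obtain ⟨c, rfl⟩ := hg
    have := h0 1 (by rw [mem_deg, euler_one]; simp)
    rw [map_one, Module.End.one_apply, map_smul, map_one, smul_eq_mul, mul_one] at this
    rw [this, zero_smul]
  | succ k ih =>
    refine W.eq_zero_of_D (Nat.cast_ne_zero.2 k.succ_ne_zero) hh hg fun j => ?_
    refine ih ?_ fun f hf => ?_
    · have := W.D_mem_deg (h := h) hg j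
      rwa [Nat.cast_succ, add_sub_cancel_right] at this
    · rw [← W.symbol_mul_coord hF]
      refine h0 _ ?_
      rw [deg_eq_lin_pow] at *
      rw [pow_succ]
      exact Submodule.mul_mem_mul hf (Submodule.subset_span ⟨j, rfl⟩)

variable {ξ η ζ : Fin p → ℂ} (ht : IsTriple h ξ η ζ)
include ht

theorem symbol_linPow (k : ℕ) :
    F (W.linPow ξ k) (W.linPow η k) = (k.factorial : ℂ) • (1 : V) := by
  have h1 : ∀ k g, F (W.linPow ξ k) g = (W.Dv h ξ ^ k) g := by
    intro k g
    induction k with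
    | zero => simp [linPow_zero]
    | succ k ih =>
      rw [linPow_succ, pow_succ', Module.End.mul_apply, ← ih, Xv_apply, Dv_apply]
      simp only [map_sum, map_smul, LinearMap.sum_apply, LinearMap.smul_apply, W.symbol_X hF]
  rw [h1]
  induction k with
  | zero => simp [linPow_zero]
  | succ k ih =>
    rw [pow_succ, Module.End.mul_apply, W.Dv_linPow_succ hh ht, map_smul, ih, smul_smul, Nat.factorial_succ]
    push_cast
    rfl

end

theorem exists_symbol (hh : IsMetric (par p n) h) :
    ∃ F : V →ₐ[ℂ] Module.End ℂ V, ∀ j, F (W.coord j) = W.D h j :=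
  W.lift (W.D h) fun i j => LinearMap.ext fun f => W.D_D hh i j f

/-- A rotation stable space of harmonic polynomials of degree `k` which are not all divisible by
`R²` contains all of them. -/
theorem eq_harmDeg_of_rotStable (hh : IsMetric (par p n) h) {ξ η ζ : Fin p → ℂ}
    (ht : IsTriple h ξ η ζ) {k : ℕ} {N : Submodule ℂ V} (hle : N ≤ W.harmDeg h k)
    (hN : W.RotStable h N) (hR : ¬ N ≤ LinearMap.range (W.R h)) : N = W.harmDeg h k := by
  obtain ⟨F, hF⟩ := W.exists_symbol hh
  have hdeg := hle.trans (W.harmDeg_le_deg k)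
  refine le_antisymm hle fun g hg => ?_
  by_contra hgN
  -- A functional that vanishes on `N` but not at g; by finite dimension in degree k it is the
  -- Fischer pairing with some f.
  obtain ⟨φ, hφg, hφN⟩ := Submodule.exists_le_ker_of_notMem hgN
  have := W.finite_deg k
  let b : W.deg k →ₗ[ℂ] W.deg k →ₗ[ℂ] ℂ := LinearMap.mk₂ ℂ
    (fun g f => W.augmentation (F (f : V) (g : V)))
    (fun _ _ _ => by simp) (fun _ _ _ => by simp) (fun _ _ _ => by simp) (fun _ _ _ => by simp)
  have hb : Function.Injective b := by
    rw [← LinearMap.ker_eq_bot, LinearMap.ker_eq_bot']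
    intro x hx
    refine Subtype.ext (W.eq_zero_of_symbol hh hF x.2 fun f hf => ?_)
    exact LinearMap.congr_fun hx ⟨f, hf⟩
  obtain ⟨f, hf⟩ := LinearMap.flip_surjective_iff₁.2 hb (φ.comp (W.deg k).subtype)
  have hf' : ∀ x ∈ W.deg k, W.augmentation (F (f : V) x) = φ x := fun x hx =>
    LinearMap.congr_fun hf ⟨x, hx⟩
  let N' : Submodule ℂ V :=
    { carrier := {f | f ∈ W.deg k ∧ ∀ x ∈ N, W.augmentation (F f x) = 0}
      zero_mem' := ⟨Submodule.zero_mem _, fun x _ => by simp⟩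
      add_mem' := fun ha hb => ⟨Submodule.add_mem _ ha.1 hb.1, fun x hx => by
        rw [map_add, LinearMap.add_apply, map_add, ha.2 x hx, hb.2 x hx, add_zero]⟩
      smul_mem' := fun c f ha => ⟨Submodule.smul_mem _ c ha.1, fun x hx => by
        rw [map_smul, LinearMap.smul_apply, map_smul, ha.2 x hx, smul_zero]⟩ }
  -- The polynomial f lies in the annihilator of `N`. If it were divisible by R², it would pair to
  -- zero with the harmonic g.
  have hN'R : ¬ N' ≤ LinearMap.range (W.R h) := by
    intro hcon
    obtain ⟨f', hf''⟩ := hcon (show (f : V) ∈ N' from ⟨f.2, fun x hx => by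
      rw [hf' x (hdeg hx)]; exact hφN hx⟩)
    apply hφg
    rw [← hf' g (W.harmDeg_le_deg k hg), ← hf'', W.symbol_R hh hF, (W.mem_harmDeg.1 hg).1, map_zero,
      map_zero]
  have h1 : W.linPow ξ k ∈ N' := by
    refine W.linPow_mem hh ht (fun f hf => hf.1) (Or.inr rfl) (fun i j f hf => ?_) hN'R
    refine ⟨W.L_mem_deg (W.parityOp_pow_mem_deg hf.1 _) _ _, fun x hx => ?_⟩
    rw [W.symbol_L hh hF, map_sub, augmentation_L, parityOp_pow_parityOp_pow, zero_sub,
      hf.2 _ (hN _ _ x hx), neg_zero]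
  -- The roles of ξ and η are exchanged here, because ξ^k and η^k have nonzero pairing k!.
  have h2 : W.linPow η k ∈ N := by
    refine W.linPow_mem hh (ht.swap hh) hdeg (Or.inl rfl) (fun i j f hf => ?_) hR
    rw [one_pow]
    exact hN _ _ f hf
  have h3 := h1.2 _ h2
  rw [W.symbol_linPow hh hF ht, map_smul, map_one, smul_eq_mul, mul_one] at h3
  exact Nat.cast_ne_zero.2 k.factorial_ne_zero h3

end SuperWeyl
end OspHarm

/-! ### The critical dimensions M = 2 - 2q -/

namespace OspHarm
variable {p n : ℕ} {h : Matrix (Idx p n) (Idx p n) ℂ}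

namespace SuperWeyl
variable {V : Type} [Ring V] [Algebra ℂ V] (W : SuperWeyl p n V)

/-- Indecomposability. -/
def IsIndecomposable (S : Set (Module.End ℂ V)) (U : Submodule ℂ V) : Prop :=
  W.IsSubrep S U ∧ U ≠ ⊥ ∧ ∀ U₁ U₂ : Submodule ℂ V, Stable S U₁ → Stable S U₂ →
    U₁ ⊔ U₂ = U → U₁ ⊓ U₂ = ⊥ → U₁ = ⊥ ∨ U₂ = ⊥

/-- The piece of degree `j` of the socle. -/
def piece (h : Matrix (Idx p n) (Idx p n) ℂ) (q j : ℕ) : Submodule ℂ V :=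
  if j ≤ q then W.harmDeg h j
  else (W.harmDeg h (2 * q - j)).map (LinearMap.mulLeft ℂ (W.rsq h ^ (j - q)))

/-- The sum of the pieces. -/
def socle (h : Matrix (Idx p n) (Idx p n) ℂ) (q : ℕ) : Submodule ℂ V :=
  ⨆ j : Fin (2 * q + 1), W.piece h q j

/-- The elements of degree at most `m`. -/
def degLE (m : ℕ) : Submodule ℂ V := ⨆ k : ℕ, if k ≤ m then W.deg k else ⊥

theorem deg_le_degLE {k m : ℕ} (hk : k ≤ m) : W.deg k ≤ W.degLE m :=
  le_iSup_of_le k (by rw [if_pos hk])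

theorem degLE_le {m : ℕ} {U : Submodule ℂ V} (hU : ∀ k ≤ m, W.deg k ≤ U) : W.degLE m ≤ U :=
  iSup_le fun k => by
    split_ifs with hk
    · exact hU k hk
    · exact bot_le

theorem linPow_not_mem_degLE {a : Fin p → ℂ} (ha : a ≠ 0) (m : ℕ) :
    W.linPow a (m + 1) ∉ W.degLE m := by
  intro hm
  have h2 := mem_of_mem_iSup_of_mem_eigenspace (T := W.euler) (c := fun k : ℕ => (k : ℂ))
    Nat.cast_injective (A := fun k => if k ≤ m then W.deg k else ⊥)
    (fun k => by
      split_ifs with hk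
      · exact le_rfl
      · exact bot_le) hm (i := m + 1) (W.linPow_mem_deg a _)
  rw [if_neg (by omega), Submodule.mem_bot] at h2
  exact W.linPow_ne_zero ha _ h2

theorem mulLeft_rsq_pow (t : ℕ) : LinearMap.mulLeft ℂ (W.rsq h ^ t) = W.R h ^ t :=
  (LinearMap.pow_mulLeft ℂ V (W.rsq h) t).symm

theorem R_pow_succ (t : ℕ) (f : V) : (W.R h ^ (t + 1)) f = W.R h ((W.R h ^ t) f) := by
  rw [pow_succ']; rfl

theorem R_pow_succ_apply (t : ℕ) (f : V) : (W.R h ^ (t + 1)) f = (W.R h ^ t) (W.R h f) := by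
  rw [pow_succ]; rfl

theorem piece_of_le {q j : ℕ} (hj : j ≤ q) : W.piece h q j = W.harmDeg h j := if_pos hj

theorem piece_add (q s : ℕ) : W.piece h q (q + s) = (W.harmDeg h (q - s)).map (W.R h ^ s) := by
  rcases s with _ | s
  · rw [add_zero, W.piece_of_le le_rfl, pow_zero]
    exact (Submodule.map_id _).symm
  · rw [piece, if_neg (by omega), mulLeft_rsq_pow, show 2 * q - (q + (s + 1)) = q - (s + 1) by omega,
      show q + (s + 1) - q = s + 1 by omega]

theorem harmDeg_le_socle {q k : ℕ} (hk : k ≤ q) : W.harmDeg h k ≤ W.socle h q := by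
  rw [← W.piece_of_le hk]
  exact le_iSup (fun j : Fin (2 * q + 1) => W.piece h q j) ⟨k, by omega⟩

theorem R_pow_mem_socle {q s : ℕ} (hs : s ≤ q) {f : V} (hf : f ∈ W.harmDeg h (q - s)) :
    (W.R h ^ s) f ∈ W.socle h q := by
  have h1 : W.piece h q (q + s) ≤ W.socle h q :=
    le_iSup (fun j : Fin (2 * q + 1) => W.piece h q j) ⟨q + s, by omega⟩
  rw [piece_add] at h1
  exact h1 ⟨f, hf, rfl⟩

theorem socle_le {q : ℕ} {U : Submodule ℂ V} (h1 : ∀ k ≤ q, W.harmDeg h k ≤ U)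
    (h2 : ∀ s ≤ q, ∀ f ∈ W.harmDeg h (q - s), (W.R h ^ s) f ∈ U) : W.socle h q ≤ U := by
  refine iSup_le fun j => ?_
  by_cases hj : (j : ℕ) ≤ q
  · rw [W.piece_of_le hj]
    exact h1 _ hj
  · obtain ⟨s, hs⟩ := Nat.exists_eq_add_of_le (Nat.le_of_not_le hj)
    rw [hs, piece_add]
    rintro _ ⟨f, hf, rfl⟩
    exact h2 s (by omega) f hf

theorem R_pow_mem_deg {c : ℂ} {f : V} (hf : f ∈ W.deg c) (s : ℕ) :
    (W.R h ^ s) f ∈ W.deg (c + 2 * s) := by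
  induction s with
  | zero => simpa using hf
  | succ s ih =>
    rw [R_pow_succ]
    convert W.R_mem_deg ih using 2
    push_cast
    ring

theorem piece_le_deg {q j : ℕ} (hj : j ≤ 2 * q) : W.piece h q j ≤ W.deg j := by
  by_cases hjq : j ≤ q
  · rw [W.piece_of_le hjq]; exact W.harmDeg_le_deg j
  · obtain ⟨s, rfl⟩ := Nat.exists_eq_add_of_le (Nat.le_of_not_le hjq)
    rw [piece_add]
    rintro _ ⟨f, hf, rfl⟩
    convert W.R_pow_mem_deg (W.harmDeg_le_deg _ hf) s using 2
    rw [Nat.cast_sub (by omega)]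
    push_cast
    ring

theorem iSupIndep_piece (q : ℕ) : iSupIndep (fun j : Fin (2 * q + 1) => W.piece h q j) := by
  have hc : Function.Injective (fun j : Fin (2 * q + 1) => ((j : ℕ) : ℂ)) := fun a b hab =>
    Fin.ext (Nat.cast_injective hab)
  exact ((Module.End.eigenspaces_iSupIndep W.euler).comp hc).mono fun j =>
    W.piece_le_deg (by omega)

theorem mem_deg_of_R_mem {c : ℂ} {f : V} (hinj : Function.Injective (W.R h))
    (hf : W.R h f ∈ W.deg c) : f ∈ W.deg (c - 2) := by
  rw [mem_deg] at *
  apply hinj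
  rw [euler_R] at hf
  rw [map_smul, eq_sub_of_add_eq hf]
  module

section
variable (hh : IsMetric (par p n) h)
include hh

theorem R_pow_X (s : ℕ) (j : Idx p n) (f : V) :
    (W.R h ^ s) (W.X j f) = W.X j ((W.R h ^ s) f) := by
  induction s with
  | zero => rfl
  | succ s ih => rw [R_pow_succ, ih, W.R_X hh, R_pow_succ]

theorem L_R_pow (i j : Idx p n) (s : ℕ) (f : V) :
    W.L h i j ((W.R h ^ s) f) = (W.R h ^ s) (W.L h i j f) := by
  induction s with
  | zero => rfl
  | succ s ih => rw [R_pow_succ, W.L_R hh, ih, R_pow_succ]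

theorem parityOp_R_pow (s : ℕ) (f : V) :
    W.parityOp ((W.R h ^ s) f) = (W.R h ^ s) (W.parityOp f) := by
  induction s with
  | zero => rfl
  | succ s ih => rw [R_pow_succ, W.parityOp_R hh, ih, R_pow_succ]

/-- The sl_2 relation iterated. The vanishing of the scalar decides which multiples of R² can be
harmonic. -/
theorem laplace_R_pow {c : ℂ} {f : V} (hf : f ∈ W.deg c) (s : ℕ) :
    W.laplace h ((W.R h ^ (s + 1)) f) = (W.R h ^ (s + 1)) (W.laplace h f) +
      (2 * (s + 1) * (2 * c + sdim p n + 2 * s)) • (W.R h ^ s) f := by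
  induction s with
  | zero =>
    rw [zero_add, pow_one, pow_zero, W.laplace_R hh, W.mem_deg.1 hf, Module.End.one_apply]
    push_cast
    module
  | succ s ih =>
    rw [R_pow_succ, W.laplace_R hh, ih, W.mem_deg.1 (W.R_pow_mem_deg hf (s + 1)), map_add,
      map_smul, ← R_pow_succ, ← R_pow_succ]
    push_cast
    module

theorem D_R_pow (j : Idx p n) (s : ℕ) (f : V) : W.D h j ((W.R h ^ (s + 1)) f) =
    (W.R h ^ (s + 1)) (W.D h j f) + (2 * (s + 1) : ℂ) • (W.R h ^ s) (W.X j f) := by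
  induction s with
  | zero =>
    rw [zero_add, pow_one, pow_zero, W.D_R hh, Module.End.one_apply]
    push_cast
    module
  | succ s ih =>
    rw [R_pow_succ, W.D_R hh, ih, map_add, map_smul, ← R_pow_succ, ← R_pow_succ, ← W.R_pow_X hh]
    push_cast
    module

theorem laplace_Xv (a : Fin p → ℂ) (f : V) :
    W.laplace h (W.Xv a f) = W.Xv a (W.laplace h f) + (2 : ℂ) • W.Dv h a f := by
  simp only [Xv_apply, Dv_apply, map_sum, map_smul, W.laplace_X hh, smul_add,
    Finset.sum_add_distrib, Finset.smul_sum, smul_comm (2 : ℂ)]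

theorem linPow_mem_harmDeg {ξ η ζ : Fin p → ℂ} (ht : IsTriple h ξ η ζ) (k : ℕ) :
    W.linPow ξ k ∈ W.harmDeg h k := by
  refine W.mem_harmDeg.2 ⟨?_, W.linPow_mem_deg ξ k⟩
  have hD : ∀ k, W.Dv h ξ (W.linPow ξ k) = 0 := by
    intro k
    induction k with
    | zero => simp [linPow_zero, Dv_apply, D_apply, W.pd_one]
    | succ k ih => rw [linPow_succ, W.Dv_Xv hh, ih, ht.ξξ, map_zero, zero_smul, add_zero]
  induction k with
  | zero => simp [linPow_zero, laplace_eq_pd, W.pd_one]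
  | succ k ih =>
    rw [linPow_succ, W.laplace_Xv hh, ih, hD, map_zero, smul_zero, add_zero]

theorem linPow_not_mem_range {ξ η ζ : Fin p → ℂ} (ht : IsTriple h ξ η ζ) (k : ℕ) :
    W.linPow ξ k ∉ LinearMap.range (W.R h) := by
  induction k with
  | zero =>
    rintro ⟨g, hg⟩
    have := congrArg W.augmentation hg
    rw [R_eq, linPow_zero, map_one] at this
    simp only [map_sum, map_smul, augmentation_X, smul_zero, Finset.sum_const_zero] at this
    exact zero_ne_one this
  | succ k ih =>
    rw [linPow_succ]
    exact fun hk => ih (W.mem_range_R_of_Xv hh ht hk)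

variable {q : ℕ} (hq : sdim p n = 2 - 2 * q)
include hq

theorem D_R_pow_harmDeg {s : ℕ} (hs : s + 1 ≤ q) {f : V} (hf : f ∈ W.harmDeg h (q - (s + 1)))
    (j : Idx p n) : W.D h j ((W.R h ^ (s + 1)) f) = -(W.R h ^ s) (W.K h j f) := by
  rw [W.D_R_pow hh, K_apply, W.mem_deg.1 (W.harmDeg_le_deg _ hf), R_pow_succ_apply, hq,
    Nat.cast_sub hs, map_sub, map_add]
  simp only [map_smul]
  push_cast
  module

/-- R^{2s}f has degree q + s, so 2E + M - 2 takes the value 2s on it; this cancels against the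
derivative of R^{2s}. Together with `D_R_pow_harmDeg` it shows that K and D exchange roles on the
upper half of the socle. -/
theorem K_R_pow_harmDeg {s : ℕ} (hs : s ≤ q) {f : V} (hf : f ∈ W.harmDeg h (q - s))
    (j : Idx p n) : W.K h j ((W.R h ^ s) f) = -(W.R h ^ (s + 1)) (W.D h j f) := by
  have h1 := W.mem_deg.1 (W.R_pow_mem_deg (h := h) (W.harmDeg_le_deg _ hf) s)
  rw [Nat.cast_sub hs] at h1
  rw [K_apply, h1, map_smul, hq]
  rcases s with _ | s
  · simp only [pow_zero, zero_add, pow_one, Module.End.one_apply]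
    push_cast
    module
  · rw [W.D_R_pow hh, map_add, map_smul, ← R_pow_succ, ← R_pow_succ, W.R_pow_X hh (s + 1) j f]
    push_cast
    module

theorem confStable_socle : W.ConfStable h (W.socle h q) where
  D j := by
    suffices W.socle h q ≤ (W.socle h q).comap (W.D h j) from this
    have h1 : ∀ k ≤ q, W.harmDeg h k ≤ (W.socle h q).comap (W.D h j) := by
      rintro (_ | k) hk f hf
      · have := W.harmDeg_le_deg 0 hf
        rw [Nat.cast_zero] at this
        rw [Submodule.mem_comap, W.D_eq_zero_of_mem_deg_zero this]
        exact Submodule.zero_mem _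
      · exact W.harmDeg_le_socle (Nat.le_of_succ_le hk) (W.D_mem_harmDeg hh hf j)
    refine W.socle_le h1 ?_
    rintro (_ | s) hs f hf
    · exact h1 q le_rfl hf
    · rw [Submodule.mem_comap, W.D_R_pow_harmDeg hh hq hs hf]
      refine Submodule.neg_mem _ (W.R_pow_mem_socle (Nat.le_of_succ_le hs) ?_)
      have := W.K_mem_harmDeg hh hf j
      rwa [show q - (s + 1) + 1 = q - s by omega] at this
  euler := by
    suffices W.socle h q ≤ (W.socle h q).comap W.euler from this
    refine iSup_le fun j f hf => ?_
    rw [Submodule.mem_comap, W.mem_deg.1 (W.piece_le_deg (by omega) hf)]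
    exact Submodule.smul_mem _ _ (le_iSup (fun j : Fin (2 * q + 1) => W.piece h q j) j hf)
  K j := by
    suffices W.socle h q ≤ (W.socle h q).comap (W.K h j) from this
    have h2 : ∀ s ≤ q, ∀ f ∈ W.harmDeg h (q - s),
        (W.R h ^ s) f ∈ (W.socle h q).comap (W.K h j) := by
      intro s hs f hf
      rw [Submodule.mem_comap, W.K_R_pow_harmDeg hh hq hs hf]
      refine Submodule.neg_mem _ ?_
      rcases Nat.eq_or_lt_of_le hs with rfl | hs'
      · have := W.harmDeg_le_deg _ hf
        rw [Nat.sub_self, Nat.cast_zero] at this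
        rw [W.D_eq_zero_of_mem_deg_zero this, map_zero]
        exact Submodule.zero_mem _
      · refine W.R_pow_mem_socle hs' (W.D_mem_harmDeg hh ?_ j)
        rwa [show q - (s + 1) + 1 = q - s by omega]
    refine W.socle_le (fun k hk f hf => ?_) h2
    rcases Nat.eq_or_lt_of_le hk with rfl | hk'
    · exact h2 0 (Nat.zero_le _) f hf
    · exact W.harmDeg_le_socle hk' (W.K_mem_harmDeg hh hf j)
  L i j := by
    suffices W.socle h q ≤ (W.socle h q).comap (W.L h i j) from this
    refine W.socle_le (fun k hk f hf => W.harmDeg_le_socle hk (W.rotStable_harmDeg hh k i j f hf))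
      fun s hs f hf => ?_
    rw [Submodule.mem_comap, W.L_R_pow hh]
    exact W.R_pow_mem_socle hs (W.rotStable_harmDeg hh _ i j f hf)

omit hq in
theorem parityOp_mem_socle {f : V} (hf : f ∈ W.socle h q) : W.parityOp f ∈ W.socle h q := by
  suffices W.socle h q ≤ (W.socle h q).comap W.parityOp from this hf
  refine W.socle_le (fun k hk f hf => W.harmDeg_le_socle hk (W.parityOp_mem_harmDeg hh hf))
    fun s hs f hf => ?_
  rw [Submodule.mem_comap, W.parityOp_R_pow hh]
  exact W.R_pow_mem_socle hs (W.parityOp_mem_harmDeg hh hf)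

theorem socle_le_harm : W.socle h q ≤ W.harm h := by
  refine W.socle_le (fun k _ => W.harmDeg_le_harm k) ?_
  rintro (_ | s) hs f hf
  · exact W.harmDeg_le_harm _ hf
  · rw [mem_harm, W.laplace_R_pow hh (W.harmDeg_le_deg _ hf), (W.mem_harmDeg.1 hf).1, map_zero, hq,
      Nat.cast_sub hs]
    push_cast
    rw [show (2 * ((s : ℂ) + 1) * (2 * (q - (s + 1)) + (2 - 2 * q) + 2 * s)) = 0 by ring,
      zero_smul, add_zero]

variable {ξ η ζ : Fin p → ℂ} (ht : IsTriple h ξ η ζ)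
include ht

omit hq in
theorem R_pow_injective (s : ℕ) : Function.Injective (W.R h ^ s : Module.End ℂ V) := by
  rw [Module.End.coe_pow]
  exact (W.R_injective hh ht).iterate s

/-- Let f = R^{2s+2}φ be harmonic. Applying Δ and cancelling R^{2s} gives R²Δφ + cφ = 0, so φ is
again divisible by R² when c ≠ 0. The constant is 4(s + 1)(k - (q + s + 1)). -/
theorem exists_R_pow {k : ℕ} {f : V} (hf : f ∈ W.harmDeg h k) (hR : f ∈ LinearMap.range (W.R h))
    (s : ℕ) (hs : ∀ t, t < s → k ≠ q + (t + 1)) :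
    ∃ φ ∈ W.deg ((k : ℂ) - 2 * (s + 1)), f = (W.R h ^ (s + 1)) φ := by
  have hinj := W.R_injective hh ht
  induction s with
  | zero =>
    obtain ⟨φ, hφ⟩ := hR
    refine ⟨φ, ?_, by rw [zero_add, pow_one, hφ]⟩
    have := W.mem_deg_of_R_mem hinj (hφ.symm ▸ W.harmDeg_le_deg k hf)
    simpa using this
  | succ s ih =>
    obtain ⟨φ, hφ, rfl⟩ := ih fun t ht => hs t (by omega)
    have h1 := (W.mem_harmDeg.1 hf).1
    rw [W.laplace_R_pow hh hφ, R_pow_succ_apply, ← map_smul, ← map_add] at h1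
    replace h1 := W.R_pow_injective hh ht s (h1.trans (map_zero _).symm)
    set c : ℂ := 2 * (s + 1) * (2 * (k - 2 * (s + 1)) + sdim p n + 2 * s) with hc
    have hc' : c = 4 * (s + 1) * (k - (q + (s + 1))) := by rw [hc, hq]; ring
    have hc0 : c ≠ 0 := by
      rw [hc']
      refine mul_ne_zero (mul_ne_zero (by norm_num) (Nat.cast_add_one_ne_zero s)) ?_
      refine sub_ne_zero.2 fun he => hs s (Nat.lt_succ_self s) ?_
      exact_mod_cast he
    have h2 : φ = W.R h (-(c⁻¹) • W.laplace h φ) := by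
      have : c • φ = -W.R h (W.laplace h φ) := (neg_eq_of_add_eq_zero_right h1).symm
      calc φ = c⁻¹ • (c • φ) := by rw [smul_smul, inv_mul_cancel₀ hc0, one_smul]
        _ = _ := by rw [this, map_smul]; module
    refine ⟨-(c⁻¹) • W.laplace h φ, ?_, ?_⟩
    · have h3 := W.mem_deg_of_R_mem hinj (h2 ▸ hφ)
      convert h3 using 2
      push_cast
      ring
    · rw [W.R_pow_succ_apply (s + 1), ← h2]

/-- For k ≤ q the division by R² never stops, so the quotient eventually has negative degree. -/
theorem eq_zero_of_mem_range {k : ℕ} (hk : k ≤ q) {f : V} (hf : f ∈ W.harmDeg h k)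
    (hR : f ∈ LinearMap.range (W.R h)) : f = 0 := by
  obtain ⟨φ, hφ, rfl⟩ := W.exists_R_pow hh hq ht hf hR k fun t _ => by omega
  rw [W.deg_eq_bot (c := (k : ℂ) - 2 * (k + 1)) (fun l hl => by
    have : ((k + l + 2 : ℕ) : ℂ) = 0 := by push_cast; linear_combination -hl
    exact absurd (Nat.cast_eq_zero.1 this) (by omega)), Submodule.mem_bot] at hφ
  rw [hφ, map_zero]

/-- For k = q + s + 1 the division can be carried out up to R^{2s+2}, where the scalar vanishes; the
quotient is then itself harmonic, of degree q - s - 1, or zero if this is negative. -/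
theorem mem_socle_of_mem_range {k : ℕ} {f : V} (hf : f ∈ W.harmDeg h k)
    (hR : f ∈ LinearMap.range (W.R h)) : f ∈ W.socle h q := by
  rcases Nat.lt_or_ge q k with hk | hk
  · obtain ⟨s, rfl⟩ := Nat.exists_eq_add_of_lt hk
    obtain ⟨φ, hφ, rfl⟩ := W.exists_R_pow hh hq ht hf hR s fun t _ => by omega
    rcases Nat.lt_or_ge s q with hs | hs
    · have e : (((q + s + 1 : ℕ) : ℂ) - 2 * (s + 1)) = ((q - (s + 1) : ℕ) : ℂ) := by
        rw [Nat.cast_sub hs]; push_cast; ring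
      rw [e] at hφ
      refine W.R_pow_mem_socle hs (W.mem_harmDeg.2 ⟨?_, hφ⟩)
      have h1 := (W.mem_harmDeg.1 hf).1
      rw [W.laplace_R_pow hh hφ, hq, Nat.cast_sub hs] at h1
      push_cast at h1
      rw [show (2 * ((s : ℂ) + 1) * (2 * (q - (s + 1)) + (2 - 2 * q) + 2 * s)) = 0 by ring,
        zero_smul, add_zero] at h1
      exact W.R_pow_injective hh ht (s + 1) (h1.trans (map_zero _).symm)
    · rw [W.deg_eq_bot (fun l hl => by
        have : (q : ℂ) = ((s + l + 1 : ℕ) : ℂ) := by push_cast at hl ⊢; linear_combination hl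
        have := Nat.cast_injective this
        omega), Submodule.mem_bot] at hφ
      rw [hφ, map_zero]
      exact Submodule.zero_mem _
  · rw [W.eq_zero_of_mem_range hh hq ht hk hf hR]
    exact Submodule.zero_mem _

theorem eq_harmDeg_of_le {k : ℕ} (hk : k ≤ q) {N : Submodule ℂ V} (hN : N ≤ W.harmDeg h k)
    (hst : W.RotStable h N) (hne : N ≠ ⊥) : N = W.harmDeg h k := by
  refine W.eq_harmDeg_of_rotStable hh ht hN hst fun hR => hne ?_
  rw [eq_bot_iff]
  exact fun f hf => (Submodule.mem_bot ℂ).2 (W.eq_zero_of_mem_range hh hq ht hk (hN hf) (hR hf))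

/-- Up to degree q the scalar of `sum_K_D` is nonzero. Beyond q one uses K_j R^{2s}f = -R^{2s+2}D_j
f and the irreducibility of the spaces H_k with k ≤ q. -/
theorem socle_le_of_one_mem {U : Submodule ℂ V} (hU : W.ConfStable h U) (h1 : (1 : V) ∈ U) :
    W.socle h q ≤ U := by
  have hk : ∀ k ≤ q, W.harmDeg h k ≤ U := by
    intro k hk
    induction k with
    | zero => exact W.harmDeg_zero_le h1
    | succ k ih =>
      refine W.harmDeg_succ_le hh hU (fun h0 => ?_) (ih (by omega))
      rw [hq] at h0
      have : (k : ℂ) = q := by linear_combination h0 / 2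
      have := Nat.cast_injective this
      omega
  refine W.socle_le hk fun s hs => ?_
  induction s with
  | zero => exact fun f hf => hk q le_rfl hf
  | succ s ih =>
    let N := W.harmDeg h (q - (s + 1)) ⊓ U.comap (W.R h ^ (s + 1))
    have hD : ∀ f ∈ W.harmDeg h (q - s), ∀ j, W.D h j f ∈ N := by
      intro f hf j
      refine ⟨W.D_mem_harmDeg hh (by rwa [show q - (s + 1) + 1 = q - s by omega]) j, ?_⟩
      have h2 := hU.K j _ (ih (by omega) f hf)
      rw [W.K_R_pow_harmDeg hh hq (by omega) hf] at h2
      exact (Submodule.neg_mem_iff U).1 h2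
    have hN : N = W.harmDeg h (q - (s + 1)) := by
      refine W.eq_harmDeg_of_le hh hq ht (by omega) inf_le_left (fun i j f hf => ?_) fun hbot => ?_
      · refine ⟨W.rotStable_harmDeg hh _ i j f hf.1, ?_⟩
        have := hU.L i j _ hf.2
        rwa [W.L_R_pow hh] at this
      -- `N` contains all D_j ξ^{q-s}. Since q - s > 0, these cannot all vanish by Euler's identity.
      · refine W.linPow_ne_zero ht.ne_zero (q - s) (W.eq_zero_of_D (c := ((q - s : ℕ) : ℂ))
          (Nat.cast_ne_zero.2 (by omega)) hh (W.linPow_mem_deg ξ (q - s)) fun j => ?_)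
        have := hD _ (W.linPow_mem_harmDeg hh ht (q - s)) j
        rwa [hbot, Submodule.mem_bot] at this
    intro f hf
    rw [← hN] at hf
    exact hf.2

omit hh hq ht in
theorem one_mem_socle : (1 : V) ∈ W.socle h q :=
  W.harmDeg_le_socle (Nat.zero_le q) W.one_mem_harmDeg

theorem isIrred_socle : W.IsIrred (W.confOps h) (W.socle h q) := by
  refine ⟨⟨(W.stable_confOps_iff hh _).2 (W.confStable_socle hh hq),
    fun f hf => W.parityOp_mem_socle hh hf⟩, fun hbot => ?_, fun U hU hst => ?_⟩
  · have := W.one_mem_socle (h := h) (q := q)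
    rw [hbot, Submodule.mem_bot] at this
    exact W.one_ne_zero' this
  · rw [W.stable_confOps_iff hh] at hst
    rw [or_iff_not_imp_left]
    exact fun hne => le_antisymm hU
      (W.socle_le_of_one_mem hh hq ht hst (ConfStable.one_mem W hh hst hne))

/-- The socle lives in degrees at most 2q, whereas ξ^{2q+1} is harmonic. -/
theorem socle_lt_harm : W.socle h q < W.harm h := by
  refine lt_of_le_of_ne (W.socle_le_harm hh hq) fun heq => ?_
  refine W.linPow_not_mem_degLE ht.ne_zero (2 * q) (?_ : _ ∈ W.degLE (2 * q))
  have h1 : W.socle h q ≤ W.degLE (2 * q) := iSup_le fun j =>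
    (W.piece_le_deg (by omega)).trans (W.deg_le_degLE (by omega))
  exact h1 (heq ▸ W.harmDeg_le_harm _ (W.linPow_mem_harmDeg hh ht _))

omit hq in
-- D_η ξ^{k+1} = (k + 1)ξ^k is not divisible by R², so what D produces in H_k is not confined to the
-- multiples of R² and generates H_k under rotations.
theorem harmDeg_le_of_succ {U : Submodule ℂ V} (hU : W.ConfStable h U) {k : ℕ}
    (hk : W.harmDeg h (k + 1) ≤ U) : W.harmDeg h k ≤ U := by
  have hN : U ⊓ W.harmDeg h k = W.harmDeg h k := by
    refine W.eq_harmDeg_of_rotStable hh ht inf_le_right (fun i j f hf =>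
      ⟨hU.L i j f hf.1, W.rotStable_harmDeg hh k i j f hf.2⟩) fun hR => ?_
    refine W.linPow_not_mem_range hh ht k (hR ?_)
    have h1 : W.Dv h η (W.linPow ξ (k + 1)) ∈ U := by
      rw [Dv_apply]
      exact U.sum_mem fun i _ => U.smul_mem _ (hU.D _ _ (hk (W.linPow_mem_harmDeg hh ht _)))
    rw [W.Dv_linPow_succ hh (ht.swap hh)] at h1
    have h3 := U.smul_mem ((k : ℂ) + 1)⁻¹ h1
    rw [smul_smul, inv_mul_cancel₀ (Nat.cast_add_one_ne_zero k), one_smul] at h3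
    exact ⟨h3, W.linPow_mem_harmDeg hh ht k⟩
  exact inf_eq_right.1 hN

theorem eq_bot_or_socle_or_harm {U : Submodule ℂ V} (hle : U ≤ W.harm h)
    (hst : Stable (W.confOps h) U) : U = ⊥ ∨ U = W.socle h q ∨ U = W.harm h := by
  rw [W.stable_confOps_iff hh] at hst
  rw [or_iff_not_imp_left, or_iff_not_imp_left]
  intro hne hns
  have hsU := W.socle_le_of_one_mem hh hq ht hst (ConfStable.one_mem W hh hst hne)
  -- In such a degree the component of `U` is not made of multiples of R², since those lie in the
  -- socle. It is therefore all of H_k, and k > q.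
  have hex : ∃ k : ℕ, ¬ U ⊓ W.deg k ≤ W.socle h q := by
    by_contra hcon
    push Not at hcon
    exact hns (le_antisymm ((ConfStable.inf_deg W hst).trans (iSup_le hcon)) hsU)
  obtain ⟨k, hk⟩ := hex
  have hUk : U ⊓ W.deg k ≤ W.harmDeg h k := fun f hf =>
    W.mem_harmDeg.2 ⟨W.mem_harm.1 (hle hf.1), hf.2⟩
  have hHk : W.harmDeg h k ≤ U := by
    rw [← W.eq_harmDeg_of_rotStable hh ht hUk (fun i j f hf =>
      ⟨hst.L i j f hf.1, W.L_mem_deg hf.2 i j⟩) fun hR => hk fun f hf =>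
        W.mem_socle_of_mem_range hh hq ht (hUk hf) (hR hf)]
    exact inf_le_left
  have hqk : q < k := by
    by_contra hcon
    exact hk (hUk.trans (W.harmDeg_le_socle (not_lt.1 hcon)))
  refine le_antisymm hle (iSup_le fun j => ?_)
  rcases Nat.le_total j k with hj | hj
  · exact Nat.decreasingInduction (motive := fun j _ => W.harmDeg h j ≤ U)
      (fun i _ ih => W.harmDeg_le_of_succ hh ht hst ih) hHk hj
  · refine Nat.le_induction (P := fun j _ => W.harmDeg h j ≤ U) hHk (fun i hi ih => ?_) j hj
    -- Going up from k is unobstructed, since the only zero of 2i + M - 2 is i = q < k.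
    refine W.harmDeg_succ_le hh hst (fun h0 => ?_) ih
    rw [hq] at h0
    have : (i : ℂ) = q := by linear_combination h0 / 2
    have := Nat.cast_injective this
    omega

/-- Any two nonzero submodules share the constant 1. -/
theorem isIndecomposable_harm : W.IsIndecomposable (W.confOps h) (W.harm h) := by
  refine ⟨W.isSubrep_harm hh, ne_bot_of_gt (W.socle_lt_harm hh hq ht), fun U₁ U₂ h1 h2 _ hinf => ?_⟩
  rw [W.stable_confOps_iff hh] at h1 h2
  by_contra hcon
  rw [not_or] at hcon
  have : (1 : V) ∈ U₁ ⊓ U₂ :=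
    ⟨ConfStable.one_mem W hh h1 hcon.1, ConfStable.one_mem W hh h2 hcon.2⟩
  rw [hinf, Submodule.mem_bot] at this
  exact W.one_ne_zero' this

/-- Multiplication by a power of R² is injective and commutes with rotations, so each piece is a
copy of some H_k with k ≤ q. -/
theorem isIrred_piece (j : Fin (2 * q + 1)) : W.IsIrred (W.rotOps h) (W.piece h q j) := by
  have key : ∀ s k, k ≤ q → W.IsIrred (W.rotOps h) ((W.harmDeg h k).map (W.R h ^ s)) := by
    intro s k hk
    refine ⟨⟨(W.stable_rotOps_iff hh _).2 ?_, ?_⟩, fun hbot => ?_, fun U hU hst => ?_⟩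
    · rintro a b _ ⟨f, hf, rfl⟩
      exact ⟨_, W.rotStable_harmDeg hh k a b f hf, (W.L_R_pow hh a b s f).symm⟩
    · rintro _ ⟨f, hf, rfl⟩
      exact ⟨_, W.parityOp_mem_harmDeg hh hf, (W.parityOp_R_pow hh s f).symm⟩
    · have : (W.R h ^ s) (W.linPow ξ k) ∈ (W.harmDeg h k).map (W.R h ^ s) :=
        ⟨_, W.linPow_mem_harmDeg hh ht k, rfl⟩
      rw [hbot, Submodule.mem_bot] at this
      exact W.linPow_ne_zero ht.ne_zero k
        (W.R_pow_injective hh ht s (this.trans (map_zero _).symm))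
    · rw [W.stable_rotOps_iff hh] at hst
      rw [or_iff_not_imp_left]
      intro hne
      obtain ⟨g, hg, hg0⟩ := Submodule.exists_mem_ne_zero_of_ne_bot hne
      obtain ⟨f, hf, rfl⟩ := hU hg
      have hN : W.harmDeg h k ⊓ U.comap (W.R h ^ s) = W.harmDeg h k := by
        refine W.eq_harmDeg_of_le hh hq ht hk inf_le_left (fun a b f hf => ?_) fun hbot => hg0 ?_
        · refine ⟨W.rotStable_harmDeg hh k a b f hf.1, ?_⟩
          have := hst a b _ hf.2
          rwa [W.L_R_pow hh] at this
        · have : f ∈ W.harmDeg h k ⊓ U.comap (W.R h ^ s) := ⟨hf, hg⟩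
          rw [hbot, Submodule.mem_bot] at this
          rw [this, map_zero]
      refine le_antisymm hU ?_
      rw [Submodule.map_le_iff_le_comap]
      exact inf_eq_left.1 hN
  by_cases hj : (j : ℕ) ≤ q
  · have := key 0 j hj
    rw [pow_zero] at this
    rw [W.piece_of_le hj, ← Submodule.map_id (W.harmDeg h j)]
    exact this
  · obtain ⟨s, hs⟩ := Nat.exists_eq_add_of_le (Nat.le_of_not_le hj)
    rw [hs, piece_add]
    exact key s _ (by omega)

end
end SuperWeyl
end OspHarm

/-! ### Existence of Witt frames -/

namespace OspHarm
variable {p n : ℕ} {h : Matrix (Idx p n) (Idx p n) ℂ}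

/-- Symplectic Gram–Schmidt: a further pair is found in the orthogonal complement of the pairs
already constructed. -/
theorem exists_hyperbolic_of_alternating {E : Type} [AddCommGroup E] [Module ℂ E]
    [FiniteDimensional ℂ E] (B : E →ₗ[ℂ] E →ₗ[ℂ] ℂ) (halt : ∀ x, B x x = 0)
    (hnd : ∀ x, x ≠ 0 → ∃ y, B x y ≠ 0) (k : ℕ) (hk : 2 * k ≤ Module.finrank ℂ E) :
    ∃ x y : Fin k → E, (∀ i j, B (x i) (x j) = 0) ∧ (∀ i j, B (y i) (y j) = 0) ∧
      ∀ i j, B (x i) (y j) = if i = j then 1 else 0 := by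
  have hskew : ∀ x y, B y x = -B x y := fun x y => by
    have := halt (x + y)
    simp only [map_add, LinearMap.add_apply, halt, zero_add, add_zero] at this
    exact eq_neg_of_add_eq_zero_left this
  induction k with
  | zero => exact ⟨Fin.elim0, Fin.elim0, fun i => i.elim0, fun i => i.elim0, fun i => i.elim0⟩
  | succ k ih =>
    obtain ⟨x, y, hx, hy, hxy⟩ := ih (by omega)
    have hyx : ∀ i j, B (y i) (x j) = -if i = j then 1 else 0 := fun i j => by
      rw [hskew, hxy]; simp only [eq_comm]
    -- The projection onto the orthogonal complement of the pairs already constructed; it is nonzero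
    -- on vectors outside their span.
    let P : E → E := fun z => z - ∑ i, B z (y i) • x i + ∑ i, B z (x i) • y i
    have hPy : ∀ z j, B (P z) (y j) = 0 := fun z j => by
      simp [P, hxy, hy, LinearMap.sum_apply]
    have hPx : ∀ z j, B (P z) (x j) = 0 := fun z j => by
      simp [P, hyx, hx, LinearMap.sum_apply]
    obtain ⟨z₀, hz₀⟩ : ∃ z₀, z₀ ∉ Submodule.span ℂ (Set.range (Sum.elim x y)) := by
      by_contra hcon
      push Not at hcon
      have h1 := finrank_range_le_card (R := ℂ) (Sum.elim x y)
      rw [Set.finrank, (Submodule.eq_top_iff'.2 hcon), finrank_top, Fintype.card_sum,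
        Fintype.card_fin] at h1
      omega
    have hz : P z₀ ≠ 0 := by
      intro h0
      apply hz₀
      have hmx : ∀ i, x i ∈ Submodule.span ℂ (Set.range (Sum.elim x y)) := fun i =>
        Submodule.subset_span ⟨Sum.inl i, rfl⟩
      have hmy : ∀ i, y i ∈ Submodule.span ℂ (Set.range (Sum.elim x y)) := fun i =>
        Submodule.subset_span ⟨Sum.inr i, rfl⟩
      have e : z₀ = ∑ i, B z₀ (y i) • x i - ∑ i, B z₀ (x i) • y i := by
        have h1 : z₀ - (∑ i, B z₀ (y i) • x i - ∑ i, B z₀ (x i) • y i) = 0 := by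
          rw [← h0]
          simp only [P]
          abel
        exact sub_eq_zero.1 h1
      rw [e]
      exact Submodule.sub_mem _ (Submodule.sum_mem _ fun i _ => Submodule.smul_mem _ _ (hmx i))
        (Submodule.sum_mem _ fun i _ => Submodule.smul_mem _ _ (hmy i))
    obtain ⟨w, hw⟩ := hnd _ hz
    have hPw : B (P z₀) (P w) = B (P z₀) w := by
      have e : P w = w - ∑ i, B w (y i) • x i + ∑ i, B w (x i) • y i := rfl
      rw [e, map_add, map_sub, map_sum, map_sum]
      simp only [map_smul, hPx, hPy, smul_zero, Finset.sum_const_zero, sub_zero, add_zero]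
    refine ⟨Fin.cons (P z₀) x, Fin.cons ((B (P z₀) w)⁻¹ • P w) y, ?_, ?_, ?_⟩
    · intro i j
      refine Fin.cases ?_ (fun i => ?_) i <;> refine Fin.cases ?_ (fun j => ?_) j
      · simp [halt]
      · simp [hPx]
      · simp [hskew (P z₀), hPx]
      · simp [hx]
    · intro i j
      refine Fin.cases ?_ (fun i => ?_) i <;> refine Fin.cases ?_ (fun j => ?_) j
      · simp [halt]
      · simp [hPy]
      · simp [hskew (P w), hPy]
      · simp [hy]
    · intro i j
      refine Fin.cases ?_ (fun i => ?_) i <;> refine Fin.cases ?_ (fun j => ?_) j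
      · simp [hPw, hw]
      · simp [hPy, (Fin.succ_ne_zero j).symm]
      · simp [hskew (P w), hPx]
      · simp [hxy]

/-- The inclusion of the even ambient indices. -/
def evenEmb : Fin 2 ⊕ Fin p → AmbIdx p n := Sum.map id Sum.inl

/-- Even ambient vectors. -/
def evenVec (w : Fin 2 ⊕ Fin p → ℂ) : AmbIdx p n → ℂ :=
  Sum.elim (fun i => w (Sum.inl i)) (Sum.elim (fun i => w (Sum.inr i)) 0)

/-- Odd ambient vectors. -/
def oddVec (w : Fin (2 * n) → ℂ) : AmbIdx p n → ℂ := Sum.elim 0 (Sum.elim 0 w)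

theorem sum_ambIdx {M : Type} [AddCommMonoid M] (f : AmbIdx p n → M) :
    ∑ a, f a = ∑ i, f (evenEmb i) + ∑ j, f (Sum.inr (Sum.inr j)) := by
  simp [Fintype.sum_sum_type, evenEmb, add_assoc]

theorem evenVec_evenEmb (w : Fin 2 ⊕ Fin p → ℂ) (i : Fin 2 ⊕ Fin p) :
    evenVec (n := n) w (evenEmb i) = w i := by rcases i with i | i <;> rfl

theorem oddVec_evenEmb (w : Fin (2 * n) → ℂ) (i : Fin 2 ⊕ Fin p) :
    oddVec w (evenEmb i) = 0 := by rcases i with i | i <;> rfl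

theorem ambPar_evenEmb (i : Fin 2 ⊕ Fin p) : ambPar p n (evenEmb i) = 0 := by
  rcases i with i | i <;> rfl

theorem ambPar_inr_inr (j : Fin (2 * n)) : ambPar p n (Sum.inr (Sum.inr j)) = 1 := rfl

variable (hh : IsMetric (par p n) h)
include hh

theorem IsMetric.ambMetric_even_odd (i : Fin 2 ⊕ Fin p) (j : Fin (2 * n)) :
    ambMetric h (evenEmb i) (Sum.inr (Sum.inr j)) = 0 :=
  hh.ambMetric_isMetric.even _ _ (by rw [ambPar_evenEmb, ambPar_inr_inr]; decide)

theorem IsMetric.ambMetric_odd_even (i : Fin 2 ⊕ Fin p) (j : Fin (2 * n)) :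
    ambMetric h (Sum.inr (Sum.inr j)) (evenEmb i) = 0 :=
  hh.ambMetric_isMetric.even _ _ (by rw [ambPar_evenEmb, ambPar_inr_inr]; decide)

theorem evenVec_dotProduct (w w' : Fin 2 ⊕ Fin p → ℂ) :
    evenVec w ⬝ᵥ (ambMetric h).mulVec (evenVec w') =
      w ⬝ᵥ (Matrix.of fun i j => ambMetric h (evenEmb i) (evenEmb j)).mulVec w' := by
  simp only [dotProduct, Matrix.mulVec, Matrix.of_apply]
  rw [sum_ambIdx]
  simp only [sum_ambIdx (fun b => ambMetric h _ b * evenVec w' b), evenVec_evenEmb,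
    hh.ambMetric_even_odd]
  simp [evenVec]

theorem oddVec_dotProduct (w w' : Fin (2 * n) → ℂ) :
    oddVec w ⬝ᵥ (ambMetric h).mulVec (oddVec w') =
      w ⬝ᵥ (Matrix.of fun i j => h (Sum.inr i) (Sum.inr j)).mulVec w' := by
  simp only [dotProduct, Matrix.mulVec, Matrix.of_apply]
  rw [sum_ambIdx]
  simp only [sum_ambIdx (fun b => ambMetric h _ b * oddVec w' b), oddVec_evenEmb,
    hh.ambMetric_odd_even]
  simp [oddVec, ambMetric]

theorem evenVec_dotProduct_oddVec (w : Fin 2 ⊕ Fin p → ℂ) (w' : Fin (2 * n) → ℂ) :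
    evenVec w ⬝ᵥ (ambMetric h).mulVec (oddVec w') = 0 := by
  simp only [dotProduct, Matrix.mulVec]
  rw [sum_ambIdx]
  simp only [sum_ambIdx (fun b => ambMetric h _ b * oddVec w' b), oddVec_evenEmb,
    hh.ambMetric_even_odd]
  simp [evenVec]

theorem oddVec_dotProduct_evenVec (w : Fin 2 ⊕ Fin p → ℂ) (w' : Fin (2 * n) → ℂ) :
    oddVec w' ⬝ᵥ (ambMetric h).mulVec (evenVec w) = 0 := by
  simp only [dotProduct, Matrix.mulVec]
  rw [sum_ambIdx]
  simp only [sum_ambIdx (fun b => ambMetric h _ b * evenVec w b), oddVec_evenEmb,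
    hh.ambMetric_odd_even]
  simp [evenVec]

theorem exists_even_frame : ∃ a b : Fin ((p + 2) / 2) → Fin 2 ⊕ Fin p → ℂ,
    (∀ k l, evenVec (a k) ⬝ᵥ (ambMetric h).mulVec (evenVec (a l)) = 0) ∧
    (∀ k l, evenVec (b k) ⬝ᵥ (ambMetric h).mulVec (evenVec (b l)) = 0) ∧
    ∀ k l, evenVec (a k) ⬝ᵥ (ambMetric h).mulVec (evenVec (b l)) = if k = l then 1 else 0 := by
  have hg := hh.ambMetric_isMetric
  simp only [evenVec_dotProduct hh]
  set G := Matrix.of fun i j => ambMetric h (evenEmb i) (evenEmb j)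
  have hG : (Matrix.of fun i j => upper (ambMetric h) (evenEmb j) (evenEmb i)) * G = 1 := by
    ext i j
    have := hg.upper_mul_left (evenEmb i) (evenEmb j)
    rw [sum_ambIdx] at this
    simp only [hh.ambMetric_odd_even, mul_zero, Finset.sum_const_zero, add_zero] at this
    rw [Matrix.mul_apply, Matrix.one_apply]
    refine Eq.trans this ?_
    have hinj : Function.Injective (evenEmb : Fin 2 ⊕ Fin p → AmbIdx p n) :=
      Function.injective_id.sumMap Sum.inl_injective
    simp only [hinj.eq_iff]
  obtain ⟨v, hv⟩ := exists_orthonormal (Matrix.IsSymm.ext fun i j => by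
    simp only [G, Matrix.of_apply]
    rw [hg.supersymm, ambPar_evenEmb, zero_mul, pow_zero, one_mul]) hG
  let e : Fin (p + 2) ≃ Fin 2 ⊕ Fin p := Fintype.equivOfCardEq (by simp [add_comm])
  have hv' : ∀ i j, v (e i) ⬝ᵥ G.mulVec (v (e j)) = if i = j then 1 else 0 := fun i j => by
    rw [hv]; simp only [e.injective.eq_iff]
  have hadd : ∀ (s t s' t' : ℂ) (i j k l : Fin (p + 2)),
      (s • v (e i) + t • v (e j)) ⬝ᵥ G.mulVec (s' • v (e k) + t' • v (e l)) =
      s * s' * (if i = k then 1 else 0) + s * t' * (if i = l then 1 else 0) +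
        t * s' * (if j = k then 1 else 0) + t * t' * (if j = l then 1 else 0) := by
    intro s t s' t' i j k l
    simp only [Matrix.mulVec_add, Matrix.mulVec_smul, add_dotProduct,
      dotProduct_add, smul_dotProduct, dotProduct_smul, smul_eq_mul, hv']
    ring
  let i0 : Fin ((p + 2) / 2) → Fin (p + 2) := fun k => ⟨2 * k, by omega⟩
  let i1 : Fin ((p + 2) / 2) → Fin (p + 2) := fun k => ⟨2 * k + 1, by omega⟩
  have h00 : ∀ k l, i0 k = i0 l ↔ k = l := fun k l => by
    simp only [i0, Fin.ext_iff]; omega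
  have h11 : ∀ k l, i1 k = i1 l ↔ k = l := fun k l => by
    simp only [i1, Fin.ext_iff]; omega
  have h01 : ∀ k l, ¬ i0 k = i1 l := fun k l => by
    simp only [i0, i1, Fin.mk.injEq]; omega
  have h10 : ∀ k l, ¬ i1 k = i0 l := fun k l => by
    simp only [i0, i1, Fin.mk.injEq]; omega
  -- The orthonormal vectors are paired off as numbers 2k and 2k + 1; for odd p one of them is left
  -- over.
  refine ⟨fun k => (1 : ℂ) • v (e (i0 k)) + Complex.I • v (e (i1 k)),
    fun k => (1 / 2 : ℂ) • v (e (i0 k)) + (-(Complex.I / 2)) • v (e (i1 k)), ?_, ?_, ?_⟩ <;>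
  · intro k l
    rw [hadd]
    simp only [h00, h11, h01, h10, if_false]
    split_ifs
    · ring_nf; simp only [Complex.I_sq]; norm_num
    · ring

theorem exists_odd_frame : ∃ x y : Fin n → Fin (2 * n) → ℂ,
    (∀ k l, oddVec (p := p) (x k) ⬝ᵥ (ambMetric h).mulVec (oddVec (x l)) = 0) ∧
    (∀ k l, oddVec (p := p) (y k) ⬝ᵥ (ambMetric h).mulVec (oddVec (y l)) = 0) ∧
    ∀ k l, oddVec (p := p) (x k) ⬝ᵥ (ambMetric h).mulVec (oddVec (y l)) =
      if k = l then 1 else 0 := by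
  simp only [oddVec_dotProduct hh]
  set G : Matrix (Fin (2 * n)) (Fin (2 * n)) ℂ := Matrix.of fun i j => h (Sum.inr i) (Sum.inr j)
  have hskew : G.transpose = -G := by
    ext i j
    simp only [G, Matrix.transpose_apply, Matrix.of_apply, Matrix.neg_apply]
    rw [hh.symm', sg_inr_inr, neg_one_mul]
  have hG : G * (Matrix.of fun i j => upper h (Sum.inr j) (Sum.inr i)) = 1 := by
    ext i j
    have := hh.upper_mul_right (Sum.inr i) (Sum.inr j)
    simp only [Fintype.sum_sum_type, hh.inr_inl, zero_mul, Finset.sum_const_zero, zero_add,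
      Sum.inr.injEq] at this
    rw [Matrix.mul_apply, Matrix.one_apply]
    exact this
  have key := exists_hyperbolic_of_alternating (Matrix.toBilin' G) (fun x => ?_) (fun x hx => ?_) n
    (by simp)
  · simpa only [Matrix.toBilin'_apply'] using key
  · rw [Matrix.toBilin'_apply']
    have h1 : x ⬝ᵥ G.mulVec x = -(x ⬝ᵥ G.mulVec x) := by
      conv_lhs => rw [Matrix.dotProduct_mulVec, ← Matrix.mulVec_transpose, hskew, Matrix.neg_mulVec,
        neg_dotProduct, dotProduct_comm]
    exact eq_zero_of_eq_neg h1
  · by_contra hcon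
    push Not at hcon
    apply hx
    have h1 : Matrix.vecMul x G = 0 := by
      funext i
      have := hcon (Pi.single i 1)
      rw [Matrix.toBilin'_apply', Matrix.dotProduct_mulVec, dotProduct_single_one] at this
      exact this
    have h2 := congrArg (fun y => Matrix.vecMul y
      (Matrix.of fun i j => upper h (Sum.inr j) (Sum.inr i))) h1
    simpa only [Matrix.vecMul_vecMul, hG, Matrix.vecMul_one, Matrix.zero_vecMul] using h2

theorem exists_isWittFrame : ∃ u v, IsWittFrame h u v := by
  obtain ⟨a, b, haa, hbb, hab⟩ := exists_even_frame hh
  obtain ⟨x, y, hxx, hyy, hxy⟩ := exists_odd_frame hh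
  have hpar : ∀ (a : Fin ((p + 2) / 2) → Fin 2 ⊕ Fin p → ℂ) (x : Fin n → Fin (2 * n) → ℂ)
      (k : Fin (rk p n)) (c : AmbIdx p n),
      ambPar p n c ≠ (if k.val < (p + 2) / 2 then 0 else 1) →
      (Fin.addCases (fun i => evenVec (a i)) (fun j => oddVec (x j)) k : AmbIdx p n → ℂ) c = 0 := by
    intro a x k
    refine Fin.addCases (fun k => ?_) (fun k => ?_) k
    · rw [Fin.addCases_left]
      rintro (c | c | c) hc
      · exact absurd (if_pos k.2).symm hc
      · exact absurd (if_pos k.2).symm hc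
      · rfl
    · rw [Fin.addCases_right]
      rintro (c | c | c) hc
      · rfl
      · rfl
      · exact absurd (if_neg (by rw [Fin.val_natAdd]; omega)).symm hc
  refine ⟨Fin.addCases (fun i => evenVec (a i)) (fun j => oddVec (x j)),
    Fin.addCases (fun i => evenVec (b i)) (fun j => oddVec (y j)), hpar a x, hpar b y, ?_, ?_, ?_⟩
  all_goals
    intro k l
    refine Fin.addCases (fun k => ?_) (fun k => ?_) k <;>
      refine Fin.addCases (fun l => ?_) (fun l => ?_) l <;>
      simp only [Fin.addCases_left, Fin.addCases_right, evenVec_dotProduct_oddVec hh,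
        oddVec_dotProduct_evenVec hh, haa, hbb, hab, hxx, hyy, hxy]
  · simp [Fin.ext_iff]
  · rw [if_neg]
    simp only [Fin.ext_iff, Fin.val_castAdd, Fin.val_natAdd]
    omega
  · rw [if_neg]
    simp only [Fin.ext_iff, Fin.val_castAdd, Fin.val_natAdd]
    omega
  · simp [Fin.ext_iff]

end OspHarm

/-! ### The highest weight vector on the null cone -/

namespace OspHarm
variable {p n : ℕ} {h : Matrix (Idx p n) (Idx p n) ℂ}

/-! Root vectors with respect to a Witt frame. -/

theorem IsMetric.vecMul_eq (hh : IsMetric (par p n) h) {e : ℕ} {u : AmbIdx p n → ℂ}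
    (hu : ∀ a, ambPar p n a ≠ e → u a = 0) :
    Matrix.vecMul u (ambMetric h) = (-1 : ℂ) ^ (e * e) • (ambMetric h).mulVec u := by
  funext b
  simp only [Matrix.vecMul, Matrix.mulVec, dotProduct, Pi.smul_apply, smul_eq_mul, Finset.mul_sum]
  refine Finset.sum_congr rfl fun a _ => ?_
  by_cases ha : ambPar p n a = e
  · have hg := hh.ambMetric_isMetric
    rw [hg.supersymm b a, hg.sign b a a, ha]
    ring
  · rw [hu a ha]; ring

theorem cartanElt_mem_osp (hh : IsMetric (par p n) h) {u v : Fin (rk p n) → AmbIdx p n → ℂ}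
    (hf : IsWittFrame h u v) (k : Fin (rk p n)) :
    cartanElt h u v k ∈ osp (ambPar p n) (ambMetric h) := by
  have hg := hh.ambMetric_isMetric
  have e : cartanElt h u v k = ∑ a, ∑ b, (u k a * v k b) • ospGen (ambPar p n) (ambMetric h) a b := by
    ext x c
    rw [cartanElt, hh.vecMul_eq (hf.parity_u k)]
    simp only [Matrix.sum_apply, Matrix.smul_apply, ospGen, smul_eq_mul, mul_sub,
      Finset.sum_sub_distrib, Matrix.sub_apply, Matrix.vecMulVec_apply, Pi.smul_apply]
    congr 1
    · simp only [mul_ite, mul_zero, Matrix.mulVec, dotProduct, Finset.mul_sum]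
      rw [Finset.sum_comm]
      refine Finset.sum_congr rfl fun b _ => ?_
      simp only [Finset.sum_ite_eq, Finset.mem_univ, if_true]
      ring
    · simp only [mul_ite, mul_zero, Matrix.mulVec, dotProduct, Finset.mul_sum]
      refine Finset.sum_congr rfl fun a _ => ?_
      simp only [Finset.sum_ite_eq, Finset.mem_univ, if_true]
      by_cases hx : v k x = 0
      · simp [hx]
      · by_cases ha : u k a = 0
        · simp [ha]
        · rw [not_imp_comm.1 (hf.parity_v k x) hx, not_imp_comm.1 (hf.parity_u k a) ha]
          split_ifs <;> ring
  rw [e]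
  exact Submodule.sum_mem _ fun a _ => Submodule.sum_mem _ fun b _ =>
    Submodule.smul_mem _ _ (hg.ospGen_mem a b)

theorem cartanElt_mulVec (u v : Fin (rk p n) → AmbIdx p n → ℂ) (k : Fin (rk p n))
    (w : AmbIdx p n → ℂ) : (cartanElt h u v k).mulVec w =
      (w ⬝ᵥ (ambMetric h).mulVec (v k)) • u k - (u k ⬝ᵥ (ambMetric h).mulVec w) • v k := by
  rw [cartanElt, Matrix.sub_mulVec, Matrix.vecMulVec_mulVec, Matrix.vecMulVec_mulVec,
    ← Matrix.dotProduct_mulVec, dotProduct_comm w, op_smul_eq_smul, op_smul_eq_smul]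

section
variable {u v : Fin (rk p n) → AmbIdx p n → ℂ} (hf : IsWittFrame h u v)
include hf

theorem IsWittFrame.cartanElt_u (k l : Fin (rk p n)) :
    (cartanElt h u v k).mulVec (u l) = (if l = k then (1 : ℂ) else 0) • u k := by
  rw [cartanElt_mulVec, hf.dual, hf.isotropic_u, zero_smul, sub_zero]

theorem IsWittFrame.cartanElt_v (k l : Fin (rk p n)) :
    (cartanElt h u v k).mulVec (v l) = -((if k = l then (1 : ℂ) else 0) • v k) := by
  rw [cartanElt_mulVec, hf.dual, hf.isotropic_v, zero_smul, zero_sub]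

/-- The image of one Cartan element is spanned by u_k and v_k, which the other one annihilates: no
weight of the natural representation has two nonzero coordinates. -/
theorem IsWittFrame.eq_zero_of_cartanElt {k l : Fin (rk p n)} (hkl : k ≠ l) {w : AmbIdx p n → ℂ}
    {c d : ℂ} (hc : c ≠ 0) (hd : d ≠ 0) (h1 : (cartanElt h u v k).mulVec w = c • w)
    (h2 : (cartanElt h u v l).mulVec w = d • w) : w = 0 := by
  have h3 : (cartanElt h u v l).mulVec ((cartanElt h u v k).mulVec w) = 0 := by
    rw [cartanElt_mulVec u v k, Matrix.mulVec_sub, Matrix.mulVec_smul, Matrix.mulVec_smul,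
      hf.cartanElt_u, hf.cartanElt_v, if_neg hkl, if_neg hkl.symm]
    simp
  rw [h1, Matrix.mulVec_smul, h2, smul_smul, smul_eq_zero] at h3
  exact h3.resolve_left (mul_ne_zero hc hd)

/-- A Cartan element C satisfies C³ = C, so 2 is not an eigenvalue. -/
theorem IsWittFrame.eq_zero_of_cartanElt_two {k : Fin (rk p n)} {w : AmbIdx p n → ℂ}
    (h1 : (cartanElt h u v k).mulVec w = (2 : ℂ) • w) : w = 0 := by
  have h3 : (cartanElt h u v k).mulVec ((cartanElt h u v k).mulVec
      ((cartanElt h u v k).mulVec w)) = (cartanElt h u v k).mulVec w := by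
    rw [cartanElt_mulVec u v k w]
    simp only [Matrix.mulVec_sub, Matrix.mulVec_smul, Matrix.mulVec_neg, hf.cartanElt_u,
      hf.cartanElt_v, if_true, one_smul, smul_neg, neg_neg]
  simp only [h1, Matrix.mulVec_smul, smul_smul] at h3
  have h4 : (6 : ℂ) • w = 0 := by
    rw [show (6 : ℂ) = 2 * 2 * 2 - 2 by norm_num, sub_smul, h3, sub_self]
  exact (smul_eq_zero.1 h4).resolve_left (by norm_num)

/-- A u_1 has weight α + ε_1. For a simple root α this has either a coordinate 2 at the first place
or two nonzero coordinates, so it is not a weight of the natural representation. -/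
theorem IsWittFrame.mulVec_eq_zero (hrk : 1 < rk p n) {α : Fin (rk p n) → ℂ}
    (hα : α ∈ simpleRoots p n) {A : Matrix (AmbIdx p n) (AmbIdx p n) ℂ}
    (hA : A ∈ rootSpace h u v α) : A.mulVec (u ⟨0, by omega⟩) = 0 := by
  set z : Fin (rk p n) := ⟨0, by omega⟩ with hz
  have key : ∀ k, (cartanElt h u v k).mulVec (A.mulVec (u z)) =
      (α k + if z = k then 1 else 0) • A.mulVec (u z) := by
    intro k
    have h1 := congrArg (fun M => M.mulVec (u z)) (hA.2 k)
    simp only [Matrix.sub_mulVec, ← Matrix.mulVec_mulVec, Matrix.smul_mulVec, hf.cartanElt_u,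
      Matrix.mulVec_smul] at h1
    rw [sub_eq_iff_eq_add] at h1
    rw [h1, add_smul]
    split_ifs with hk
    · rw [hk]
    · rw [zero_smul, zero_smul]
  rcases hα with ⟨k, l, hkl, rfl⟩ | ⟨k, hk, rfl⟩
  · have hkl' : k ≠ l := fun he => by rw [he] at hkl; omega
    have hlz : l ≠ z := fun he => by rw [he, hz] at hkl; simp at hkl
    by_cases hkz : k = z
    · refine hf.eq_zero_of_cartanElt_two (k := z) ((key z).trans ?_)
      subst hkz
      simp only [Pi.sub_apply, Pi.single_eq_same, Pi.single_eq_of_ne hkl', if_true]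
      norm_num
    · have h1 := key z
      have h2 := key k
      rw [Pi.sub_apply, Pi.single_eq_of_ne (Ne.symm hkz), Pi.single_eq_of_ne (Ne.symm hlz),
        if_pos rfl] at h1
      rw [Pi.sub_apply, Pi.single_eq_same, Pi.single_eq_of_ne hkl', if_neg (Ne.symm hkz)] at h2
      exact hf.eq_zero_of_cartanElt (Ne.symm hkz) (by norm_num) (by norm_num) h1 h2
  · have hkz : k ≠ z := fun he => by rw [he, hz] at hk; simp at hk; omega
    have h1 := key z
    have h2 := key k
    rw [if_pos rfl] at h1
    rw [if_neg (Ne.symm hkz)] at h2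
    split_ifs at h1 h2
    · rw [Pi.single_eq_of_ne (Ne.symm hkz)] at h1
      rw [Pi.single_eq_same] at h2
      exact hf.eq_zero_of_cartanElt (Ne.symm hkz) (by norm_num) (by norm_num) h1 h2
    · rw [Pi.single_eq_of_ne (Ne.symm hkz)] at h1
      rw [Pi.single_eq_same] at h2
      exact hf.eq_zero_of_cartanElt (Ne.symm hkz) (by norm_num) (by norm_num) h1 h2

end

/-- Conjugation by the parity, as often as the index `b` is odd. -/
def parityTwist (b : AmbIdx p n) (A : Matrix (AmbIdx p n) (AmbIdx p n) ℂ) :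
    Matrix (AmbIdx p n) (AmbIdx p n) ℂ := Matrix.of fun a c => asg a b * A a c * asg c b

theorem parityTwist_mem_osp (hh : IsMetric (par p n) h) (b : AmbIdx p n)
    {A : Matrix (AmbIdx p n) (AmbIdx p n) ℂ} (hA : A ∈ osp (ambPar p n) (ambMetric h)) :
    parityTwist b A ∈ osp (ambPar p n) (ambMetric h) := by
  have hg := hh.ambMetric_isMetric
  intro x y
  have h1 := congrArg (fun t => asg x b * asg y b * t) (hA x y)
  simp only [mul_zero, Finset.mul_sum] at h1
  rw [← h1]
  refine Finset.sum_congr rfl fun c _ => ?_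
  have e1 : asg c b * ambMetric h x c = asg x b * ambMetric h x c := (hg.sign x c b).symm
  have e2 : asg c b * ambMetric h c y = asg y b * ambMetric h c y := hg.sign c y b
  simp only [parityTwist, Matrix.of_apply]
  linear_combination (A c y * asg y b) * e1 +
    ((-1) ^ (ambPar p n y * (ambPar p n x + ambPar p n c)) * A c x * asg x b) * e2

namespace SuperWeyl
variable {V : Type} [Ring V] [Algebra ℂ V] (W : SuperWeyl p n V)

/-- Multiplication by the restriction of a linear form to the null cone. -/
def Pv (h : Matrix (Idx p n) (Idx p n) ℂ) (u : AmbIdx p n → ℂ) : Module.End ℂ V :=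
  ∑ a, u a • W.Phi h a

/-- The powers of the restriction of a linear form to the null cone. -/
def conePow (h : Matrix (Idx p n) (Idx p n) ℂ) (u : AmbIdx p n → ℂ) (k : ℕ) : V :=
  (W.Pv h u ^ k) 1

theorem conePow_succ (u : AmbIdx p n → ℂ) (k : ℕ) :
    W.conePow h u (k + 1) = W.Pv h u (W.conePow h u k) := by
  rw [conePow, pow_succ']; rfl

theorem Pv_apply (u : AmbIdx p n → ℂ) (f : V) : W.Pv h u f = ∑ a, u a • W.Phi h a f := by
  simp [Pv]

/-- The span of the products of `k` coordinates of the null cone. -/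
def coneSpan (h : Matrix (Idx p n) (Idx p n) ℂ) : ℕ → Submodule ℂ V
  | 0 => Submodule.span ℂ {1}
  | k + 1 => ⨆ a, (coneSpan h k).map (W.Phi h a)

theorem Phi_mem_coneSpan {k : ℕ} {f : V} (hf : f ∈ W.coneSpan h k) (a : AmbIdx p n) :
    W.Phi h a f ∈ W.coneSpan h (k + 1) :=
  Submodule.mem_iSup_of_mem a ⟨f, hf, rfl⟩

theorem coneSpan_succ_le {k : ℕ} {U : Submodule ℂ V}
    (hU : ∀ a, ∀ f ∈ W.coneSpan h k, W.Phi h a f ∈ U) : W.coneSpan h (k + 1) ≤ U :=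
  iSup_le fun a => by
    rintro _ ⟨f, hf, rfl⟩
    exact hU a f hf

theorem one_mem_coneSpan (k : ℕ) : (1 : V) ∈ W.coneSpan h k := by
  induction k with
  | zero => exact Submodule.mem_span_singleton_self _
  | succ k ih =>
    have := W.Phi_mem_coneSpan ih (Sum.inl 0)
    rwa [Phi_zero] at this

theorem conePow_mem_coneSpan (u : AmbIdx p n → ℂ) (k : ℕ) :
    W.conePow h u k ∈ W.coneSpan h k := by
  induction k with
  | zero => exact Submodule.mem_span_singleton_self _
  | succ k ih =>
    rw [conePow_succ, Pv_apply]
    exact Submodule.sum_mem _ fun a _ => Submodule.smul_mem _ _ (W.Phi_mem_coneSpan ih a)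

theorem Phi_mem_degLE (a : AmbIdx p n) {m : ℕ} {f : V} (hf : f ∈ W.degLE m) :
    W.Phi h a f ∈ W.degLE (m + 2) := by
  suffices W.degLE m ≤ (W.degLE (m + 2)).comap (W.Phi h a) from this hf
  refine W.degLE_le fun k hk f hf => ?_
  rw [Submodule.mem_comap]
  rcases a with a | a
  · fin_cases a
    · exact (W.Phi_zero (h := h) f).symm ▸ W.deg_le_degLE (by omega : k ≤ m + 2) hf
    · refine (W.Phi_one (h := h) f).symm ▸ Submodule.smul_mem _ _
        (W.deg_le_degLE (by omega : k + 2 ≤ m + 2) ?_)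
      rw [Nat.cast_add]
      exact W.R_mem_deg hf
  · refine W.deg_le_degLE (by omega : k + 1 ≤ m + 2) ?_
    rw [Nat.cast_add, Nat.cast_one]
    exact W.X_mem_deg hf a

theorem coneSpan_le_degLE (k : ℕ) : W.coneSpan h k ≤ W.degLE (2 * k) := by
  induction k with
  | zero =>
    refine (Submodule.span_singleton_le_iff_mem _ _).2 (W.deg_le_degLE le_rfl ?_)
    rw [mem_deg, euler_one]
    simp
  | succ k ih => exact W.coneSpan_succ_le fun a f hf => W.Phi_mem_degLE a (ih hf)

theorem densOp_zero_one (A : Matrix (AmbIdx p n) (AmbIdx p n) ℂ) : W.densOp h 0 A 1 = 0 := by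
  have : ∀ c : AmbIdx p n, W.nab 0 c 1 = 0 := by
    rintro (c | c)
    · fin_cases c
      · exact (W.nab_zero 0 1).trans (by rw [euler_one]; simp)
      · exact W.nab_one 0 1
    · exact W.pd_one c
  simp [densOp_apply, this]

variable (hh : IsMetric (par p n) h)
include hh

/-- The product rule with Φ_b moved to the left; the sign picked up on the way is encoded in
`parityTwist`, which keeps the matrix in the Lie superalgebra, so inductions on the number of
factors go through. -/
theorem densOp_Phi_eq {A : Matrix (AmbIdx p n) (AmbIdx p n) ℂ}
    (hA : A ∈ osp (ambPar p n) (ambMetric h)) (κ : ℂ) (b : AmbIdx p n) (f : V) :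
    W.densOp h κ A (W.Phi h b f) =
      W.Phi h b (W.densOp h (κ - 1) (parityTwist b A) f) + ∑ a, A a b • W.Phi h a f := by
  rw [W.densOp_Phi hh hA, densOp_apply, map_sum]
  congr 1
  refine Finset.sum_congr rfl fun a _ => ?_
  rw [map_sum]
  refine Finset.sum_congr rfl fun c _ => ?_
  rw [W.Phi_Phi hh a b, map_smul, smul_smul, parityTwist, Matrix.of_apply]
  congr 1
  ring

theorem densOp_mem_coneSpan {A : Matrix (AmbIdx p n) (AmbIdx p n) ℂ}
    (hA : A ∈ osp (ambPar p n) (ambMetric h)) {k : ℕ} {f : V} (hf : f ∈ W.coneSpan h k) :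
    W.densOp h k A f ∈ W.coneSpan h k := by
  suffices W.coneSpan h k ≤ (W.coneSpan h k).comap (W.densOp h k A) from this hf
  clear hf
  induction k generalizing A with
  | zero =>
    refine (Submodule.span_singleton_le_iff_mem _ _).2 ?_
    rw [Submodule.mem_comap, Nat.cast_zero, densOp_zero_one]
    exact Submodule.zero_mem _
  | succ k ih =>
    refine W.coneSpan_succ_le fun b f hf => ?_
    rw [Submodule.mem_comap, W.densOp_Phi_eq hh hA, Nat.cast_succ, add_sub_cancel_right]
    exact Submodule.add_mem _ (W.Phi_mem_coneSpan (ih (parityTwist_mem_osp hh b hA) hf) b)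
      (Submodule.sum_mem _ fun a _ => Submodule.smul_mem _ _ (W.Phi_mem_coneSpan hf a))

section
variable {u : AmbIdx p n → ℂ} (hu : ∀ a, ambPar p n a ≠ 0 → u a = 0)
include hu

theorem densOp_Pv {A : Matrix (AmbIdx p n) (AmbIdx p n) ℂ}
    (hA : A ∈ osp (ambPar p n) (ambMetric h)) (κ : ℂ) (f : V) :
    W.densOp h κ A (W.Pv h u f) =
      W.Pv h u (W.densOp h (κ - 1) A f) + W.Pv h (A.mulVec u) f := by
  simp only [Pv_apply, map_sum, map_smul, W.densOp_Phi_eq hh hA, smul_add, Finset.sum_add_distrib,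
    Matrix.mulVec, dotProduct, Finset.sum_smul, Finset.smul_sum, smul_smul]
  congr 1
  · refine Finset.sum_congr rfl fun b _ => ?_
    by_cases hb : ambPar p n b = 0
    · have : parityTwist b A = A := by
        ext a c
        simp [parityTwist, asg, hb]
      rw [this]
    · rw [hu b hb, zero_smul, zero_smul]
  · rw [Finset.sum_comm]
    simp only [mul_comm]

theorem densOp_conePow {A : Matrix (AmbIdx p n) (AmbIdx p n) ℂ}
    (hA : A ∈ osp (ambPar p n) (ambMetric h)) {c : ℂ} (hc : A.mulVec u = c • u) (k : ℕ) :
    W.densOp h k A (W.conePow h u k) = (k * c) • W.conePow h u k := by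
  induction k with
  | zero =>
    rw [Nat.cast_zero, zero_mul, zero_smul]
    exact W.densOp_zero_one A
  | succ k ih =>
    have e : ∀ f, W.Pv h (c • u) f = c • W.Pv h u f := fun f => by
      simp only [Pv_apply, Pi.smul_apply, smul_eq_mul, Finset.smul_sum, smul_smul]
    rw [conePow_succ, W.densOp_Pv hh hu hA, Nat.cast_succ, add_sub_cancel_right, ih, hc, e,
      map_smul]
    module

omit hh in
theorem Pv_eq (f : V) : W.Pv h u f = u (Sum.inl 0) • f - (u (Sum.inl 1) / 2) • W.R h f +
    W.Xv (fun i => u (Sum.inr (Sum.inl i))) f := by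
  have : ∀ j, u (Sum.inr (Sum.inr j)) = 0 := fun j => hu _ (by rw [ambPar_inr_inr]; decide)
  simp only [Pv_apply, Fintype.sum_sum_type, Fin.sum_univ_two, Phi_zero, Phi_one, Phi_inr, this,
    zero_smul, Finset.sum_const_zero, add_zero, Xv_apply]
  module

/-- The restricted linear form is a nonzero even polynomial plus a nilpotent, hence not a zero
divisor. -/
theorem Pv_injective {ξ η ζ : Fin p → ℂ} (ht : IsTriple h ξ η ζ) (hu0 : u ≠ 0) {f : V}
    (hf : W.Pv h u f = 0) : f = 0 := by
  set a : Fin p → ℂ := fun i => u (Sum.inr (Sum.inl i))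
  let P : MvPolynomial (Fin p) ℂ :=
    MvPolynomial.C (u (Sum.inl 0)) - (u (Sum.inl 1) / 2) • quadForm h + linForm a
  have hP : P ≠ 0 := by
    intro hP0
    have hev : ∀ x : Fin p → ℂ, u (Sum.inl 0) - u (Sum.inl 1) / 2 *
        (∑ i, ∑ j, upper h (Sum.inl i) (Sum.inl j) * (x i * x j)) + ∑ i, a i * x i = 0 := by
      intro x
      have := congrArg (MvPolynomial.eval x) hP0
      simpa [P, quadForm, linForm, MvPolynomial.smul_eval] using this
    have h0 : u (Sum.inl 0) = 0 := by simpa using hev 0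
    -- Comparing the values at e_i and -e_i isolates the linear coefficient.
    have ha : ∀ i, a i = 0 := fun i => by
      have h1 := hev (Pi.single i 1)
      have h2 := hev (-Pi.single i 1)
      simp only [Pi.neg_apply, neg_mul, mul_neg, neg_neg, Finset.sum_neg_distrib] at h2
      have h3 : ∑ k, a k * (Pi.single i 1 : Fin p → ℂ) k = a i := by simp [Pi.single_apply]
      rw [h3] at h1 h2
      linear_combination (h1 - h2) / 2
    have hlin : linForm a = 0 := by simp [linForm, ha]
    have h1 : u (Sum.inl 1) = 0 := by
      have h2 : (u (Sum.inl 1) / 2) • quadForm h = 0 := by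
        have : P = -((u (Sum.inl 1) / 2) • quadForm h) := by
          simp only [P, h0, hlin, map_zero, zero_sub, add_zero]
        rw [hP0] at this
        exact neg_eq_zero.1 this.symm
      have := (smul_eq_zero.1 h2).resolve_right (ht.quadForm_ne_zero hh)
      simpa using this
    apply hu0
    funext b
    rcases b with b | b | b
    · fin_cases b
      · exact h0
      · exact h1
    · exact ha b
    · exact hu _ (by rw [ambPar_inr_inr]; decide)
  refine W.eq_zero_of_body_add_mul hP
    (IsNilpotent.smul (W.oddSq_isNilpotent h) (-(u (Sum.inl 1) / 2))) ?_
  rw [← hf, W.Pv_eq hu, R_apply, W.rsq_eq hh, ← body_linForm_mul]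
  simp only [P, map_add, map_sub, map_smul, add_mul, sub_mul, smul_mul_assoc, smul_add]
  rw [← MvPolynomial.algebraMap_eq, AlgHom.commutes, ← Algebra.smul_def]
  module

theorem laplace_Pv (f : V) : W.laplace h (W.Pv h u f) = W.Pv h u (W.laplace h f) +
    ((2 : ℂ) • W.Dv h (fun i => u (Sum.inr (Sum.inl i))) f -
      u (Sum.inl 1) • ((2 : ℂ) • W.euler f + sdim p n • f)) := by
  simp only [W.Pv_eq hu, map_add, map_sub, map_smul, W.laplace_R hh, W.laplace_Xv hh]
  module

variable (hiso : u ⬝ᵥ (ambMetric h).mulVec u = 0)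
include hiso

omit hh in
theorem ip_eq_of_isotropic : ip h (fun i => u (Sum.inr (Sum.inl i)))
    (fun i => u (Sum.inr (Sum.inl i))) = -2 * u (Sum.inl 0) * u (Sum.inl 1) := by
  have hodd : ∀ j, u (Sum.inr (Sum.inr j)) = 0 := fun j => hu _ (by rw [ambPar_inr_inr]; decide)
  have e : u ⬝ᵥ (ambMetric h).mulVec u = 2 * u (Sum.inl 0) * u (Sum.inl 1) +
      ip h (fun i => u (Sum.inr (Sum.inl i))) (fun i => u (Sum.inr (Sum.inl i))) := by
    simp only [dotProduct, Matrix.mulVec, Fintype.sum_sum_type, Fin.sum_univ_two, hodd, zero_mul,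
      mul_zero, Finset.sum_const_zero, add_zero, ambMetric, Matrix.fromBlocks_apply₁₁,
      Matrix.fromBlocks_apply₁₂, Matrix.fromBlocks_apply₂₁, Matrix.fromBlocks_apply₂₂,
      Matrix.zero_apply, zero_add, ip, low, Finset.mul_sum]
    congr 1
    · simp
      ring
    · rw [Finset.sum_comm]
      refine Finset.sum_congr rfl fun i _ => Finset.sum_congr rfl fun j _ => ?_
      ring
  rw [hiso] at e
  linear_combination -e

/-- The left side is the commutator of Δ with multiplication by the restricted form, by
`laplace_Pv`. Because u is isotropic, passing it across one more factor only adds -4u_2. -/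
theorem conePow_aux (k : ℕ) :
    (2 : ℂ) • W.Dv h (fun i => u (Sum.inr (Sum.inl i))) (W.conePow h u k) -
      u (Sum.inl 1) • ((2 : ℂ) • W.euler (W.conePow h u k) + sdim p n • W.conePow h u k) =
      (-(u (Sum.inl 1) * (sdim p n + 4 * k))) • W.conePow h u k := by
  induction k with
  | zero =>
    have : W.conePow h u 0 = 1 := rfl
    rw [this, euler_one, Dv_apply]
    simp [D_apply, W.pd_one, smul_smul]
  | succ k ih =>
    rw [conePow_succ]
    set f := W.conePow h u k
    have hD : W.Dv h (fun i => u (Sum.inr (Sum.inl i))) (W.R h f) =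
        W.R h (W.Dv h (fun i => u (Sum.inr (Sum.inl i))) f) +
          (2 : ℂ) • W.Xv (fun i => u (Sum.inr (Sum.inl i))) f := by
      simp only [Dv_apply, Xv_apply, W.D_R hh, map_sum, map_smul, smul_add, Finset.sum_add_distrib,
        Finset.smul_sum, smul_comm (2 : ℂ)]
    have h1 : ∀ {f g : V} {c : ℂ}, f - g = c • g → f = g + c • g := fun hfg => by
      rw [← hfg]; abel
    have ih' := congrArg (W.Pv h u) ih
    have h2 : (2 : ℂ) • W.Dv h (fun i => u (Sum.inr (Sum.inl i))) (W.Pv h u f) -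
      u (Sum.inl 1) • ((2 : ℂ) • W.euler (W.Pv h u f) + sdim p n • W.Pv h u f) =
      W.Pv h u ((2 : ℂ) • W.Dv h (fun i => u (Sum.inr (Sum.inl i))) f -
      u (Sum.inl 1) • ((2 : ℂ) • W.euler f + sdim p n • f)) -
        (4 * u (Sum.inl 1)) • W.Pv h u f := by
      simp only [W.Pv_eq hu, map_add, map_sub, map_smul, W.Dv_Xv hh, hD, euler_R, euler_Xv,
        ip_eq_of_isotropic hu hiso]
      module
    rw [h2, ih, map_smul]
    push_cast
    module

/-- Summing the scalars M + 4i of `conePow_aux` over i ≤ k gives (k + 1)(M + 2k), which for k = q -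
1 and M = 2 - 2q is zero. -/
theorem laplace_conePow_succ (k : ℕ) : W.laplace h (W.conePow h u (k + 1)) =
    (-(u (Sum.inl 1) * ((k + 1) * (sdim p n + 2 * k)))) • W.conePow h u k := by
  induction k with
  | zero =>
    rw [conePow_succ, W.laplace_Pv hh hu, W.conePow_aux hh hu hiso]
    have : W.conePow h u 0 = 1 := rfl
    rw [this, laplace_eq_pd]
    simp [W.pd_one]
  | succ k ih =>
    rw [conePow_succ, W.laplace_Pv hh hu, W.conePow_aux hh hu hiso, ih, map_smul, ← conePow_succ]
    push_cast
    module

theorem conePow_mem_harm {q : ℕ} (hq : sdim p n = 2 - 2 * q) : W.conePow h u q ∈ W.harm h := by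
  rw [mem_harm]
  rcases q with _ | q
  · have : W.conePow h u 0 = 1 := rfl
    rw [this, laplace_eq_pd]
    simp [W.pd_one]
  · rw [W.laplace_conePow_succ hh hu hiso, hq]
    push_cast
    rw [show (2 - 2 * ((q : ℂ) + 1) + 2 * q) = 0 by ring]
    simp

end

/-- Since κ = q, this intersection is a submodule of the harmonic polynomials. It contains 1 and has
degrees at most 2q, so the classification leaves only the socle. -/
theorem coneSpan_inf_harm {q : ℕ} (hq : sdim p n = 2 - 2 * q) {ξ η ζ : Fin p → ℂ}
    (ht : IsTriple h ξ η ζ) : W.coneSpan h q ⊓ W.harm h = W.socle h q := by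
  have hst : Stable (W.confOps h) (W.coneSpan h q ⊓ W.harm h) := by
    rintro _ ⟨A, hA, rfl⟩ f hf
    refine ⟨?_, (W.isSubrep_harm hh).1 _ ⟨A, hA, rfl⟩ f hf.2⟩
    rw [confOp_eq, hq, show (1 - (2 - 2 * (q : ℂ)) / 2) = q by ring]
    exact W.densOp_mem_coneSpan hh hA hf.1
  rcases W.eq_bot_or_socle_or_harm hh hq ht inf_le_right hst with h1 | h1 | h1
  · exfalso
    have : (1 : V) ∈ W.coneSpan h q ⊓ W.harm h :=
      ⟨W.one_mem_coneSpan q, W.harmDeg_le_harm 0 W.one_mem_harmDeg⟩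
    rw [h1, Submodule.mem_bot] at this
    exact W.one_ne_zero' this
  · exact h1
  · exfalso
    have : W.linPow ξ (2 * q + 1) ∈ W.coneSpan h q ⊓ W.harm h := by
      rw [h1]
      exact W.harmDeg_le_harm _ (W.linPow_mem_harmDeg hh ht _)
    exact W.linPow_not_mem_degLE ht.ne_zero _ (W.coneSpan_le_degLE q this.1)

omit hh in
/-- Highest weight vectors. -/
def IsHighestWeightVector (W : SuperWeyl p n V) (h : Matrix (Idx p n) (Idx p n) ℂ)
    (u v : Fin (rk p n) → AmbIdx p n → ℂ) (μ : Fin (rk p n) → ℂ) (f : V) : Prop :=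
  f ≠ 0 ∧ (∀ k, W.confOp h (cartanElt h u v k) f = μ k • f) ∧
    ∀ α ∈ simpleRoots p n, ∀ A ∈ rootSpace h u v α, W.confOp h A f = 0

theorem isHighestWeightVector_conePow {q : ℕ} (hq : sdim p n = 2 - 2 * q) {ξ η ζ : Fin p → ℂ}
    (ht : IsTriple h ξ η ζ) (hrk : 1 < rk p n) {u v : Fin (rk p n) → AmbIdx p n → ℂ}
    (hf : IsWittFrame h u v) : ∃ f ∈ W.socle h q,
      W.IsHighestWeightVector h u v (qEps p n q) f := by
  set z : Fin (rk p n) := ⟨0, by omega⟩ with hz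
  have hu : ∀ a, ambPar p n a ≠ 0 → u z a = 0 := fun a ha => hf.parity_u z a (by
    rw [if_pos (by rw [hz]; exact Nat.div_pos (by omega) two_pos)]; exact ha)
  have hu0 : u z ≠ 0 := fun h0 => by
    have := hf.dual z z
    rw [h0, if_pos rfl, zero_dotProduct] at this
    exact zero_ne_one this
  have hop : ∀ A, W.confOp h A = W.densOp h q A := fun A => by
    rw [confOp_eq, hq, show (1 - (2 - 2 * (q : ℂ)) / 2) = q by ring]
  refine ⟨W.conePow h (u z) q, ?_, ?_, fun k => ?_, fun α hα A hA => ?_⟩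
  · rw [← W.coneSpan_inf_harm hh hq ht]
    exact ⟨W.conePow_mem_coneSpan _ _, W.conePow_mem_harm hh hu (hf.isotropic_u z z) hq⟩
  · have : ∀ k, W.conePow h (u z) k ≠ 0 := by
      intro k
      induction k with
      | zero => exact W.one_ne_zero'
      | succ k ih =>
        rw [conePow_succ]
        exact fun h0 => ih (W.Pv_injective hh hu ht hu0 h0)
    exact this q
  · rw [hop, W.densOp_conePow hh hu (cartanElt_mem_osp hh hf k)
      (c := if z = k then 1 else 0) (by
        rw [hf.cartanElt_u]
        split_ifs with hk
        · rw [hk]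
        · rw [zero_smul, zero_smul])]
    congr 1
    simp only [qEps, hz, Fin.ext_iff, eq_comm (a := (0 : ℕ))]
    split_ifs <;> simp
  · rw [hop, W.densOp_conePow hh hu hA.1 (c := 0) (by
      rw [zero_smul]; exact hf.mulVec_eq_zero hrk hα hA)]
    rw [mul_zero, zero_smul]

end SuperWeyl
end OspHarm

end

/-! ### The theorem for the concrete algebra of superpolynomials -/

theorem mainTheorem12 (p n : ℕ) (hp : 2 < p) (hn : 1 < n)
    (h : Matrix (OspHarm.Idx p n) (OspHarm.Idx p n) ℂ)
    (hh : OspHarm.IsMetric (OspHarm.par p n) h) :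
    OspHarm.IsSuperRepresentation h ∧
    OspHarm.IsSubrep (OspHarm.confOps h) (OspHarm.harm h) ∧
    ((∀ q : ℕ, (p : ℤ) - 2 * (n : ℤ) ≠ 2 - 2 * (q : ℤ)) →
      OspHarm.IsIrred (OspHarm.confOps h) (OspHarm.harm h)) ∧
    (∀ q : ℕ, (p : ℤ) - 2 * (n : ℤ) = 2 - 2 * (q : ℤ) →
      OspHarm.IsIndecomposable (OspHarm.confOps h) (OspHarm.harm h) ∧
      OspHarm.IsIrred (OspHarm.confOps h) (OspHarm.socle h q) ∧
      OspHarm.socle h q < OspHarm.harm h ∧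
      (∀ W ≤ OspHarm.harm h, OspHarm.IsStable (OspHarm.confOps h) W →
        W = ⊥ ∨ W = OspHarm.socle h q ∨ W = OspHarm.harm h) ∧
      (∀ j : Fin (2 * q + 1), OspHarm.IsIrred (OspHarm.rotOps h) (OspHarm.piece h q j)) ∧
      iSupIndep (fun j : Fin (2 * q + 1) => OspHarm.piece h q j) ∧
      OspHarm.IsK h (OspHarm.qEps p n q) (OspHarm.socle h q)) := by
  have hmet := hh.ambMetric_isMetric
  have hconf : ∀ A, OspHarm.confOp h A = (OspHarm.SPoly.superWeyl p n).densOp h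
      (1 - OspHarm.SuperWeyl.sdim p n / 2) A := (OspHarm.SPoly.superWeyl p n).confOp_eq h
  obtain ⟨ξ, η, ζ, ht⟩ := OspHarm.exists_isTriple hh hp
  refine ⟨⟨fun i A _ hi => ?_, fun i j A hA B hB hi hj => ?_⟩,
    (OspHarm.SPoly.superWeyl p n).isSubrep_harm hh,
    (OspHarm.SPoly.superWeyl p n).isIrred_harm hh, fun q hpq => ?_⟩
  · rw [hconf]
    exact (OspHarm.SPoly.superWeyl p n).densOp_parityOp hh hi _
  · refine ⟨OspHarm.superBracket_mem hA hB hi hj, ?_⟩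
    rw [hconf, hconf, hconf]
    exact (OspHarm.SPoly.superWeyl p n).densOp_superBracket hh hA hB hi hj _
  · have hq : OspHarm.SuperWeyl.sdim p n = 2 - 2 * q := by
      have : (((p : ℤ) - 2 * (n : ℤ) : ℤ) : ℂ) = ((2 - 2 * (q : ℤ) : ℤ) : ℂ) := by rw [hpq]
      push_cast at this
      exact this
    have hrk : 1 < OspHarm.rk p n := by
      have : 0 < (p + 2) / 2 := Nat.div_pos (by omega) two_pos
      unfold OspHarm.rk
      omega
    have hirr := (OspHarm.SPoly.superWeyl p n).isIrred_socle hh hq ht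
    exact ⟨(OspHarm.SPoly.superWeyl p n).isIndecomposable_harm hh hq ht, hirr,
      (OspHarm.SPoly.superWeyl p n).socle_lt_harm hh hq ht,
      fun U hU hst => (OspHarm.SPoly.superWeyl p n).eq_bot_or_socle_or_harm hh hq ht hU hst,
      (OspHarm.SPoly.superWeyl p n).isIrred_piece hh hq ht,
      (OspHarm.SPoly.superWeyl p n).iSupIndep_piece q, hirr, OspHarm.exists_isWittFrame hh,
      fun u v huv => (OspHarm.SPoly.superWeyl p n).isHighestWeightVector_conePow hh hq ht hrk huv⟩
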